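/- **Setting.** Let $(\Omega,\mathcal F,\mathbb P)$ be a probability space, $\theta:\Omega\to\Omega$ an invertible, bi-measurable, $\mathbb P$-preserving transformation, and $\mathcal F_0\subset\mathcal F$ a $\sigma$-algebra with $\mathcal F_0\subset\theta^{-1}(\mathcal F_0)$. Put $\mathcal F_n=\theta^{-n}(\mathcal F_0)$, $\mathbb E_n=\mathbb E(\cdot\mid\mathcal F_n)$ and $P_n=\mathbb E_n-\mathbb E_{n-1}$ for $n\in\mathbb Z$. Let $Y_0$ be a real $\mathcal F_0$-measurable random variable with law $P_{Y_0}$, and $Y_i=Y_0\circ\theta^i$. Write $Z^{(0)}=Z-\mathbb E(Z)$ and, for $n\ge 1$, $$\phi_{\mathbf Y}(n)=\sup_{i\ge n}\ \sup_{x\in\mathbb R}\Big\|\mathbb E\big((\mathbf 1_{Y_i\le x})^{(0)}\,\big|\,\mathcal F_0\big)^{(0)}\Big\|_\infty .$$ For a probability $\mu$ on $\mathbb R$, $1<p<\infty$ and $M>0$, let ${\rm Mon}_p(M,\mu)$ be the set of functions $\mathbb R\to\mathbb R$ that are monotonic on some interval, null elsewhere, and satisfy $\mu(|f|^p)\le M^p$;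 let ${\rm Mon}^c_p(M,\mu)$ be the closure in $L^p(\mu)$ of the set of finite sums $\sum_\ell a_\ell f_\ell$ with $\sum_\ell|a_\ell|\le 1$ and $f_\ell\in{\rm Mon}_p(M,\mu)$. For $X_i=f(Y_i)-\mathbb E(f(Y_i))$ put $S_n=X_0+\dots+X_{n-1}$, $\|X_0\|_{H_p}=\sum_{n\in\mathbb Z}\|P_nX_0\|_p$, $L=\max(1,\log)$, $$\mathcal M_p=\sup_{n\ge1}\frac{|S_n|}{n^{1/p}}\quad(1<p<2),\qquad \mathcal M_2=\sup_{n\ge1}\frac{|S_n|}{\sqrt{nL(L(n))}},$$ and $\|Z\|_{q,\infty}=\sup_{t>0}t\,\mathbb P(|Z|>t)^{1/q}$. **Theorem.** There exist constants $C_p>0$ $(1<p<2)$ and $C'_q>0$ $(1\le q<2)$, depending only on the index (not on the probability space, $\theta$, $\mathcal F_0$, $Y_0$ or $f$), such that the following holds in every setting as above. Let $1<p\le\infty$. Assume that $f\in{\rm Mon}^c_p(M,P_{Y_0})$ for some $M>0$ if $p<\infty$, and that $f:\mathbb R\to\mathbb R$ has bounded variation if $p=\infty$. Assume moreover that $$\sum_{k\ge1}\frac{\phi_{\mathbf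 Y}(k)^{(p-1)/p}}{\sqrt k}<\infty$$ (where $(p-1)/p=1$ if $p=\infty$). 1. If $1<p<2$, then $X_0\in L^p$, $\|X_0\|_{H_p}<\infty$, $\|\mathcal M_p\|_{p,\infty}\le C_p\|X_0\|_{H_p}$, and $|S_n|/n^{1/p}\to0$ $\mathbb P$-a.s. 2. If $p\ge2$ (including $p=\infty$), then $X_0\in L^2$, $\|X_0\|_{H_2}<\infty$, and $\|\mathcal M_2\|_{q,\infty}\le C'_q\|X_0\|_{H_2}$ for every $1\le q<2$. Moreover the series $d=\sum_{n\in\mathbb Z}P_1(X_n)$ converges (unconditionally) in $L^2(\Omega,\mathcal F_1,\mathbb P)$, $\mathbb E_0(d)=0$, and, writing $M_n=\sum_{k=0}^{n-1}d\circ\theta^k$, we have $|S_n-M_n|=o(\sqrt{nL(L(n))})$ $\mathbb P$-a.s. -/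

import Mathlib

open MeasureTheory Filter Topology Asymptotics
open scoped ENNReal NNReal

namespace PhiMixing

noncomputable section

variable {Ω : Type*}

/-- The integer iterate `θ ^ n` of an invertible bi-measurable transformation. -/
def iter [MeasurableSpace Ω] (θ : Ω ≃ᵐ Ω) (n : ℤ) : Ω → Ω :=
  ⇑((θ.toEquiv : Equiv.Perm Ω) ^ n)

/-- The `σ`-algebras `F n = θ⁻ⁿ (F0)`, for `n ∈ ℤ`. -/
abbrev filt (F0 : MeasurableSpace Ω) [MeasurableSpace Ω] (θ : Ω ≃ᵐ Ω) (n : ℤ) :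
    MeasurableSpace Ω :=
  F0.comap (iter θ n)

/-- The projection `P n Z = 𝔼(Z | F n) - 𝔼(Z | F (n - 1))`. -/
def proj [MeasurableSpace Ω] (μ : Measure Ω) (F : ℤ → MeasurableSpace Ω) (n : ℤ) (Z : Ω → ℝ) :
    Ω → ℝ :=
  μ[Z | F n] - μ[Z | F (n - 1)]

/-- The centred variable `Z - 𝔼(Z)`. -/
def center [MeasurableSpace Ω] (μ : Measure Ω) (Z : Ω → ℝ) : Ω → ℝ :=
  fun ω => Z ω - ∫ ω', Z ω' ∂μ

/-- `phi(m, Y) = sup over x of ‖(𝔼((1_{Y ≤ x})⁽⁰⁾ | m))⁽⁰⁾‖_∞`. -/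
def phi (m : MeasurableSpace Ω) [MeasurableSpace Ω] (μ : Measure Ω) (Y : Ω → ℝ) : ℝ≥0∞ :=
  ⨆ x : ℝ, eLpNorm
    (center μ (μ[center μ (Set.indicator {ω | Y ω ≤ x} (fun _ => (1 : ℝ))) | m])) ∞ μ

/-- The mixing coefficients `phi_Y(n) = sup over i ≥ n of phi(F0, Y ∘ θ ^ i)`. -/
def phiSeq (F0 : MeasurableSpace Ω) [MeasurableSpace Ω] (μ : Measure Ω) (θ : Ω ≃ᵐ Ω) (Y : Ω → ℝ)
    (n : ℕ) : ℝ≥0∞ :=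
  ⨆ i : ℕ, ⨆ _ : n ≤ i, phi F0 μ (Y ∘ iter θ i)

/-- `Mon_p(M, ν)`: functions that are monotonic on some interval, null elsewhere, and whose
norm in `L^p(ν)` is at most `M`. -/
def Mon (p : ℝ≥0∞) (M : ℝ) (ν : Measure ℝ) : Set (ℝ → ℝ) :=
  {f | (∃ I : Set ℝ, I.OrdConnected ∧ (MonotoneOn f I ∨ AntitoneOn f I) ∧ ∀ x ∉ I, f x = 0) ∧
    eLpNorm f p ν ≤ ENNReal.ofReal M}

/-- The finite combinations `∑ a l • f l` with `∑ |a l| ≤ 1` and `f l` in `Mon_p(M, ν)`. -/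
def MonComb (p : ℝ≥0∞) (M : ℝ) (ν : Measure ℝ) : Set (ℝ → ℝ) :=
  {g | ∃ (L : ℕ) (a : Fin L → ℝ) (f : Fin L → ℝ → ℝ),
    ∑ l, |a l| ≤ 1 ∧ (∀ l, f l ∈ Mon p M ν) ∧ g = fun x => ∑ l, a l * f l x}

/-- `Mon^c_p(M, ν)`: the closure of `MonComb p M ν` in `L^p(ν)`. -/
def MonClosure (p : ℝ≥0∞) (M : ℝ) (ν : Measure ℝ) : Set (ℝ → ℝ) :=
  {f | MemLp f p ν ∧ ∀ ε : ℝ≥0∞, 0 < ε → ∃ g ∈ MonComb p M ν, eLpNorm (f - g) p ν < ε}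

/-- `X i = f(Y i) - 𝔼(f(Y i))` with `Y i = Y ∘ θ ^ i`. -/
def proc [MeasurableSpace Ω] (μ : Measure Ω) (θ : Ω ≃ᵐ Ω) (Y : Ω → ℝ) (f : ℝ → ℝ) (i : ℤ) :
    Ω → ℝ :=
  center μ (fun ω => f (Y (iter θ i ω)))

/-- The partial sums `S n = X 0 + ... + X (n - 1)`. -/
def partialSum (X : ℤ → Ω → ℝ) (n : ℕ) (ω : Ω) : ℝ :=
  ∑ i ∈ Finset.range n, X i ω

/-- `L = max(1, log)`. -/
def L (x : ℝ) : ℝ := max 1 (Real.log x)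

/-- The maximal function `M_q`, `1 ≤ q < 2`: supremum over `n ≥ 1` of `|S n| / n ^ (1/q)`. -/
def maxFun (q : ℝ) (X : ℤ → Ω → ℝ) (ω : Ω) : ℝ≥0∞ :=
  ⨆ n : ℕ, ⨆ _ : 1 ≤ n, ENNReal.ofReal (|partialSum X n ω| / (n : ℝ) ^ (1 / q))

/-- The maximal function `M_2`: supremum over `n ≥ 1` of `|S n| / √(n L(L(n)))`. -/
def maxFunLIL (X : ℤ → Ω → ℝ) (ω : Ω) : ℝ≥0∞ :=
  ⨆ n : ℕ, ⨆ _ : 1 ≤ n, ENNReal.ofReal (|partialSum X n ω| / √((n : ℝ) * L (L (n : ℝ))))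

/-- The weak norm `‖Z‖_{q,∞} = sup over t > 0 of t μ(Z > t) ^ (1/q)` of a nonnegative `Z`. -/
def weakNorm [MeasurableSpace Ω] (μ : Measure Ω) (q : ℝ) (Z : Ω → ℝ≥0∞) : ℝ≥0∞ :=
  ⨆ t : ℝ≥0, (t : ℝ≥0∞) * (μ {ω | (t : ℝ≥0∞) < Z ω}) ^ (1 / q)

/-- The Hannan norm `‖Z‖_{H_p}`, the sum over `n ∈ ℤ` of `‖P n Z‖_p`. -/
def hannanNorm [MeasurableSpace Ω] (μ : Measure Ω) (F : ℤ → MeasurableSpace Ω) (p : ℝ≥0∞)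
    (Z : Ω → ℝ) : ℝ≥0∞ :=
  ∑' n : ℤ, eLpNorm (proj μ F n Z) p μ

/-- Maximal inequality and Marcinkiewicz-Zygmund strong law at exponent `q`,
with the constant `C` in the maximal inequality. -/
def MZConclusion [MeasurableSpace Ω] (μ : Measure Ω) (F : ℤ → MeasurableSpace Ω)
    (X : ℤ → Ω → ℝ) (q : ℝ) (C : ℝ) : Prop :=
  MemLp (X 0) (ENNReal.ofReal q) μ ∧
  hannanNorm μ F (ENNReal.ofReal q) (X 0) < ∞ ∧
  weakNorm μ q (maxFun q X) ≤ ENNReal.ofReal C * hannanNorm μ F (ENNReal.ofReal q) (X 0) ∧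
  ∀ᵐ ω ∂μ, Tendsto (fun n : ℕ => |partialSum X n ω| / (n : ℝ) ^ (1 / q)) atTop (𝓝 0)

/-- Maximal inequalities at the scale of the law of the iterated logarithm, with constants `C q`,
and almost sure approximation by the martingale with increments `d ∘ θ ^ k`, where
`d` is the sum in `L²` of the series of the `P 1 (X n)`, `n ∈ ℤ`. -/
def LILConclusion [MeasurableSpace Ω] (μ : Measure Ω) (θ : Ω ≃ᵐ Ω) (F : ℤ → MeasurableSpace Ω)
    (X : ℤ → Ω → ℝ) (C : ℝ → ℝ) : Prop :=
  MemLp (X 0) 2 μ ∧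
  hannanNorm μ F 2 (X 0) < ∞ ∧
  (∀ q : ℝ, 1 ≤ q → q < 2 →
    weakNorm μ q (maxFunLIL X) ≤ ENNReal.ofReal (C q) * hannanNorm μ F 2 (X 0)) ∧
  ∃ d : Ω → ℝ, StronglyMeasurable[F 1] d ∧ MemLp d 2 μ ∧
    Tendsto (fun s : Finset ℤ => eLpNorm (d - ∑ n ∈ s, proj μ F 1 (X n)) 2 μ) atTop (𝓝 0) ∧
    μ[d | F 0] =ᵐ[μ] 0 ∧
    ∀ᵐ ω ∂μ,
      (fun n : ℕ => partialSum X n ω - partialSum (fun k => d ∘ iter θ k) n ω)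
        =o[atTop] (fun n : ℕ => √((n : ℝ) * L (L (n : ℝ))))

end

end PhiMixing

/-! The process is decomposed into stationary martingale differences, and each limit theorem is
proved for one such sequence with a bound that can be summed over the decomposition.

Mixing enters once. The superlevel sets of a monotone function are half-lines, so `phi` controls the
conditional expectation of a bounded monotone function of `Y`. Truncating at a level that may depend
on `ω` extends this to unbounded functions: for `f` in `Mon_p` the `L^p` norm of `𝔼(f(Y_k) - 𝔼
f(Y_k) | F 0)` is at most a constant times `φ(k)^((p-1)/p)`. The bound passes to convex combinations
and to their closure; bounded variation is the case `p = ∞`, by the Jordan decomposition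
(`exists_eLpNorm_condExp_center_le`).

With `r = min(p, 2)` the hypothesis therefore gives `∑ ‖𝔼(X_k | F 0)‖_r / √k < ∞`, where by
stationarity `‖𝔼(X_k | F 0)‖_r = ‖𝔼(X_0 | F (-k))‖_r`. Uniform convexity of `|x|^r` gives
martingales in `L^r` cotype 2, so that `∑_{j ≥ J} ‖P_{-j} X_0‖_r²` is at most `C ‖𝔼(X_0 | F
(-J))‖_r²`. The Cauchy–Schwarz inequality on dyadic blocks and Cauchy condensation then yield
`‖X_0‖_{H_r} < ∞` and `X_0 = ∑ D_k` almost surely, with `D_k = P_{-k} X_0`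
(`tsum_eLpNorm_condExp_sub_ne_top`, `hannan_of_condExp`).

The maximal function of `X` is at most the sum of those of the `D_k`, and weak `L^q` is countably
subadditive up to a constant for `q > 1` (`exists_weakNorm_tsum_le`). A maximal inequality for one
sequence `d ∘ θ^i` of martingale differences is thus enough. For `p < 2` it follows from truncation
and Kolmogorov's inequality on dyadic blocks (`exists_tsum_measure_le`). At the scale of the
iterated logarithm it follows from truncation and an exponential inequality, the conditional
variances being controlled by Hopf's maximal ergodic inequality (`measure_lt_maxFunLIL_le`).

For the almost sure statements, the sum over `k` of the maximal functions of the `D_k` is finite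
almost surely, so limits may be taken term by term. In the martingale approximation `d = ∑ D_k ∘
θ^(k+1)`; for fixed `k` the partial sums of `D_k` and of its shift by `k + 1` differ by boundary
terms, which are `o(√n)`. -/

namespace PhiMixing

universe u

/-! ### Iterates of the transformation and the filtration they generate. -/

section Iter

variable {Ω : Type*} {m F0 : MeasurableSpace Ω} [mΩ : MeasurableSpace Ω] {μ : Measure Ω} (θ : Ω ≃ᵐ Ω)

@[simp] lemma iter_zero : iter θ 0 = id := by
  ext ω; simp [iter]

lemma iter_add (m n : ℤ) : iter θ (m + n) = iter θ m ∘ iter θ n := by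
  ext ω; simp [iter, zpow_add]

lemma iter_one : iter θ 1 = θ := by
  ext ω; simp [iter]

lemma iter_neg_one : iter θ (-1) = θ.symm := by
  ext ω
  simp only [iter, zpow_neg, zpow_one]
  rfl

/-- The integer iterate of a measurable equivalence, as a measurable equivalence. -/
def iterEquiv (hθ : ∀ n : ℤ, Measurable (iter θ n)) (n : ℤ) : Ω ≃ᵐ Ω where
  toEquiv := (θ.toEquiv : Equiv.Perm Ω) ^ n
  measurable_toFun := hθ n
  measurable_invFun := by
    have h := hθ (-n)
    rw [iter, zpow_neg] at h
    exact h

variable {θ} in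
lemma measurePreserving_iter (hθ : MeasurePreserving θ μ μ) (n : ℤ) :
    MeasurePreserving (iter θ n) μ μ := by
  induction n using Int.induction_on with
  | zero => rw [iter_zero]; exact MeasurePreserving.id μ
  | succ n ih => rw [iter_add, iter_one]; exact ih.comp hθ
  | pred n ih =>
    rw [sub_eq_add_neg, iter_add, iter_neg_one]
    exact ih.comp (MeasurePreserving.symm θ hθ)

variable {θ} in
lemma measurableEmbedding_iter (hθ : MeasurePreserving θ μ μ) (n : ℤ) :
    MeasurableEmbedding (iter θ n) :=
  (iterEquiv θ (fun n => (measurePreserving_iter hθ n).measurable) n).measurableEmbedding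

variable (m) in
lemma filt_zero : filt m θ 0 = m := by
  simp [filt]

variable (m) in
lemma filt_one : filt m θ 1 = m.comap θ := by
  rw [filt, iter_one]

variable (m) in
lemma filt_filt (i j : ℤ) : filt (filt m θ i) θ j = filt m θ (i + j) := by
  rw [filt, filt, filt, MeasurableSpace.comap_comp, iter_add]

variable {θ} in
lemma filt_le (hθ : MeasurePreserving θ μ μ) (hm : m ≤ mΩ) (n : ℤ) :
    filt m θ n ≤ mΩ := by
  rw [← measurable_iff_comap_le]
  exact (measurePreserving_iter hθ n).measurable.mono le_rfl hm

variable {θ} in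
lemma filt_mono (h : m ≤ m.comap θ) : Monotone (filt m θ) := by
  refine monotone_int_of_le_succ fun n => ?_
  have : filt m θ (n + 1) = filt (filt m θ 1) θ n := by rw [filt_filt, add_comm]
  rw [this, filt_one]
  exact MeasurableSpace.comap_mono h

variable {θ} in
lemma StronglyMeasurable.comp_iter {Z : Ω → ℝ}
    (hZ : StronglyMeasurable[m] Z) (n : ℤ) : StronglyMeasurable[filt m θ n] (Z ∘ iter θ n) :=
  hZ.comp_measurable (comap_measurable _)

end Iter

/-! ### Stationarity of conditional expectations, projections and norms. -/

section CondExp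

variable {Ω : Type*} {m F0 : MeasurableSpace Ω} [mΩ : MeasurableSpace Ω] {μ : Measure Ω}
  {θ : Ω ≃ᵐ Ω}

/-- Conditional expectations commute with measure-preserving iterates. -/
lemma condExp_comp_iter [IsProbabilityMeasure μ] (hθ : MeasurePreserving θ μ μ) (hm : m ≤ mΩ)
    (Z : Ω → ℝ) (n : ℤ) : μ[Z ∘ iter θ n | filt m θ n] =ᵐ[μ] μ[Z | m] ∘ iter θ n := by
  have hp := measurePreserving_iter hθ n
  have he := measurableEmbedding_iter hθ n
  by_cases hZ : Integrable Z μ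
  · symm
    refine ae_eq_condExp_of_forall_setIntegral_eq (filt_le hθ hm n)
      ((hp.integrable_comp_emb he).2 hZ)
      (fun s _ _ => ((hp.integrable_comp_emb he).2 integrable_condExp).integrableOn) ?_
      (stronglyMeasurable_condExp.comp_measurable
        (comap_measurable (m := m) (iter θ n))).aestronglyMeasurable
    rintro s ⟨t, ht, rfl⟩ -
    have h1 := hp.setIntegral_preimage_emb he (μ[Z | m]) t
    have h2 := hp.setIntegral_preimage_emb he Z t
    simp only [Function.comp_apply]
    rw [h1, h2, setIntegral_condExp hm hZ ht]
  · rw [condExp_of_not_integrable hZ, condExp_of_not_integrable]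
    · rfl
    · rwa [hp.integrable_comp_emb he]

lemma proj_comp_iter [IsProbabilityMeasure μ] (hθ : MeasurePreserving θ μ μ) (hm : F0 ≤ mΩ) (Z : Ω → ℝ) (k n : ℤ) :
    proj μ (filt F0 θ) (k + n) (Z ∘ iter θ n) =ᵐ[μ] proj μ (filt F0 θ) k Z ∘ iter θ n := by
  have h1 := condExp_comp_iter hθ (filt_le hθ hm k) Z n
  have h2 := condExp_comp_iter hθ (filt_le hθ hm (k - 1)) Z n
  rw [filt_filt] at h1 h2
  have e : k - 1 + n = k + n - 1 := by ring
  rw [e] at h2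
  filter_upwards [h1, h2] with ω h1 h2
  simp [proj, h1, h2]

lemma center_comp_iter (hθ : MeasurePreserving θ μ μ) (Z : Ω → ℝ) (n : ℤ) :
    center μ (Z ∘ iter θ n) = center μ Z ∘ iter θ n := by
  ext ω
  have := (measurePreserving_iter hθ n).integral_comp (measurableEmbedding_iter hθ n) Z
  simp [center, this]

lemma proc_eq (hθ : MeasurePreserving θ μ μ) (Y : Ω → ℝ) (f : ℝ → ℝ) :
    proc μ θ Y f = fun i => center μ (f ∘ Y) ∘ iter θ i := by
  ext i ω
  rw [← center_comp_iter hθ]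
  rfl

lemma eLpNorm_comp_iter (hθ : MeasurePreserving θ μ μ) (Z : Ω → ℝ) (p : ℝ≥0∞) (n : ℤ) :
    eLpNorm (Z ∘ iter θ n) p μ = eLpNorm Z p μ := by
  have := (measurableEmbedding_iter hθ n).eLpNorm_map_measure (μ := μ) (g := Z) (p := p)
  rw [(measurePreserving_iter hθ n).map_eq] at this
  exact this.symm

lemma lintegral_comp_iter (hθ : MeasurePreserving θ μ μ) (Z : Ω → ℝ≥0∞) (n : ℤ) :
    ∫⁻ ω, Z (iter θ n ω) ∂μ = ∫⁻ ω, Z ω ∂μ :=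
  (measurePreserving_iter hθ n).lintegral_comp_emb (measurableEmbedding_iter hθ n) Z

lemma ae_comp_iter (hθ : MeasurePreserving θ μ μ) {P : Ω → Prop} (h : ∀ᵐ ω ∂μ, P ω) (n : ℤ) :
    ∀ᵐ ω ∂μ, P (iter θ n ω) :=
  (measurePreserving_iter hθ n).quasiMeasurePreserving.ae h

end CondExp

/-! ### Doob's maximal inequalities for nonnegative processes. -/

section Maximal

variable {Ω : Type*} [mΩ : MeasurableSpace Ω] {μ : Measure Ω}

lemma measurableSet_forall_lt {G : Filtration ℕ mΩ} {W : ℕ → Ω → ℝ≥0∞}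
    (hW : ∀ i, Measurable[G i] (W i)) (ε : ℝ≥0∞) (n : ℕ) :
    MeasurableSet[G n] {ω | ∀ m ≤ n, W m ω < ε} := by
  have : {ω | ∀ m ≤ n, W m ω < ε} = ⋂ m ∈ Set.Iic n, {ω | W m ω < ε} := by
    ext; simp
  rw [this]
  refine MeasurableSet.biInter (Set.to_countable _) fun m hm => ?_
  exact G.mono hm _ (hW m measurableSet_Iio)

lemma setOf_exists_le_succ {Ω : Type*} (W : ℕ → Ω → ℝ≥0∞) (ε : ℝ≥0∞) (n : ℕ) :
    {ω | ∃ m ≤ n + 1, ε ≤ W m ω} = {ω | ∃ m ≤ n, ε ≤ W m ω} ∪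
      ({ω | ∀ m ≤ n, W m ω < ε} ∩ {ω | ε ≤ W (n + 1) ω}) := by
  ext ω
  simp only [Set.mem_ofPred_eq, Set.mem_union, Set.mem_inter_iff]
  constructor
  · rintro ⟨m, hm, h⟩
    by_cases h' : ∃ m ≤ n, ε ≤ W m ω
    · exact Or.inl h'
    · push Not at h'
      have : m = n + 1 := by
        by_contra hne
        exact absurd h (not_le.2 (h' m (by omega)))
      exact Or.inr ⟨h', this ▸ h⟩
  · rintro (⟨m, hm, h⟩ | ⟨-, h⟩)
    · exact ⟨m, by omega, h⟩
    · exact ⟨n + 1, le_rfl, h⟩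

lemma setOf_forall_lt_eq_union {Ω : Type*} (W : ℕ → Ω → ℝ≥0∞) (ε : ℝ≥0∞) (n : ℕ) :
    {ω | ∀ m ≤ n, W m ω < ε} = ({ω | ∀ m ≤ n, W m ω < ε} ∩ {ω | ε ≤ W (n + 1) ω}) ∪
      {ω | ∀ m ≤ n + 1, W m ω < ε} := by
  ext ω
  simp only [Set.mem_ofPred_eq, Set.mem_union, Set.mem_inter_iff]
  constructor
  · intro h
    by_cases h' : ε ≤ W (n + 1) ω
    · exact Or.inl ⟨h, h'⟩
    · refine Or.inr fun m hm => ?_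
      rcases Nat.le_succ_iff.1 hm with h1 | h1
      · exact h m h1
      · rw [h1]; exact not_le.1 h'
  · rintro (⟨h, -⟩ | h)
    · exact h
    · exact fun m hm => h m (by omega)

/-- Maximal inequality for nonnegative supermartingales. -/
lemma mul_measure_exists_le_of_supermartingale {G : Filtration ℕ mΩ} {W : ℕ → Ω → ℝ≥0∞}
    (hW : ∀ i, Measurable[G i] (W i))
    (hstep : ∀ i (B : Set Ω), MeasurableSet[G i] B → ∫⁻ ω in B, W (i + 1) ω ∂μ ≤ ∫⁻ ω in B, W i ω ∂μ)
    (ε : ℝ≥0∞) (n : ℕ) :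
    ε * μ {ω | ∃ m ≤ n, ε ≤ W m ω} ≤ ∫⁻ ω, W 0 ω ∂μ := by
  have hWm : ∀ i, Measurable (W i) := fun i => (hW i).mono (G.le i) le_rfl
  -- The strengthened claim also carries the mass of `W n` on the event that the level has not been
  -- reached. The hypothesis `hstep` moves that mass one step forward, and the part that crosses the
  -- level pays for the new piece of the event.
  suffices h : ε * μ {ω | ∃ m ≤ n, ε ≤ W m ω} + ∫⁻ ω in {ω | ∀ m ≤ n, W m ω < ε}, W n ω ∂μ ≤
      ∫⁻ ω, W 0 ω ∂μ from le_trans le_self_add h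
  induction n with
  | zero =>
    have hs : MeasurableSet {ω | ε ≤ W 0 ω} := hWm 0 measurableSet_Ici
    have hc : {ω | ∀ m ≤ 0, W m ω < ε} = {ω | ε ≤ W 0 ω}ᶜ := by ext; simp
    have hd : {ω | ∃ m ≤ 0, ε ≤ W m ω} = {ω | ε ≤ W 0 ω} := by ext; simp
    rw [hc, hd, ← lintegral_add_compl (μ := μ) (W 0) hs]
    refine add_le_add ?_ le_rfl
    rw [← setLIntegral_const]
    exact setLIntegral_mono (hWm 0) fun ω h => h
  | succ n ih =>
    refine le_trans ?_ ih
    have hB := (G.le n) _ (measurableSet_forall_lt hW ε n)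
    have hA : MeasurableSet ({ω | ∀ m ≤ n, W m ω < ε} ∩ {ω | ε ≤ W (n + 1) ω}) :=
      hB.inter (hWm (n + 1) measurableSet_Ici)
    have hB' := (G.le (n + 1)) _ (measurableSet_forall_lt hW ε (n + 1))
    have h1 : ∫⁻ ω in {ω | ∀ m ≤ n, W m ω < ε}, W (n + 1) ω ∂μ ≤
        ∫⁻ ω in {ω | ∀ m ≤ n, W m ω < ε}, W n ω ∂μ := hstep n _ (measurableSet_forall_lt hW ε n)
    refine le_trans ?_ (add_le_add_right h1 _)
    rw [setOf_forall_lt_eq_union W ε n, lintegral_union hB' _, setOf_exists_le_succ W ε n,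
      ← add_assoc]
    · refine add_le_add ?_ le_rfl
      refine (mul_le_mul_right (measure_union_le _ _) _).trans ?_
      rw [mul_add]
      gcongr
      rw [← setLIntegral_const]
      exact setLIntegral_mono (hWm _) fun ω h => h.2
    · rw [Set.disjoint_left]
      rintro ω ⟨-, h⟩ h'
      exact absurd h (not_le.2 (h' (n + 1) le_rfl))

/-- Maximal inequality for nonnegative submartingales. -/
lemma mul_measure_exists_le_of_submartingale {G : Filtration ℕ mΩ} {W : ℕ → Ω → ℝ≥0∞}
    (hW : ∀ i, Measurable[G i] (W i))
    (hstep : ∀ i (B : Set Ω), MeasurableSet[G i] B → ∫⁻ ω in B, W i ω ∂μ ≤ ∫⁻ ω in B, W (i + 1) ω ∂μ)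
    (ε : ℝ≥0∞) (n : ℕ) :
    ε * μ {ω | ∃ m ≤ n, ε ≤ W m ω} ≤ ∫⁻ ω, W n ω ∂μ := by
  have hWm : ∀ i, Measurable (W i) := fun i => (hW i).mono (G.le i) le_rfl
  -- The integral is localised to the event itself: this event belongs to `G n`, so `hstep` applies
  -- to it in the induction.
  suffices h : ε * μ {ω | ∃ m ≤ n, ε ≤ W m ω} ≤ ∫⁻ ω in {ω | ∃ m ≤ n, ε ≤ W m ω}, W n ω ∂μ from
    le_trans h (setLIntegral_le_lintegral _ _)
  induction n with
  | zero =>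
    have hd : {ω | ∃ m ≤ 0, ε ≤ W m ω} = {ω | ε ≤ W 0 ω} := by ext; simp
    rw [hd, ← setLIntegral_const]
    exact setLIntegral_mono (hWm 0) fun ω h => h
  | succ n ih =>
    have hB := measurableSet_forall_lt hW ε n
    have hA : MeasurableSet ({ω | ∀ m ≤ n, W m ω < ε} ∩ {ω | ε ≤ W (n + 1) ω}) :=
      (G.le n _ hB).inter (hWm (n + 1) measurableSet_Ici)
    have hC : MeasurableSet[G n] {ω | ∃ m ≤ n, ε ≤ W m ω} := by
      convert hB.compl using 1
      ext; simp
    rw [setOf_exists_le_succ W ε n, lintegral_union hA]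
    · refine (mul_le_mul_right (measure_union_le _ _) _).trans ?_
      rw [mul_add]
      refine add_le_add (ih.trans (hstep n _ hC)) ?_
      rw [← setLIntegral_const]
      exact setLIntegral_mono (hWm _) fun ω h => h.2
    · rw [Set.disjoint_left]
      rintro ω ⟨m, hm, h⟩ ⟨h', -⟩
      exact absurd h (not_le.2 (h' m hm))

end Maximal

/-! ### Kolmogorov and exponential inequalities for bounded martingale differences. -/

section MDS

variable {Ω : Type*} {m : MeasurableSpace Ω} [mΩ : MeasurableSpace Ω] {μ : Measure Ω}

lemma integral_mul_condExp [IsProbabilityMeasure μ] (hm : m ≤ mΩ) {K Z : Ω → ℝ} (hK : StronglyMeasurable[m] K)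
    (hKZ : Integrable (K * Z) μ) (hZ : Integrable Z μ) :
    ∫ ω, K ω * Z ω ∂μ = ∫ ω, K ω * (μ[Z | m]) ω ∂μ := by
  have h := condExp_mul_of_stronglyMeasurable_left hK hKZ hZ
  calc ∫ ω, K ω * Z ω ∂μ = ∫ ω, (μ[K * Z | m]) ω ∂μ := (integral_condExp hm).symm
    _ = _ := integral_congr_ae h

lemma integral_mul_eq_zero_of_condExp [IsProbabilityMeasure μ] (hm : m ≤ mΩ) {K Z : Ω → ℝ} (hK : StronglyMeasurable[m] K)
    (hKZ : Integrable (K * Z) μ) (hZ : Integrable Z μ) (h0 : μ[Z | m] =ᵐ[μ] 0) :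
    ∫ ω, K ω * Z ω ∂μ = 0 := by
  rw [integral_mul_condExp hm hK hKZ hZ, integral_eq_zero_of_ae]
  filter_upwards [h0] with ω h
  simp [h]

variable {G : Filtration ℕ mΩ} {ξ : ℕ → Ω → ℝ} {b : ℝ}

lemma integrable_of_ae_abs_le [IsProbabilityMeasure μ] {Z : Ω → ℝ} (hZ : AEStronglyMeasurable Z μ) {b : ℝ}
    (hb : ∀ᵐ ω ∂μ, |Z ω| ≤ b) : Integrable Z μ :=
  Integrable.of_bound hZ b hb

lemma stronglyMeasurable_sum_range (hξ : ∀ i, StronglyMeasurable[G (i + 1)] (ξ i)) (n : ℕ) :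
    StronglyMeasurable[G n] (fun ω => ∑ i ∈ Finset.range n, ξ i ω) := by
  refine Finset.stronglyMeasurable_fun_sum _ fun i hi => ?_
  exact (hξ i).mono (G.mono (Finset.mem_range.1 hi))

lemma ae_abs_sum_range_le (hb : ∀ i, ∀ᵐ ω ∂μ, |ξ i ω| ≤ b) (n : ℕ) :
    ∀ᵐ ω ∂μ, |∑ i ∈ Finset.range n, ξ i ω| ≤ n * b := by
  filter_upwards [ae_all_iff.2 hb] with ω h
  calc |∑ i ∈ Finset.range n, ξ i ω| ≤ ∑ i ∈ Finset.range n, |ξ i ω| :=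
        Finset.abs_sum_le_sum_abs _ _
    _ ≤ ∑ i ∈ Finset.range n, b := Finset.sum_le_sum fun i _ => h i
    _ = n * b := by simp

/-- Kolmogorov's maximal inequality for bounded martingale differences. -/
lemma measure_exists_abs_sum_ge_le [IsProbabilityMeasure μ] (hξ : ∀ i, StronglyMeasurable[G (i + 1)] (ξ i))
    (hb : ∀ i, ∀ᵐ ω ∂μ, |ξ i ω| ≤ b) (h0 : ∀ i, μ[ξ i | G i] =ᵐ[μ] 0) (x : ℝ≥0) (n : ℕ) :
    (x : ℝ≥0∞) ^ 2 * μ {ω | ∃ j ≤ n, (x : ℝ) ≤ |∑ i ∈ Finset.range j, ξ i ω|} ≤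
      ∑ i ∈ Finset.range n, ∫⁻ ω, ENNReal.ofReal (ξ i ω ^ 2) ∂μ := by
  set S : ℕ → Ω → ℝ := fun n ω => ∑ i ∈ Finset.range n, ξ i ω with hS
  have hSm := stronglyMeasurable_sum_range hξ
  have hSi : ∀ n, AEStronglyMeasurable (S n) μ := fun n =>
    ((hSm n).mono (G.le n)).aestronglyMeasurable
  have hξi : ∀ n, AEStronglyMeasurable (ξ n) μ := fun n =>
    ((hξ n).mono (G.le _)).aestronglyMeasurable
  have hSb := ae_abs_sum_range_le hb
  -- Orthogonality of increments: the cross term `2 * S i * ξ i` integrates to zero over any set of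
  -- `G i`. In particular `S ^ 2` is a submartingale, and its mean is the sum of the second moments.
  have key : ∀ i (B : Set Ω), MeasurableSet[G i] B →
      ∫⁻ ω in B, ENNReal.ofReal (S (i + 1) ω ^ 2) ∂μ =
      ∫⁻ ω in B, ENNReal.ofReal (S i ω ^ 2) ∂μ + ∫⁻ ω in B, ENNReal.ofReal (ξ i ω ^ 2) ∂μ := by
    intro i B hB
    have hBm := G.le i _ hB
    have i1 : Integrable (fun ω => S i ω ^ 2) μ := by
      refine integrable_of_ae_abs_le (b := (i * b) ^ 2) ((hSi i).pow 2) ?_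
      filter_upwards [hSb i] with ω h
      rw [abs_pow]; gcongr
    have i2 : Integrable (fun ω => ξ i ω ^ 2) μ := by
      refine integrable_of_ae_abs_le (b := b ^ 2) ((hξi i).pow 2) ?_
      filter_upwards [hb i] with ω h
      rw [abs_pow]; gcongr
    have i3 : Integrable ((B.indicator fun ω => 2 * S i ω) * ξ i) μ := by
      refine integrable_of_ae_abs_le (b := 2 * (i * b) * b)
        ((((hSi i).const_mul 2).indicator hBm).mul (hξi i)) ?_
      filter_upwards [hSb i, hb i] with ω h h'
      have hb0 : 0 ≤ b := (abs_nonneg _).trans h'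
      simp only [Pi.mul_apply, abs_mul]
      gcongr
      by_cases hω : ω ∈ B
      · simp only [Set.indicator_of_mem hω, abs_mul, abs_two]; gcongr
      · simp only [Set.indicator_of_notMem hω, abs_zero]; positivity
    have h3 : ∫ ω in B, 2 * S i ω * ξ i ω ∂μ = 0 := by
      rw [← integral_indicator hBm]
      have := integral_mul_eq_zero_of_condExp (G.le i)
        (K := B.indicator fun ω => 2 * S i ω) (Z := ξ i)
        (((hSm i).const_mul 2).indicator hB) i3 (integrable_of_ae_abs_le (hξi i) (hb i)) (h0 i)
      rw [← this]
      refine integral_congr_ae (ae_of_all _ fun ω => ?_)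
      by_cases hω : ω ∈ B <;> simp [hω]
    have i3' : IntegrableOn (fun ω => 2 * S i ω * ξ i ω) B μ := by
      rw [← integrable_indicator_iff hBm]
      refine i3.congr (ae_of_all _ fun ω => ?_)
      by_cases hω : ω ∈ B <;> simp [hω]
    have i4 : IntegrableOn (fun ω => S (i + 1) ω ^ 2) B μ := by
      refine ((i1.integrableOn.add i2.integrableOn).add i3').congr (ae_of_all _ fun ω => ?_)
      simp only [hS, Finset.sum_range_succ, Pi.add_apply]; ring
    rw [← ofReal_integral_eq_lintegral_ofReal i4 (ae_of_all _ fun ω => sq_nonneg _),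
      ← ofReal_integral_eq_lintegral_ofReal i1.integrableOn (ae_of_all _ fun ω => sq_nonneg _),
      ← ofReal_integral_eq_lintegral_ofReal i2.integrableOn (ae_of_all _ fun ω => sq_nonneg _),
      ← ENNReal.ofReal_add (integral_nonneg fun ω => sq_nonneg _)
        (integral_nonneg fun ω => sq_nonneg _), ← integral_add i1.integrableOn i2.integrableOn]
    congr 1
    have : ∫ ω in B, S (i + 1) ω ^ 2 ∂μ =
        ∫ ω in B, (S i ω ^ 2 + ξ i ω ^ 2) + 2 * S i ω * ξ i ω ∂μ := by
      refine integral_congr_ae (ae_of_all _ fun ω => ?_)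
      simp only [hS, Finset.sum_range_succ]; ring
    have hadd : Integrable (fun ω => S i ω ^ 2 + ξ i ω ^ 2) (μ.restrict B) :=
      i1.integrableOn.add i2.integrableOn
    rw [this, integral_add hadd i3', h3, add_zero]
  have hmax := mul_measure_exists_le_of_submartingale (μ := μ) (G := G)
    (W := fun i ω => ENNReal.ofReal (S i ω ^ 2))
    (fun i => ((hSm i).measurable.pow_const 2).ennreal_ofReal)
    (fun i B hB => by rw [key i B hB]; exact le_self_add) ((x : ℝ≥0∞) ^ 2) n
  have hset : ∀ ω, (∃ j ≤ n, (x : ℝ) ≤ |S j ω|) ↔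
      ∃ j ≤ n, (x : ℝ≥0∞) ^ 2 ≤ ENNReal.ofReal (S j ω ^ 2) := by
    intro ω
    refine exists_congr fun j => and_congr_right fun _ => ?_
    rw [← sq_abs (S j ω), ENNReal.ofReal_pow (abs_nonneg _), ENNReal.pow_le_pow_left_iff two_ne_zero,
      ← ENNReal.ofReal_coe_nnreal, ENNReal.ofReal_le_ofReal_iff (abs_nonneg _)]
  have hset' : {ω | ∃ j ≤ n, (x : ℝ) ≤ |S j ω|} =
      {ω | ∃ j ≤ n, (x : ℝ≥0∞) ^ 2 ≤ ENNReal.ofReal (S j ω ^ 2)} := Set.ext hset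
  change (x : ℝ≥0∞) ^ 2 * μ {ω | ∃ j ≤ n, (x : ℝ) ≤ |S j ω|} ≤ _
  rw [hset']
  refine hmax.trans ?_
  clear hmax hset hset'
  induction n with
  | zero => simp [hS]
  | succ n ih =>
    have := key n Set.univ MeasurableSet.univ
    simp only [Measure.restrict_univ] at this
    rw [this, Finset.sum_range_succ]
    gcongr

/-- Exponential inequality of Freedman type for bounded martingale differences. -/
lemma measure_exists_sum_ge_inter_le_exp [IsProbabilityMeasure μ]
    (hξ : ∀ i, StronglyMeasurable[G (i + 1)] (ξ i))
    (hb : ∀ i, ∀ᵐ ω ∂μ, |ξ i ω| ≤ b) (h0 : ∀ i, μ[ξ i | G i] =ᵐ[μ] 0)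
    {v : ℕ → Ω → ℝ} (hv : ∀ i, StronglyMeasurable[G i] (v i)) (hv0 : ∀ i ω, 0 ≤ v i ω)
    (hvar : ∀ i, μ[(ξ i) ^ 2 | G i] ≤ᵐ[μ] v i) {t : ℝ} (ht : 0 ≤ t) (htb : t * b ≤ 1)
    (x V : ℝ) (n : ℕ) :
    μ {ω | (∃ j ≤ n, x ≤ ∑ i ∈ Finset.range j, ξ i ω) ∧ ∑ i ∈ Finset.range n, v i ω ≤ V} ≤
      ENNReal.ofReal (Real.exp (-(t * x) + t ^ 2 * V)) := by
  have hb0 : 0 ≤ b := by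
    obtain ⟨ω, hω⟩ := (hb 0).exists
    exact (abs_nonneg _).trans hω
  set S : ℕ → Ω → ℝ := fun n ω => ∑ i ∈ Finset.range n, ξ i ω with hS
  set Q : ℕ → Ω → ℝ := fun n ω => ∑ i ∈ Finset.range n, v i ω with hQ
  have hSm : ∀ n, StronglyMeasurable[G n] (S n) := stronglyMeasurable_sum_range hξ
  have hQm' : ∀ n, StronglyMeasurable[G n] (Q (n + 1)) := fun n =>
    Finset.stronglyMeasurable_fun_sum _ fun i hi =>
      (hv i).mono (G.mono (by have := Finset.mem_range.1 hi; omega))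
  have hQm : ∀ n, StronglyMeasurable[G n] (Q n) := fun n =>
    Finset.stronglyMeasurable_fun_sum _ fun i hi =>
      (hv i).mono (G.mono (Finset.mem_range.1 hi).le)
  have hQ0 : ∀ n ω, 0 ≤ Q n ω := fun n ω => Finset.sum_nonneg fun i _ => hv0 i ω
  have hSb : ∀ n, ∀ᵐ ω ∂μ, |S n ω| ≤ n * b := ae_abs_sum_range_le hb
  have hξi : ∀ n, AEStronglyMeasurable (ξ n) μ := fun n =>
    ((hξ n).mono (G.le _)).aestronglyMeasurable
  have hW : ∀ i, StronglyMeasurable[G i] fun ω => Real.exp (t * S i ω - t ^ 2 * Q i ω) := fun i =>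
    Real.continuous_exp.comp_stronglyMeasurable
      (((hSm i).const_mul t).sub ((hQm i).const_mul (t ^ 2)))
  -- `exp (t * S i - t ^ 2 * Q i)` is a supermartingale starting at `1`. On the event considered, `Q
  -- j ≤ Q n ≤ V`, so at the time `j` of crossing it is at least `exp (t * x - t ^ 2 * V)`.
  have hmax := mul_measure_exists_le_of_supermartingale (μ := μ) (G := G)
    (W := fun i ω => ENNReal.ofReal (Real.exp (t * S i ω - t ^ 2 * Q i ω)))
    (fun i => (hW i).measurable.ennreal_ofReal) ?_
    (ENNReal.ofReal (Real.exp (t * x - t ^ 2 * V))) n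
  · have h1 : ∫⁻ ω, ENNReal.ofReal (Real.exp (t * S 0 ω - t ^ 2 * Q 0 ω)) ∂μ = 1 := by
      simp [hS, hQ]
    rw [h1] at hmax
    have hsub : {ω | (∃ j ≤ n, x ≤ S j ω) ∧ Q n ω ≤ V} ⊆
        {ω | ∃ j ≤ n, ENNReal.ofReal (Real.exp (t * x - t ^ 2 * V)) ≤
          ENNReal.ofReal (Real.exp (t * S j ω - t ^ 2 * Q j ω))} := by
      rintro ω ⟨⟨j, hj, h⟩, h'⟩
      refine ⟨j, hj, ENNReal.ofReal_le_ofReal (Real.exp_le_exp.2 ?_)⟩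
      have hQle : Q j ω ≤ V := le_trans
        (Finset.sum_le_sum_of_subset_of_nonneg (Finset.range_mono hj) fun i _ _ => hv0 i ω) h'
      have := mul_le_mul_of_nonneg_left h ht
      have := mul_le_mul_of_nonneg_left hQle (sq_nonneg t)
      linarith
    refine (measure_mono hsub).trans ?_
    have hpos : 0 < ENNReal.ofReal (Real.exp (t * x - t ^ 2 * V)) :=
      ENNReal.ofReal_pos.2 (Real.exp_pos _)
    rw [show -(t * x) + t ^ 2 * V = -(t * x - t ^ 2 * V) by ring, Real.exp_neg,
      ENNReal.ofReal_inv_of_pos (Real.exp_pos _)]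
    rw [mul_comm] at hmax
    exact (ENNReal.le_inv_iff_mul_le).2 hmax
  · intro i B hB
    have hBm := G.le i _ hB
    -- The compensator is taken at time `i + 1` although `K` must be `G i`-measurable: `Q (i + 1)`
    -- involves `v` only up to index `i`, so it is predictable. What remains is to compare the
    -- conditional mean of `exp (t * ξ i)` with `exp (t ^ 2 * v i)`.
    set K : Ω → ℝ := B.indicator fun ω => Real.exp (t * S i ω - t ^ 2 * Q (i + 1) ω) with hK
    have hKm : StronglyMeasurable[G i] K :=
      (Real.continuous_exp.comp_stronglyMeasurable
        (((hSm i).const_mul t).sub ((hQm' i).const_mul (t ^ 2)))).indicator hB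
    have hK0 : ∀ ω, 0 ≤ K ω := fun ω => Set.indicator_nonneg (fun ω _ => (Real.exp_pos _).le) ω
    have hKb : ∀ᵐ ω ∂μ, |K ω| ≤ Real.exp (t * (i * b)) := by
      filter_upwards [hSb i] with ω h
      rw [abs_of_nonneg (hK0 ω)]
      by_cases hω : ω ∈ B
      · simp only [hK, Set.indicator_of_mem hω, Real.exp_le_exp]
        have h1 := mul_le_mul_of_nonneg_left ((le_abs_self _).trans h) ht
        have h2 := mul_nonneg (sq_nonneg t) (hQ0 (i + 1) ω)
        linarith
      · simp only [hK, Set.indicator_of_notMem hω]; exact (Real.exp_pos _).le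
    have hKi : AEStronglyMeasurable K μ := (hKm.mono (G.le i)).aestronglyMeasurable
    have bint : ∀ {Z : Ω → ℝ} {c : ℝ}, AEStronglyMeasurable Z μ → (∀ᵐ ω ∂μ, |Z ω| ≤ c) →
        Integrable (K * Z) μ := by
      intro Z c hZ hc
      refine integrable_of_ae_abs_le (b := Real.exp (t * (i * b)) * c) (hKi.mul hZ) ?_
      filter_upwards [hKb, hc] with ω h1 h2
      rw [Pi.mul_apply, abs_mul]
      exact mul_le_mul h1 h2 (abs_nonneg _) (Real.exp_pos _).le
    have hξ2b : ∀ᵐ ω ∂μ, |(ξ i ^ 2) ω| ≤ b ^ 2 := by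
      filter_upwards [hb i] with ω h
      rw [Pi.pow_apply, abs_pow]; gcongr
    have i1 : Integrable (K * ξ i) μ := bint (hξi i) (hb i)
    have i2 : Integrable (K * ξ i ^ 2) μ := bint ((hξi i).pow 2) hξ2b
    have i3 : Integrable (K * μ[ξ i ^ 2 | G i]) μ :=
      bint integrable_condExp.aestronglyMeasurable (ae_bdd_abs_condExp_of_ae_bdd_abs hξ2b)
    have iK : Integrable K μ := integrable_of_ae_abs_le hKi hKb
    have e1 : ∫ ω, K ω * ξ i ω ∂μ = 0 := integral_mul_eq_zero_of_condExp (G.le i) hKm i1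
      (integrable_of_ae_abs_le (hξi i) (hb i)) (h0 i)
    have e2 := integral_mul_condExp (G.le i) hKm i2
      (integrable_of_ae_abs_le ((hξi i).pow 2) hξ2b)
    have hWi : ∀ j, Integrable (fun ω => Real.exp (t * S j ω - t ^ 2 * Q j ω)) μ := by
      intro j
      refine integrable_of_ae_abs_le (b := Real.exp (t * (j * b)))
        ((hW j).mono (G.le j)).aestronglyMeasurable ?_
      filter_upwards [hSb j] with ω h
      rw [abs_of_pos (Real.exp_pos _), Real.exp_le_exp]
      have h1 := mul_le_mul_of_nonneg_left ((le_abs_self _).trans h) ht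
      have h2 := mul_nonneg (sq_nonneg t) (hQ0 j ω)
      linarith
    rw [← ofReal_integral_eq_lintegral_ofReal (hWi _).integrableOn
        (ae_of_all _ fun ω => (Real.exp_pos _).le),
      ← ofReal_integral_eq_lintegral_ofReal (hWi _).integrableOn
        (ae_of_all _ fun ω => (Real.exp_pos _).le)]
    refine ENNReal.ofReal_le_ofReal ?_
    rw [← integral_indicator hBm, ← integral_indicator hBm]
    calc ∫ ω, B.indicator (fun ω => Real.exp (t * S (i + 1) ω - t ^ 2 * Q (i + 1) ω)) ω ∂μ
        ≤ ∫ ω, (K ω + t * (K ω * ξ i ω)) + t ^ 2 * (K ω * (ξ i ^ 2) ω) ∂μ := by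
          refine integral_mono_ae ((hWi _).indicator hBm)
            ((iK.add (i1.const_mul t)).add (i2.const_mul (t ^ 2))) ?_
          filter_upwards [hb i] with ω h
          by_cases hω : ω ∈ B
          · simp only [hK, Set.indicator_of_mem hω, Pi.pow_apply]
            have e : t * S (i + 1) ω - t ^ 2 * Q (i + 1) ω =
                (t * S i ω - t ^ 2 * Q (i + 1) ω) + t * ξ i ω := by
              simp only [hS, Finset.sum_range_succ]; ring
            rw [e, Real.exp_add]
            -- The restriction `t * b ≤ 1` serves here: `exp y ≤ 1 + y + y ^ 2` for `|y| ≤ 1`.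
            have hle : |t * ξ i ω| ≤ 1 := by
              rw [abs_mul, abs_of_nonneg ht]
              exact (mul_le_mul_of_nonneg_left h ht).trans htb
            have := (abs_le.1 (Real.abs_exp_sub_one_sub_id_le hle)).2
            have hexp : Real.exp (t * ξ i ω) ≤ 1 + t * ξ i ω + t ^ 2 * ξ i ω ^ 2 := by
              rw [mul_pow] at this; linarith
            refine (mul_le_mul_of_nonneg_left hexp (Real.exp_pos _).le).trans (le_of_eq ?_)
            ring
          · simp [hK, hω]
      _ = ∫ ω, K ω + t ^ 2 * (K ω * (μ[ξ i ^ 2 | G i]) ω) ∂μ := by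
          have i1' : Integrable (fun ω => t * (K ω * ξ i ω)) μ := i1.const_mul t
          have i2' : Integrable (fun ω => t ^ 2 * (K ω * (ξ i ^ 2) ω)) μ := i2.const_mul _
          have i3' : Integrable (fun ω => t ^ 2 * (K ω * (μ[ξ i ^ 2 | G i]) ω)) μ :=
            i3.const_mul _
          have i4 : Integrable (fun ω => K ω + t * (K ω * ξ i ω)) μ := iK.add i1'
          rw [integral_add i4 i2', integral_add iK i1', integral_add iK i3', integral_const_mul, integral_const_mul,
            integral_const_mul, e1, e2]
          ring
      _ ≤ ∫ ω, B.indicator (fun ω => Real.exp (t * S i ω - t ^ 2 * Q i ω)) ω ∂μ := by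
          refine integral_mono_ae (iK.add (i3.const_mul (t ^ 2))) ((hWi _).indicator hBm) ?_
          filter_upwards [hvar i] with ω h
          by_cases hω : ω ∈ B
          · simp only [hK, Set.indicator_of_mem hω]
            have e : t * S i ω - t ^ 2 * Q i ω =
                (t * S i ω - t ^ 2 * Q (i + 1) ω) + t ^ 2 * v i ω := by
              simp only [hQ, Finset.sum_range_succ]; ring
            rw [e, Real.exp_add]
            have h1 := Real.add_one_le_exp (t ^ 2 * v i ω)
            have h2 := mul_le_mul_of_nonneg_left h (sq_nonneg t)
            have h3 : 1 + t ^ 2 * (μ[ξ i ^ 2 | G i]) ω ≤ Real.exp (t ^ 2 * v i ω) := by linarith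
            refine le_trans (le_of_eq ?_) (mul_le_mul_of_nonneg_left h3 (Real.exp_pos _).le)
            ring
          · simp [hK, hω]

end MDS

/-! ### The maximal ergodic inequality. -/

section Hopf

variable {Ω : Type*} [mΩ : MeasurableSpace Ω] {μ : Measure Ω} {θ : Ω ≃ᵐ Ω}

/-- The running maximum of the partial sums along `θ`, defined by recursion. -/
noncomputable def runMax (θ : Ω ≃ᵐ Ω) (h : Ω → ℝ) : ℕ → Ω → ℝ
  | 0 => 0
  | n + 1 => fun ω => max 0 (h ω + runMax θ h n (θ ω))

lemma runMax_nonneg (h : Ω → ℝ) (n : ℕ) (ω : Ω) : 0 ≤ runMax θ h n ω := by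
  cases n with
  | zero => exact le_rfl
  | succ n => exact le_max_left _ _

lemma runMax_le_succ (h : Ω → ℝ) (n : ℕ) (ω : Ω) : runMax θ h n ω ≤ runMax θ h (n + 1) ω := by
  induction n generalizing ω with
  | zero => exact runMax_nonneg h 1 ω
  | succ n ih => exact max_le_max le_rfl (by have := ih (θ ω); linarith)

lemma sum_le_runMax (h : Ω → ℝ) {j n : ℕ} (hj : j ≤ n) (ω : Ω) :
    ∑ i ∈ Finset.range j, h (iter θ i ω) ≤ runMax θ h n ω := by
  induction n generalizing j ω with
  | zero =>
    obtain rfl : j = 0 := by omega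
    simp [runMax]
  | succ n ih =>
    cases j with
    | zero => simpa using runMax_nonneg h (n + 1) ω
    | succ j =>
      rw [Finset.sum_range_succ']
      have e : ∀ i : ℕ, iter θ ((i + 1 : ℕ) : ℤ) ω = iter θ i (θ ω) := by
        intro i
        rw [Nat.cast_succ, iter_add, iter_one]; rfl
      simp only [e, Nat.cast_zero, iter_zero, id]
      have := ih (j := j) (by omega) (θ ω)
      exact le_trans (by linarith) (le_max_right _ _)

lemma integrable_runMax (hθ : MeasurePreserving θ μ μ) {h : Ω → ℝ} (hh : Integrable h μ) (n : ℕ) :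
    Integrable (runMax θ h n) μ := by
  induction n with
  | zero => exact integrable_zero _ _ _
  | succ n ih =>
    have h1 : Integrable (fun ω => runMax θ h n (θ ω)) μ := hθ.integrable_comp_of_integrable ih
    exact (integrable_zero _ _ _).sup (hh.add h1)

/-- Hopf's maximal ergodic inequality. -/
lemma mul_measure_exists_lt_sum_le [IsProbabilityMeasure μ] (hθ : MeasurePreserving θ μ μ) {g : Ω → ℝ}
    (hg : Integrable g μ) (hg0 : ∀ ω, 0 ≤ g ω) (v : ℝ) (n : ℕ) :
    ENNReal.ofReal v * μ {ω | ∃ j ≤ n, v * j < ∑ i ∈ Finset.range j, g (iter θ i ω)} ≤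
      ∫⁻ ω, ENNReal.ofReal (g ω) ∂μ := by
  set h : Ω → ℝ := fun ω => g ω - v with hh
  have hhi : Integrable h μ := hg.sub (integrable_const v)
  set M := runMax θ h n with hM
  have hMi : Integrable M μ := integrable_runMax hθ hhi n
  have hMθ : Integrable (fun ω => M (θ ω)) μ := hθ.integrable_comp_of_integrable hMi
  have hA : NullMeasurableSet {ω | 0 < M ω} μ :=
    nullMeasurableSet_lt aemeasurable_const hMi.aemeasurable
  have hsub : {ω | ∃ j ≤ n, v * j < ∑ i ∈ Finset.range j, g (iter θ i ω)} ⊆ {ω | 0 < M ω} := by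
    rintro ω ⟨j, hj, hlt⟩
    refine lt_of_lt_of_le ?_ (sum_le_runMax h hj ω)
    simp only [hh, Finset.sum_sub_distrib, Finset.sum_const, Finset.card_range, nsmul_eq_mul]
    linarith
  -- Garsia's argument. Where `M > 0` the recursion gives `h ≥ M - M ∘ θ`, and elsewhere `M = 0`, so
  -- that `M - M ∘ θ ≤ 0`. Since `M - M ∘ θ` has integral zero, `h` has a nonnegative integral over
  -- `{M > 0}`.
  have h1 : 0 ≤ ∫ ω in {ω | 0 < M ω}, h ω ∂μ := by
    have e : ∫ ω, M ω - M (θ ω) ∂μ = 0 := by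
      rw [integral_sub hMi hMθ, hθ.integral_comp', sub_self]
    rw [← integral_indicator₀ hA]
    refine e.symm.le.trans ?_
    refine integral_mono (hMi.sub hMθ) (hhi.indicator₀ hA) fun ω => ?_
    by_cases hω : ω ∈ {ω | 0 < M ω}
    · rw [Set.indicator_of_mem hω]
      cases n with
      | zero => exact absurd (show (0 : ℝ) < 0 from hω) (lt_irrefl _)
      | succ n =>
        have hω' : 0 < M ω := hω
        have e1 : M ω = max 0 (h ω + runMax θ h n (θ ω)) := rfl
        have h2 : runMax θ h n (θ ω) ≤ M (θ ω) := runMax_le_succ h n (θ ω)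
        rcases max_choice 0 (h ω + runMax θ h n (θ ω)) with h3 | h3
        · rw [e1, h3] at hω'; exact absurd hω' (lt_irrefl _)
        · rw [h3] at e1; linarith
    · rw [Set.indicator_of_notMem hω]
      have : M ω ≤ 0 := not_lt.1 hω
      have := runMax_nonneg (θ := θ) h n (θ ω)
      linarith
  have h2 : v * μ.real {ω | 0 < M ω} ≤ ∫ ω, g ω ∂μ := by
    rw [integral_sub hg.integrableOn (integrable_const v), setIntegral_const, smul_eq_mul] at h1
    have := setIntegral_le_integral (s := {ω | 0 < M ω}) hg (ae_of_all _ hg0)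
    linarith
  rw [← ofReal_integral_eq_lintegral_ofReal hg (ae_of_all _ hg0)]
  refine (mul_le_mul_right (measure_mono hsub) _).trans ?_
  rcases le_total v 0 with hv | hv
  · simp [ENNReal.ofReal_of_nonpos hv]
  · rw [← ofReal_measureReal, ← ENNReal.ofReal_mul hv]
    exact ENNReal.ofReal_le_ofReal h2

lemma mul_measure_exists_lt_sum_le' [IsProbabilityMeasure μ] (hθ : MeasurePreserving θ μ μ) {g : Ω → ℝ}
    (hg : Integrable g μ) (hg0 : ∀ ω, 0 ≤ g ω) (v : ℝ) :
    ENNReal.ofReal v * μ {ω | ∃ j : ℕ, v * j < ∑ i ∈ Finset.range j, g (iter θ i ω)} ≤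
      ∫⁻ ω, ENNReal.ofReal (g ω) ∂μ := by
  have e : {ω | ∃ j : ℕ, v * j < ∑ i ∈ Finset.range j, g (iter θ i ω)} =
      ⋃ n : ℕ, {ω | ∃ j ≤ n, v * j < ∑ i ∈ Finset.range j, g (iter θ i ω)} := by
    ext ω
    simp only [Set.mem_ofPred_eq, Set.mem_iUnion]
    exact ⟨fun ⟨j, h⟩ => ⟨j, j, le_rfl, h⟩, fun ⟨_, j, _, h⟩ => ⟨j, h⟩⟩
  rw [e, Monotone.measure_iUnion, ENNReal.mul_iSup]
  · exact iSup_le fun n => mul_measure_exists_lt_sum_le hθ hg hg0 v n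
  · rintro a c hac ω ⟨j, hj, h⟩
    exact ⟨j, hj.trans hac, h⟩

end Hopf

/-! ### Truncation. -/

section Trunc

variable {Ω : Type*} {b : ℝ} {d : Ω → ℝ}

/-- The truncation of `d` at the level `b`. -/
noncomputable def trunc (b : ℝ) (d : Ω → ℝ) : Ω → ℝ := {ω | |d ω| ≤ b}.indicator d

lemma abs_trunc_le (hb : 0 ≤ b) (ω : Ω) : |trunc b d ω| ≤ b := by
  by_cases h : |d ω| ≤ b
  · simp [trunc, Set.indicator, h]
  · simp [trunc, Set.indicator, h, hb]

lemma abs_trunc_le_abs (ω : Ω) : |trunc b d ω| ≤ |d ω| := by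
  by_cases h : |d ω| ≤ b
  · simp [trunc, Set.indicator, h]
  · simp [trunc, Set.indicator, h]

lemma StronglyMeasurable.trunc {m' : MeasurableSpace Ω} (hd : StronglyMeasurable[m'] d) :
    StronglyMeasurable[m'] (trunc b d) :=
  hd.indicator (measurableSet_le (hd.norm.measurable) measurable_const)

end Trunc

/-! ### Maximal inequalities for stationary martingale differences after truncation. -/

section Stationary

variable {Ω : Type*} {m : MeasurableSpace Ω} [mΩ : MeasurableSpace Ω] {μ : Measure Ω}
  {θ : Ω ≃ᵐ Ω} {b : ℝ} {d : Ω → ℝ}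

/-- The filtration `θ⁻ⁿ m`, `n ∈ ℕ`. -/
def natFilt (hθ : MeasurePreserving θ μ μ) (hm : m ≤ mΩ) (hmθ : m ≤ m.comap θ) :
    Filtration ℕ mΩ where
  seq n := filt m θ n
  mono' _ _ h := filt_mono hmθ (Int.ofNat_le.2 h)
  le' n := filt_le hθ hm n

set_option linter.overlappingInstances false in
/-- The truncation of `d` at the level `b`, centred conditionally on `m`. -/
noncomputable def ctrunc (m : MeasurableSpace Ω) [MeasurableSpace Ω] (μ : Measure Ω) (b : ℝ)
    (d : Ω → ℝ) : Ω → ℝ := trunc b d - μ[trunc b d | m]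

lemma integrable_trunc [IsProbabilityMeasure μ] (hd : StronglyMeasurable d) (hb : 0 ≤ b) : Integrable (trunc b d) μ :=
  integrable_of_ae_abs_le (StronglyMeasurable.trunc hd).aestronglyMeasurable
    (ae_of_all _ fun ω => abs_trunc_le hb ω)

lemma memLp_trunc [IsProbabilityMeasure μ] (hd : StronglyMeasurable d) (hb : 0 ≤ b) : MemLp (trunc b d) 2 μ :=
  MemLp.of_bound (StronglyMeasurable.trunc hd).aestronglyMeasurable b
    (ae_of_all _ fun ω => abs_trunc_le hb ω)

lemma ae_abs_ctrunc_le (hb : 0 ≤ b) : ∀ᵐ ω ∂μ, |ctrunc m μ b d ω| ≤ 2 * b := by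
  have h := ae_bdd_abs_condExp_of_ae_bdd_abs (m := m) (μ := μ) (f := trunc b d) (R := b)
    (ae_of_all _ fun ω => abs_trunc_le hb ω)
  filter_upwards [h] with ω h
  have := abs_trunc_le (d := d) hb ω
  simp only [ctrunc, Pi.sub_apply]
  calc _ ≤ |trunc b d ω| + |(μ[trunc b d | m]) ω| := abs_sub _ _
    _ ≤ 2 * b := by linarith

lemma condExp_ctrunc [IsProbabilityMeasure μ] (hm : m ≤ mΩ) (hd : StronglyMeasurable d) (hb : 0 ≤ b) :
    μ[ctrunc m μ b d | m] =ᵐ[μ] 0 := by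
  refine (condExp_sub (integrable_trunc hd hb) integrable_condExp m).trans ?_
  rw [condExp_of_stronglyMeasurable hm stronglyMeasurable_condExp integrable_condExp, sub_self]

lemma condExp_ctrunc_sq_le [IsProbabilityMeasure μ] (hm : m ≤ mΩ) (hd : StronglyMeasurable d) (hb : 0 ≤ b) :
    μ[ctrunc m μ b d ^ 2 | m] ≤ᵐ[μ] μ[trunc b d ^ 2 | m] :=
  ProbabilityTheory.condVar_ae_le_condExp_sq hm (memLp_trunc hd hb)

/-- Centring conditionally cannot increase the second moment, because a conditional variance is at
most the conditional second moment. -/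
lemma lintegral_ctrunc_sq_le [IsProbabilityMeasure μ] (hm : m ≤ mΩ) (hd : StronglyMeasurable d) (hb : 0 ≤ b) :
    ∫⁻ ω, ENNReal.ofReal (ctrunc m μ b d ω ^ 2) ∂μ ≤ ∫⁻ ω, ‖trunc b d ω‖ₑ ^ 2 ∂μ := by
  have h2 := memLp_trunc (μ := μ) hd hb
  have hc : MemLp (ctrunc m μ b d) 2 μ := h2.sub (h2.condExp one_le_two)
  have e : ∀ ω, ‖trunc b d ω‖ₑ ^ 2 = ENNReal.ofReal (trunc b d ω ^ 2) := fun ω => by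
    rw [Real.enorm_eq_ofReal_abs, ← ENNReal.ofReal_pow (abs_nonneg _), sq_abs]
  simp only [e]
  rw [← ofReal_integral_eq_lintegral_ofReal hc.integrable_sq (ae_of_all _ fun ω => sq_nonneg _),
    ← ofReal_integral_eq_lintegral_ofReal h2.integrable_sq (ae_of_all _ fun ω => sq_nonneg _)]
  refine ENNReal.ofReal_le_ofReal ?_
  have e1 : ∫ ω, ctrunc m μ b d ω ^ 2 ∂μ = ∫ ω, (μ[ctrunc m μ b d ^ 2 | m]) ω ∂μ :=
    (integral_condExp hm).symm
  have e2 : ∫ ω, trunc b d ω ^ 2 ∂μ = ∫ ω, (μ[trunc b d ^ 2 | m]) ω ∂μ :=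
    (integral_condExp hm).symm
  rw [e1, e2]
  exact integral_mono_ae integrable_condExp integrable_condExp (condExp_ctrunc_sq_le hm hd hb)

/-- As `d` is conditionally centred, `d - ctrunc m μ b d` is `d - trunc b d` minus its own
conditional expectation. The `L¹` contraction bounds each of the two terms, hence the factor 2. -/
lemma lintegral_sub_ctrunc_le [IsProbabilityMeasure μ] (hd : StronglyMeasurable d) (hdi : Integrable d μ) (hb : 0 ≤ b)
    (h0 : μ[d | m] =ᵐ[μ] 0) :
    ∫⁻ ω, ‖d ω - ctrunc m μ b d ω‖ₑ ∂μ ≤ 2 * ∫⁻ ω, ‖d ω - trunc b d ω‖ₑ ∂μ := by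
  have hti := integrable_trunc (μ := μ) hd hb
  have e : (fun ω => d ω - ctrunc m μ b d ω) =ᵐ[μ] (d - trunc b d) - μ[d - trunc b d | m] := by
    filter_upwards [condExp_sub hdi hti m, h0] with ω h1 h2
    simp only [ctrunc, Pi.sub_apply, h1, h2, Pi.zero_apply]
    ring
  calc ∫⁻ ω, ‖d ω - ctrunc m μ b d ω‖ₑ ∂μ = eLpNorm (fun ω => d ω - ctrunc m μ b d ω) 1 μ :=
        eLpNorm_one_eq_lintegral_enorm.symm
    _ = eLpNorm ((d - trunc b d) - μ[d - trunc b d | m]) 1 μ := eLpNorm_congr_ae e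
    _ ≤ eLpNorm (d - trunc b d) 1 μ + eLpNorm (μ[d - trunc b d | m]) 1 μ :=
        eLpNorm_sub_le (hdi.sub hti).aestronglyMeasurable integrable_condExp.aestronglyMeasurable
          le_rfl
    _ ≤ 2 * eLpNorm (d - trunc b d) 1 μ := by
        rw [two_mul]
        gcongr
        exact eLpNorm_condExp_le_eLpNorm _ le_rfl
    _ = _ := by rw [eLpNorm_one_eq_lintegral_enorm]; rfl

/-- No cancellation is used: every partial sum is dominated by the sum of the absolute values, to
which Markov's inequality applies. This suffices for the part removed by truncation. -/
lemma mul_measure_exists_abs_sum_le {η : Ω → ℝ} (hθ : MeasurePreserving θ μ μ)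
    (hη : AEStronglyMeasurable η μ) (x : ℝ≥0) (n : ℕ) :
    (x : ℝ≥0∞) * μ {ω | ∃ j ≤ n, (x : ℝ) ≤ |∑ i ∈ Finset.range j, η (iter θ i ω)|} ≤
      n * ∫⁻ ω, ‖η ω‖ₑ ∂μ := by
  have hsub : {ω | ∃ j ≤ n, (x : ℝ) ≤ |∑ i ∈ Finset.range j, η (iter θ i ω)|} ⊆
      {ω | (x : ℝ≥0∞) ≤ ∑ i ∈ Finset.range n, ‖η (iter θ i ω)‖ₑ} := by
    rintro ω ⟨j, hj, h⟩
    have h1 : (x : ℝ≥0∞) ≤ ‖∑ i ∈ Finset.range j, η (iter θ i ω)‖ₑ := by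
      rw [Real.enorm_eq_ofReal_abs, ← ENNReal.ofReal_coe_nnreal]
      exact ENNReal.ofReal_le_ofReal h
    refine h1.trans ((enorm_sum_le _ _).trans ?_)
    exact Finset.sum_le_sum_of_subset (Finset.range_mono hj)
  have hm1 : ∀ i : ℕ, AEMeasurable (fun ω => ‖η (iter θ i ω)‖ₑ) μ := fun i =>
    (hη.comp_measurePreserving (measurePreserving_iter hθ i)).enorm
  refine (mul_le_mul_right (measure_mono hsub) _).trans ?_
  refine (mul_meas_ge_le_lintegral₀ (Finset.aemeasurable_fun_sum _ fun i _ => hm1 i) _).trans ?_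
  rw [lintegral_finsetSum' _ fun i _ => hm1 i]
  simp only [lintegral_comp_iter hθ (fun ω => ‖η ω‖ₑ), Finset.sum_const, Finset.card_range,
    nsmul_eq_mul, le_refl]

lemma stronglyMeasurable_ctrunc (hd : StronglyMeasurable[filt m θ 1] d) (hmθ : m ≤ m.comap θ) :
    StronglyMeasurable[filt m θ 1] (ctrunc m μ b d) := by
  refine (StronglyMeasurable.trunc hd).sub (stronglyMeasurable_condExp.mono ?_)
  rw [filt_one]; exact hmθ

lemma stronglyMeasurable_ctrunc_iter (hθ : MeasurePreserving θ μ μ) (hm : m ≤ mΩ) (hmθ : m ≤ m.comap θ)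
    (hd : StronglyMeasurable[filt m θ 1] d) (i : ℕ) :
    StronglyMeasurable[natFilt hθ hm hmθ (i + 1)] (ctrunc m μ b d ∘ iter θ i) := by
  have h := StronglyMeasurable.comp_iter (θ := θ) (stronglyMeasurable_ctrunc (μ := μ) (b := b) hd hmθ) i
  rw [filt_filt, add_comm] at h
  exact_mod_cast h

lemma condExp_ctrunc_iter [IsProbabilityMeasure μ] (hθ : MeasurePreserving θ μ μ) (hm : m ≤ mΩ) (hmθ : m ≤ m.comap θ)
    (hd : StronglyMeasurable d) (hb : 0 ≤ b) (i : ℕ) :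
    μ[ctrunc m μ b d ∘ iter θ i | natFilt hθ hm hmθ i] =ᵐ[μ] 0 := by
  refine (condExp_comp_iter hθ hm _ i).trans ?_
  filter_upwards [ae_comp_iter hθ (condExp_ctrunc hm hd hb) i] with ω h
  exact h

/-- Maximal inequality for stationary martingale differences, by truncation. -/
lemma measure_exists_abs_sum_le_trunc [IsProbabilityMeasure μ] (hθ : MeasurePreserving θ μ μ) (hm : m ≤ mΩ) (hmθ : m ≤ m.comap θ)
    (hd : StronglyMeasurable[filt m θ 1] d)
    (hdi : Integrable d μ) (h0 : μ[d | m] =ᵐ[μ] 0) (hb : 0 ≤ b) {x : ℝ≥0} (hx : 0 < x) (n : ℕ) :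
    μ {ω | ∃ j ≤ n, 2 * (x : ℝ) ≤ |∑ i ∈ Finset.range j, d (iter θ i ω)|} ≤
      (n : ℝ≥0∞) * (∫⁻ ω, ‖trunc b d ω‖ₑ ^ 2 ∂μ) / (x : ℝ≥0∞) ^ 2 +
      2 * (n : ℝ≥0∞) * (∫⁻ ω, ‖d ω - trunc b d ω‖ₑ ∂μ) / x := by
  have hd' : StronglyMeasurable d := hd.mono (filt_le hθ hm 1)
  set ξ := ctrunc m μ b d with hξ
  have hξm : StronglyMeasurable ξ :=
    (stronglyMeasurable_ctrunc hd hmθ).mono (filt_le hθ hm 1)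
  -- The level `2 * x` is shared equally between the bounded martingale part `ξ`, treated by
  -- Kolmogorov's inequality, and the remainder `d - ξ`, treated in `L¹`.
  have hsub : {ω | ∃ j ≤ n, 2 * (x : ℝ) ≤ |∑ i ∈ Finset.range j, d (iter θ i ω)|} ⊆
      {ω | ∃ j ≤ n, (x : ℝ) ≤ |∑ i ∈ Finset.range j, (ξ ∘ iter θ i) ω|} ∪
      {ω | ∃ j ≤ n, (x : ℝ) ≤ |∑ i ∈ Finset.range j, (d - ξ) (iter θ i ω)|} := by
    rintro ω ⟨j, hj, h⟩
    have e : ∑ i ∈ Finset.range j, d (iter θ i ω) = ∑ i ∈ Finset.range j, (ξ ∘ iter θ i) ω +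
        ∑ i ∈ Finset.range j, (d - ξ) (iter θ i ω) := by
      rw [← Finset.sum_add_distrib]; simp
    by_cases h1 : (x : ℝ) ≤ |∑ i ∈ Finset.range j, (ξ ∘ iter θ i) ω|
    · exact Or.inl ⟨j, hj, h1⟩
    · refine Or.inr ⟨j, hj, ?_⟩
      rw [e] at h
      have := abs_add_le (∑ i ∈ Finset.range j, (ξ ∘ iter θ i) ω)
        (∑ i ∈ Finset.range j, (d - ξ) (iter θ i ω))
      linarith
  have hx0 : (x : ℝ≥0∞) ≠ 0 := by exact_mod_cast hx.ne'
  refine (measure_mono hsub).trans ((measure_union_le _ _).trans (add_le_add ?_ ?_))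
  · rw [ENNReal.le_div_iff_mul_le (Or.inl (pow_ne_zero 2 hx0))
      (Or.inl (ENNReal.pow_ne_top ENNReal.coe_ne_top)), mul_comm]
    refine (measure_exists_abs_sum_ge_le (G := natFilt hθ hm hmθ) (b := 2 * b)
      (stronglyMeasurable_ctrunc_iter hθ hm hmθ hd)
      (fun i => ae_comp_iter hθ (ae_abs_ctrunc_le hb) i)
      (condExp_ctrunc_iter hθ hm hmθ hd' hb) x n).trans ?_
    have e : ∀ i : ℕ, ∫⁻ ω, ENNReal.ofReal ((ξ ∘ iter θ i) ω ^ 2) ∂μ =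
        ∫⁻ ω, ENNReal.ofReal (ξ ω ^ 2) ∂μ := fun i =>
      lintegral_comp_iter hθ (fun ω => ENNReal.ofReal (ξ ω ^ 2)) i
    rw [Finset.sum_congr rfl fun i _ => e i, Finset.sum_const, Finset.card_range, nsmul_eq_mul]
    exact mul_le_mul_right (lintegral_ctrunc_sq_le hm hd' hb) _
  · rw [ENNReal.le_div_iff_mul_le (Or.inl hx0) (Or.inl ENNReal.coe_ne_top), mul_comm]
    refine (mul_measure_exists_abs_sum_le hθ (hd'.sub hξm).aestronglyMeasurable x n).trans ?_
    rw [mul_comm 2 (n : ℝ≥0∞), mul_assoc]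
    gcongr
    exact lintegral_sub_ctrunc_le hd' hdi hb h0

/-- Exponential maximal inequality for stationary martingale differences, by truncation. -/
lemma measure_exists_abs_sum_inter_le_exp [IsProbabilityMeasure μ] (hθ : MeasurePreserving θ μ μ) (hm : m ≤ mΩ) (hmθ : m ≤ m.comap θ)
    (hd : StronglyMeasurable[filt m θ 1] d)
    (hd2 : MemLp d 2 μ) (h0 : μ[d | m] =ᵐ[μ] 0) (hb : 0 ≤ b) {g : Ω → ℝ}
    (hg : StronglyMeasurable[m] g) (hg0 : ∀ ω, 0 ≤ g ω) (hgd : μ[d ^ 2 | m] ≤ᵐ[μ] g)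
    {t : ℝ} (ht : 0 ≤ t) (htb : t * (2 * b) ≤ 1) {x : ℝ≥0} (hx : 0 < x) (V : ℝ) (n : ℕ) :
    μ {ω | (∃ j ≤ n, 2 * (x : ℝ) ≤ |∑ i ∈ Finset.range j, d (iter θ i ω)|) ∧
        ∑ i ∈ Finset.range n, g (iter θ i ω) ≤ V} ≤
      2 * ENNReal.ofReal (Real.exp (-(t * x) + t ^ 2 * V)) +
      2 * (n : ℝ≥0∞) * (∫⁻ ω, ‖d ω - trunc b d ω‖ₑ ∂μ) / x := by
  have hd' : StronglyMeasurable d := hd.mono (filt_le hθ hm 1)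
  have hdi : Integrable d μ := hd2.integrable one_le_two
  set ξ := ctrunc m μ b d with hξ
  have hξm : StronglyMeasurable ξ :=
    (stronglyMeasurable_ctrunc hd hmθ).mono (filt_le hθ hm 1)
  -- The exponential inequality is one-sided, so it is applied to `ξ` and to `-ξ`; this is the
  -- factor 2 in front of the exponential.
  have hsub : {ω | (∃ j ≤ n, 2 * (x : ℝ) ≤ |∑ i ∈ Finset.range j, d (iter θ i ω)|) ∧
        ∑ i ∈ Finset.range n, g (iter θ i ω) ≤ V} ⊆
      ({ω | (∃ j ≤ n, (x : ℝ) ≤ ∑ i ∈ Finset.range j, (ξ ∘ iter θ i) ω) ∧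
        ∑ i ∈ Finset.range n, (g ∘ iter θ i) ω ≤ V} ∪
      {ω | (∃ j ≤ n, (x : ℝ) ≤ ∑ i ∈ Finset.range j, (-(ξ ∘ iter θ i)) ω) ∧
        ∑ i ∈ Finset.range n, (g ∘ iter θ i) ω ≤ V}) ∪
      {ω | ∃ j ≤ n, (x : ℝ) ≤ |∑ i ∈ Finset.range j, (d - ξ) (iter θ i ω)|} := by
    rintro ω ⟨⟨j, hj, h⟩, hV⟩
    have e : ∑ i ∈ Finset.range j, d (iter θ i ω) = ∑ i ∈ Finset.range j, (ξ ∘ iter θ i) ω +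
        ∑ i ∈ Finset.range j, (d - ξ) (iter θ i ω) := by
      rw [← Finset.sum_add_distrib]; simp
    by_cases h1 : (x : ℝ) ≤ |∑ i ∈ Finset.range j, (ξ ∘ iter θ i) ω|
    · refine Or.inl ?_
      rcases le_abs.1 h1 with h2 | h2
      · exact Or.inl ⟨⟨j, hj, h2⟩, hV⟩
      · refine Or.inr ⟨⟨j, hj, ?_⟩, hV⟩
        simpa only [Pi.neg_apply, Finset.sum_neg_distrib] using h2
    · refine Or.inr ⟨j, hj, ?_⟩
      rw [e] at h
      have := abs_add_le (∑ i ∈ Finset.range j, (ξ ∘ iter θ i) ω)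
        (∑ i ∈ Finset.range j, (d - ξ) (iter θ i ω))
      linarith
  have hx0 : (x : ℝ≥0∞) ≠ 0 := by exact_mod_cast hx.ne'
  have hvar : ∀ i : ℕ, μ[(ξ ∘ iter θ i) ^ 2 | natFilt hθ hm hmθ i] ≤ᵐ[μ] g ∘ iter θ i := by
    intro i
    have h1 := condExp_comp_iter hθ hm (ξ ^ 2) i
    have h2 : μ[ξ ^ 2 | m] ≤ᵐ[μ] g := by
      refine (condExp_ctrunc_sq_le hm hd' hb).trans (EventuallyLE.trans ?_ hgd)
      refine condExp_mono (memLp_trunc hd' hb).integrable_sq hd2.integrable_sq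
        (ae_of_all _ fun ω => ?_)
      simp only [Pi.pow_apply]
      rw [← sq_abs, ← sq_abs (d ω)]
      exact pow_le_pow_left₀ (abs_nonneg _) (abs_trunc_le_abs ω) 2
    filter_upwards [h1, ae_comp_iter hθ h2 i] with ω h1 h2
    have e : (ξ ∘ iter θ i) ^ 2 = (ξ ^ 2) ∘ iter θ i := rfl
    rw [e]
    exact h1.le.trans h2
  have hgm : ∀ i : ℕ, StronglyMeasurable[natFilt hθ hm hmθ i] (g ∘ iter θ i) := fun i =>
    StronglyMeasurable.comp_iter hg i
  have hbd : ∀ i : ℕ, ∀ᵐ ω ∂μ, |(ξ ∘ iter θ i) ω| ≤ 2 * b := fun i =>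
    ae_comp_iter hθ (ae_abs_ctrunc_le hb) i
  have hcz := condExp_ctrunc_iter (b := b) hθ hm hmθ hd' hb
  refine (measure_mono hsub).trans ((measure_union_le _ _).trans (add_le_add ?_ ?_))
  · refine (measure_union_le _ _).trans ?_
    rw [two_mul]
    refine add_le_add ?_ ?_
    · exact measure_exists_sum_ge_inter_le_exp (G := natFilt hθ hm hmθ)
        (stronglyMeasurable_ctrunc_iter hθ hm hmθ hd) hbd hcz hgm (fun i ω => hg0 _) hvar ht htb
        x V n
    · refine measure_exists_sum_ge_inter_le_exp (G := natFilt hθ hm hmθ) (b := 2 * b)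
        (fun i => (stronglyMeasurable_ctrunc_iter hθ hm hmθ hd i).neg) ?_ ?_ hgm
        (fun i ω => hg0 _) ?_ ht htb x V n
      · simpa only [Pi.neg_apply, abs_neg] using hbd
      · intro i
        refine (condExp_neg _ _).trans ?_
        filter_upwards [hcz i] with ω h
        rw [Pi.neg_apply, h]; simp
      · simpa only [neg_sq] using hvar
  · rw [ENNReal.le_div_iff_mul_le (Or.inl hx0) (Or.inl ENNReal.coe_ne_top), mul_comm]
    refine (mul_measure_exists_abs_sum_le hθ (hd'.sub hξm).aestronglyMeasurable x n).trans ?_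
    rw [mul_comm 2 (n : ℝ≥0∞), mul_assoc]
    gcongr
    exact lintegral_sub_ctrunc_le hd' hdi hb h0

end Stationary

/-! ### Sums along geometrically growing sequences. -/

section Geometric

variable {c : ℕ → ℝ} {r x : ℝ}

/-- A sum of terms growing at least geometrically is comparable with its last term, and the last
term retained is below `x`. -/
lemma sum_ite_lt_le (hr : 1 < r) (hc : ∀ k, 0 < c k) (hcr : ∀ k, r * c k ≤ c (k + 1)) (hx : 0 ≤ x)
    (n : ℕ) : ∑ k ∈ Finset.range n, (if c k < x then c k else 0) ≤ r / (r - 1) * x := by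
  have hr1 : 0 < r - 1 := by linarith
  have h1 : ∀ n, ∑ k ∈ Finset.range n, (if c k < x then c k else 0) ≤ c n / (r - 1) := by
    intro n
    induction n with
    | zero => simpa using div_nonneg (hc 0).le hr1.le
    | succ n ih =>
      rw [Finset.sum_range_succ]
      have h2 : (if c n < x then c n else 0) ≤ c n := by
        split_ifs
        · exact le_rfl
        · exact (hc n).le
      have h3 : c n / (r - 1) + c n = r * c n / (r - 1) := by field_simp; ring
      have h4 : r * c n / (r - 1) ≤ c (n + 1) / (r - 1) := by gcongr; exact hcr n
      linarith
  induction n with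
  | zero => simp only [Finset.range_zero, Finset.sum_empty]; positivity
  | succ n ih =>
    rw [Finset.sum_range_succ]
    split_ifs with h
    · have h3 : c n / (r - 1) + c n = r / (r - 1) * c n := by field_simp; ring
      have h4 : r / (r - 1) * c n ≤ r / (r - 1) * x := by gcongr
      linarith [h1 n]
    · simpa using ih

/-- The inverses decay geometrically, so their sum is comparable with the first one retained, which
is at most `x⁻¹`. -/
lemma sum_ite_ge_inv_le (hr : 1 < r) (hc : ∀ k, 0 < c k) (hcr : ∀ k, r * c k ≤ c (k + 1))
    (hx : 0 < x) (n : ℕ) :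
    ∑ k ∈ Finset.range n, (if x ≤ c k then (c k)⁻¹ else 0) ≤ r / (r - 1) * x⁻¹ := by
  have hr1 : 0 < r - 1 := by linarith
  -- The added term `1 / (r - 1) * (c n)⁻¹` dominates all the inverses still to come, which makes
  -- the bound inductive. The second alternative is that the level `x` has not been reached yet.
  have h1 : ∀ n, (∑ k ∈ Finset.range (n + 1), (if x ≤ c k then (c k)⁻¹ else 0) +
      1 / (r - 1) * (c n)⁻¹ ≤ r / (r - 1) * x⁻¹) ∨
      (c n < x ∧ ∑ k ∈ Finset.range (n + 1), (if x ≤ c k then (c k)⁻¹ else 0) = 0) := by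
    have key : ∀ n, x ≤ c n → (c n)⁻¹ + 1 / (r - 1) * (c n)⁻¹ ≤ r / (r - 1) * x⁻¹ := by
      intro n h
      have : (c n)⁻¹ + 1 / (r - 1) * (c n)⁻¹ = r / (r - 1) * (c n)⁻¹ := by field_simp; ring
      rw [this]
      gcongr
    intro n
    induction n with
    | zero =>
      by_cases h : x ≤ c 0
      · left; simpa [h] using key 0 h
      · right; simp [h, not_le.1 h]
    | succ n ih =>
      rw [Finset.sum_range_succ]
      by_cases h : x ≤ c (n + 1)
      · left
        simp only [h, if_true]
        rcases ih with ih | ⟨-, ih⟩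
        · have : (c (n + 1))⁻¹ + 1 / (r - 1) * (c (n + 1))⁻¹ ≤ 1 / (r - 1) * (c n)⁻¹ := by
            have e : (c (n + 1))⁻¹ + 1 / (r - 1) * (c (n + 1))⁻¹ =
                1 / (r - 1) * (r * (c (n + 1))⁻¹) := by field_simp; ring
            rw [e]
            gcongr
            rw [← div_eq_mul_inv, div_le_iff₀ (hc _), inv_mul_eq_div, le_div_iff₀ (hc n)]
            exact hcr n
          linarith
        · rw [ih, zero_add]; exact key _ h
      · simp only [h, if_false, add_zero]
        right
        refine ⟨not_le.1 h, ?_⟩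
        rcases ih with ih | ⟨-, ih⟩
        · exfalso
          have h5 : c n < x := by
            have := hcr n
            have h6 : c n ≤ r * c n := le_mul_of_one_le_left (hc n).le hr.le
            linarith [not_le.1 h]
          have hz : ∀ m ≤ n, c m < x := by
            intro m hm
            have hmono : Monotone c := monotone_nat_of_le_succ fun k =>
              (le_mul_of_one_le_left (hc k).le hr.le).trans (hcr k)
            exact (hmono hm).trans_lt h5
          have : r / (r - 1) * x⁻¹ < 1 / (r - 1) * (c n)⁻¹ := by
            have h7 : r * c n < x := (hcr n).trans_lt (not_le.1 h)
            rw [div_mul_eq_mul_div, div_mul_eq_mul_div, one_mul]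
            gcongr
            rw [← div_eq_mul_inv, div_lt_iff₀ hx, inv_mul_eq_div, lt_div_iff₀ (hc n)]
            exact h7
          have h8 : ∑ k ∈ Finset.range (n + 1), (if x ≤ c k then (c k)⁻¹ else 0) = 0 := by
            refine Finset.sum_eq_zero fun k hk => ?_
            rw [if_neg (not_le.2 (hz k (by have := Finset.mem_range.1 hk; omega)))]
          linarith
        · exact ih
  cases n with
  | zero => simp only [Finset.range_zero, Finset.sum_empty]; positivity
  | succ n =>
    rcases h1 n with h | ⟨-, h⟩
    · have : 0 ≤ 1 / (r - 1) * (c n)⁻¹ := mul_nonneg (by positivity) (inv_nonneg.2 (hc n).le)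
      linarith
    · rw [h]; positivity

lemma rpow_two_pow_geom {s : ℝ} (k : ℕ) :
    (2 : ℝ) ^ s * ((2 : ℝ) ^ k) ^ s = ((2 : ℝ) ^ (k + 1)) ^ s := by
  rw [← Real.mul_rpow (by norm_num) (by positivity), pow_succ, mul_comm]

/-- Pointwise bound behind the Marcinkiewicz–Zygmund truncation argument. -/
lemma exists_sum_trunc_le {p : ℝ} (hp : 1 < p) (hp2 : p < 2) :
    ∃ C : ℝ, 0 < C ∧ ∀ w : ℝ, 0 ≤ w → ∀ n : ℕ,
      ∑ k ∈ Finset.range n, (if w ≤ ((2 : ℝ) ^ k) ^ (1 / p)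
        then (2 : ℝ) ^ k * w ^ 2 / (((2 : ℝ) ^ k) ^ (1 / p)) ^ 2
        else (2 : ℝ) ^ k * w / ((2 : ℝ) ^ k) ^ (1 / p)) ≤ C * w ^ p := by
  have hp0 : 0 < p := by linarith
  -- With `a = 2 ^ k`, the two kinds of summand are `w ^ 2 * (a ^ s)⁻¹` and `w * a ^ s'`. Both
  -- exponents are positive exactly because `1 < p < 2`, and the condition `w ≤ a ^ (1 / p)` becomes
  -- a comparison of `a ^ s` with `w ^ (2 - p)`, or of `a ^ s'` with `w ^ (p - 1)`.
  set s := 2 / p - 1 with hs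
  set s' := 1 - 1 / p with hs'
  have hs0 : 0 < s := by rw [hs, sub_pos, lt_div_iff₀ hp0]; linarith
  have hs0' : 0 < s' := by rw [hs', sub_pos, div_lt_iff₀ hp0]; linarith
  have hr : 1 < (2 : ℝ) ^ s := Real.one_lt_rpow (by norm_num) hs0
  have hr' : 1 < (2 : ℝ) ^ s' := Real.one_lt_rpow (by norm_num) hs0'
  have hC1 : 0 < (2 : ℝ) ^ s / ((2 : ℝ) ^ s - 1) := div_pos (by positivity) (by linarith)
  have hC2 : 0 < (2 : ℝ) ^ s' / ((2 : ℝ) ^ s' - 1) := div_pos (by positivity) (by linarith)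
  refine ⟨(2 : ℝ) ^ s / ((2 : ℝ) ^ s - 1) + (2 : ℝ) ^ s' / ((2 : ℝ) ^ s' - 1),
    by positivity, fun w hw n => ?_⟩
  rcases hw.eq_or_lt with rfl | hw
  · rw [Real.zero_rpow hp0.ne', mul_zero]
    refine (Finset.sum_eq_zero fun k _ => ?_).le
    rw [if_pos (by positivity)]; simp
  have hA := sum_ite_ge_inv_le (c := fun k => ((2 : ℝ) ^ k) ^ s) (x := w ^ (2 - p)) hr
    (fun k => by positivity) (fun k => (rpow_two_pow_geom k).le) (by positivity) n
  have hB := sum_ite_lt_le (c := fun k => ((2 : ℝ) ^ k) ^ s') (x := w ^ (p - 1)) hr'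
    (fun k => by positivity) (fun k => (rpow_two_pow_geom k).le) (by positivity) n
  have hA' := mul_le_mul_of_nonneg_left hA (sq_nonneg w)
  have hB' := mul_le_mul_of_nonneg_left hB hw.le
  have e1 : w ^ 2 * ((2 : ℝ) ^ s / ((2 : ℝ) ^ s - 1) * (w ^ (2 - p))⁻¹) =
      (2 : ℝ) ^ s / ((2 : ℝ) ^ s - 1) * w ^ p := by
    have : w ^ p = w ^ 2 * (w ^ (2 - p))⁻¹ := by
      rw [← Real.rpow_natCast, ← Real.rpow_neg hw.le, ← Real.rpow_add hw]; norm_num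
    rw [this]; ring
  have e2 : w * ((2 : ℝ) ^ s' / ((2 : ℝ) ^ s' - 1) * w ^ (p - 1)) =
      (2 : ℝ) ^ s' / ((2 : ℝ) ^ s' - 1) * w ^ p := by
    have : w ^ p = w * w ^ (p - 1) := by
      nth_rewrite 2 [← Real.rpow_one w]
      rw [← Real.rpow_add hw]; norm_num
    rw [this]; ring
  rw [e1, Finset.mul_sum] at hA'
  rw [e2, Finset.mul_sum] at hB'
  rw [add_mul]
  refine le_trans (le_of_eq ?_) (add_le_add hA' hB')
  rw [← Finset.sum_add_distrib]
  refine Finset.sum_congr rfl fun k _ => ?_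
  set a := (2 : ℝ) ^ k with ha
  have ha0 : 0 < a := by positivity
  have c1 : w ≤ a ^ (1 / p) ↔ w ^ (2 - p) ≤ a ^ s := by
    have : a ^ s = (a ^ (1 / p)) ^ (2 - p) := by
      rw [← Real.rpow_mul ha0.le]; congr 1; rw [hs]; field_simp
    rw [this, Real.rpow_le_rpow_iff hw.le (by positivity) (by linarith)]
  have c2 : a ^ s' < w ^ (p - 1) ↔ ¬ w ≤ a ^ (1 / p) := by
    have : a ^ s' = (a ^ (1 / p)) ^ (p - 1) := by
      rw [← Real.rpow_mul ha0.le]; congr 1; rw [hs']; field_simp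
    rw [this, Real.rpow_lt_rpow_iff (by positivity) hw.le (by linarith), not_le]
  have e3 : a * w ^ 2 / (a ^ (1 / p)) ^ 2 = w ^ 2 * (a ^ s)⁻¹ := by
    have : a ^ s = (a ^ (1 / p)) ^ 2 / a := by
      rw [← Real.rpow_natCast, ← Real.rpow_mul ha0.le, hs, Real.rpow_sub_one ha0.ne']
      congr 2; push_cast; ring
    rw [this]; field_simp
  have e4 : a * w / a ^ (1 / p) = w * a ^ s' := by
    rw [hs', Real.rpow_sub ha0, Real.rpow_one]; ring
  by_cases h : w ≤ a ^ (1 / p)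
  · rw [if_pos h, if_pos (c1.1 h), if_neg fun h' => c2.1 h' h, e3]; ring
  · rw [if_neg h, if_neg ((not_congr c1).1 h), if_pos (c2.2 h), e4]; ring

end Geometric

/-! ### Growth of the iterated logarithm along powers of two. -/

section LogLog

lemma one_le_L (x : ℝ) : 1 ≤ L x := le_max_left _ _

lemma L_mono {x y : ℝ} (hx : 0 < x) (h : x ≤ y) : L x ≤ L y :=
  max_le_max le_rfl (Real.log_le_log hx h)

lemma L_mul_le {a x : ℝ} (ha : 1 ≤ a) (hx : 0 < x) : L (a * x) ≤ L x + Real.log a := by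
  have h := Real.log_nonneg ha
  refine max_le (by linarith [one_le_L x]) ?_
  rw [Real.log_mul (by linarith) hx.ne']
  linarith [le_max_right 1 (Real.log x), show L x = max 1 (Real.log x) from rfl]

/-- Doubling `x` at most doubles `L x`, which adds at most `log 2 ≤ 7 / 10` to the iterated
logarithm, itself at least 1. What matters is that `2 / 1.7` exceeds `1.08 ^ 2`, so the truncation
levels in `lilScale_geom` grow geometrically. -/
lemma L_L_two_mul_le {x : ℝ} (hx : 0 < x) : L (L (2 * x)) ≤ 17 / 10 * L (L x) := by
  have h2 : Real.log 2 ≤ 7 / 10 := by linarith [Real.log_two_lt_d9]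
  have h1 : L (2 * x) ≤ 2 * L x := by
    have := L_mul_le (a := 2) one_le_two hx
    linarith [one_le_L x]
  have h3 : L (L (2 * x)) ≤ L (2 * L x) := L_mono (by linarith [one_le_L (2 * x)]) h1
  have h4 := L_mul_le (a := 2) one_le_two (x := L x) (by linarith [one_le_L x])
  linarith [one_le_L (L x)]

/-- The left side is at most `L (2 ^ k) ^ (-2)`, and `L (2 ^ k)` grows linearly in `k`. The factor 2
in the exponent is what makes the series converge. -/
lemma exp_neg_two_mul_L_L_le (k : ℕ) :
    Real.exp (-(2 * L (L ((2 : ℝ) ^ k)))) ≤ 9 / ((k : ℝ) + 1) ^ 2 := by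
  have h0 : 0 < L ((2 : ℝ) ^ k) := by linarith [one_le_L ((2 : ℝ) ^ k)]
  have h1 : ((k : ℝ) + 1) / 3 ≤ L ((2 : ℝ) ^ k) := by
    have hl : Real.log ((2 : ℝ) ^ k) = k * Real.log 2 := Real.log_pow _ _
    have h2 : (69 : ℝ) / 100 ≤ Real.log 2 := by linarith [Real.log_two_gt_d9]
    rcases Nat.eq_zero_or_pos k with rfl | hk
    · refine le_trans ?_ (one_le_L _); norm_num
    · refine le_trans ?_ (le_max_right _ _)
      rw [hl]
      have : (1 : ℝ) ≤ k := by exact_mod_cast hk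
      nlinarith
  have h2 : Real.log (L ((2 : ℝ) ^ k)) ≤ L (L ((2 : ℝ) ^ k)) := le_max_right _ _
  calc Real.exp (-(2 * L (L ((2 : ℝ) ^ k)))) ≤ Real.exp (-(2 * Real.log (L ((2 : ℝ) ^ k)))) :=
        Real.exp_le_exp.2 (by linarith)
    _ = (L ((2 : ℝ) ^ k) ^ 2)⁻¹ := by
        rw [Real.exp_neg, two_mul, Real.exp_add, Real.exp_log h0, sq]
    _ ≤ ((((k : ℝ) + 1) / 3) ^ 2)⁻¹ := by gcongr
    _ = 9 / ((k : ℝ) + 1) ^ 2 := by field_simp; norm_num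

lemma summable_exp_neg_two_mul_L_L :
    Summable fun k : ℕ => Real.exp (-(2 * L (L ((2 : ℝ) ^ k)))) := by
  refine Summable.of_nonneg_of_le (fun k => (Real.exp_pos _).le) exp_neg_two_mul_L_L_le ?_
  have h := (summable_nat_add_iff 1).2 (Real.summable_one_div_nat_pow.2 one_lt_two)
  refine (h.mul_left 9).congr fun k => ?_
  push_cast; ring

lemma lilScale_geom (k : ℕ) :
    (1.08 : ℝ) * √((2 : ℝ) ^ k / L (L ((2 : ℝ) ^ k))) ≤
      √((2 : ℝ) ^ (k + 1) / L (L ((2 : ℝ) ^ (k + 1)))) := by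
  have h1 := one_le_L (L ((2 : ℝ) ^ k))
  have h2 := one_le_L (L ((2 : ℝ) ^ (k + 1)))
  have h := L_L_two_mul_le (x := (2 : ℝ) ^ k) (by positivity)
  have e : (1.08 : ℝ) = √(1.08 ^ 2) := (Real.sqrt_sq (by norm_num)).symm
  rw [e, ← Real.sqrt_mul (by positivity)]
  refine Real.sqrt_le_sqrt ?_
  rw [mul_div_assoc', div_le_div_iff₀ (by linarith) (by linarith), pow_succ' (2 : ℝ) k]
  rw [pow_succ'] at h2
  have h3 : (0 : ℝ) < 2 ^ k := by positivity
  nlinarith [mul_le_mul_of_nonneg_left h h3.le, mul_pos h3 (by linarith : 0 < L (L ((2 : ℝ) ^ k)))]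

end LogLog

/-! ### Maximal functions and strong laws reduced to dyadic blocks. -/

section WeakNorm

/-- The maximal function of the partial sums of `X` with normalising sequence `a`. -/
noncomputable def wmax {Ω : Type*} (a : ℕ → ℝ) (X : ℤ → Ω → ℝ) (ω : Ω) : ℝ≥0∞ :=
  ⨆ n : ℕ, ⨆ _ : 1 ≤ n, ENNReal.ofReal (|partialSum X n ω| / a n)

variable {Ω : Type*} [mΩ : MeasurableSpace Ω] {μ : Measure Ω}

lemma weakNorm_le_of_forall {q : ℝ} (hq : 0 < q) {Z : Ω → ℝ≥0∞} {K : ℝ≥0∞}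
    (h : ∀ t : ℝ≥0, 0 < t → (t : ℝ≥0∞) ^ q * μ {ω | (t : ℝ≥0∞) < Z ω} ≤ K ^ q) :
    weakNorm μ q Z ≤ K := by
  refine iSup_le fun t => ?_
  rcases eq_zero_or_pos t with rfl | ht
  · simp
  · have h1 := ENNReal.rpow_le_rpow (h t ht) (one_div_pos.2 hq).le
    rwa [ENNReal.mul_rpow_of_nonneg _ _ (one_div_pos.2 hq).le, ← ENNReal.rpow_mul,
      ← ENNReal.rpow_mul, mul_one_div_cancel hq.ne', ENNReal.rpow_one, ENNReal.rpow_one] at h1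

/-- An index `n` whose normalised sum exceeds `t` lies in a block from `2 ^ k` to `2 ^ (k + 1)`, and
there `a n` may be replaced by the smaller `a (2 ^ k)`. -/
lemma lt_wmax_subset {Ω : Type*} {a : ℕ → ℝ} (ha : ∀ n, 1 ≤ n → 0 < a n)
    (hmono : ∀ m n, 1 ≤ m → m ≤ n → a m ≤ a n) (X : ℤ → Ω → ℝ) (t : ℝ≥0) :
    {ω | (t : ℝ≥0∞) < wmax a X ω} ⊆
      ⋃ k : ℕ, {ω | ∃ j ≤ 2 ^ (k + 1), t * a (2 ^ k) ≤ |partialSum X j ω|} := by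
  intro ω h
  have h' : (t : ℝ≥0∞) < wmax a X ω := h
  simp only [wmax, lt_iSup_iff] at h'
  obtain ⟨n, hn, h'⟩ := h'
  rw [← ENNReal.ofReal_coe_nnreal, ENNReal.ofReal_lt_ofReal_iff', lt_div_iff₀ (ha n hn)] at h'
  refine Set.mem_iUnion.2 ⟨Nat.log 2 n, n, (Nat.lt_pow_succ_log_self one_lt_two n).le, ?_⟩
  have h2 := hmono (2 ^ Nat.log 2 n) n Nat.one_le_two_pow (Nat.pow_log_le_self 2 (by omega))
  exact (mul_le_mul_of_nonneg_left h2 t.2).trans h'.1.le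

/-- The Borel–Cantelli lemma over dyadic blocks, for a sequence of levels decreasing to zero. -/
lemma ae_tendsto_of_tsum_ne_top {a : ℕ → ℝ} (ha : ∀ n, 1 ≤ n → 0 < a n)
    (hmono : ∀ m n, 1 ≤ m → m ≤ n → a m ≤ a n) (X : ℤ → Ω → ℝ)
    (h : ∀ ε : ℝ≥0, 0 < ε →
      ∑' k : ℕ, μ {ω | ∃ j ≤ 2 ^ (k + 1), ε * a (2 ^ k) ≤ |partialSum X j ω|} ≠ ∞) :
    ∀ᵐ ω ∂μ, Tendsto (fun n : ℕ => |partialSum X n ω| / a n) atTop (𝓝 0) := by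
  obtain ⟨u, -, hu0, hu⟩ := exists_seq_strictAnti_tendsto (0 : ℝ≥0)
  filter_upwards [ae_all_iff.2 fun i => ae_eventually_notMem (h (u i) (hu0 i))] with ω hω
  rw [Metric.tendsto_atTop]
  intro ε hε
  obtain ⟨i, hi⟩ := ((tendsto_order.1 hu).2 ⟨ε, hε.le⟩ (by exact_mod_cast hε)).exists
  obtain ⟨K, hK⟩ := eventually_atTop.1 (hω i)
  refine ⟨2 ^ K, fun n hn => ?_⟩
  have hn1 : 1 ≤ n := Nat.one_le_two_pow.trans hn
  have hlog : K ≤ Nat.log 2 n := Nat.le_log_of_pow_le one_lt_two hn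
  have h1 := hK _ hlog
  have h2 : ¬ (u i * a (2 ^ Nat.log 2 n) ≤ |partialSum X n ω|) := fun h' =>
    h1 ⟨n, (Nat.lt_pow_succ_log_self one_lt_two n).le, h'⟩
  have h3 := hmono (2 ^ Nat.log 2 n) n Nat.one_le_two_pow (Nat.pow_log_le_self 2 (by omega))
  rw [Real.dist_0_eq_abs, abs_of_nonneg (div_nonneg (abs_nonneg _) (ha n hn1).le),
    div_lt_iff₀ (ha n hn1)]
  have h4 : ((u i : ℝ≥0) : ℝ) < ε := hi
  calc |partialSum X n ω| < u i * a (2 ^ Nat.log 2 n) := not_le.1 h2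
    _ ≤ u i * a n := mul_le_mul_of_nonneg_left h3 (u i).2
    _ ≤ ε * a n := mul_le_mul_of_nonneg_right h4.le (ha n hn1).le

end WeakNorm

/-! ### Stationary martingale differences in `L^p` for `1 < p < 2`. -/

section StationaryMDS

variable {Ω : Type*} {m : MeasurableSpace Ω} [mΩ : MeasurableSpace Ω] {μ : Measure Ω}
  {θ : Ω ≃ᵐ Ω} {d : Ω → ℝ}

set_option linter.overlappingInstances false in
/-- `d ∘ θ ^ i`, `i ∈ ℕ`, is a stationary sequence of martingale differences with respect to the
filtration `θ⁻ⁱ m`. -/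
structure IsStationaryMDS (m : MeasurableSpace Ω) [mΩ : MeasurableSpace Ω] (μ : Measure Ω)
    (θ : Ω ≃ᵐ Ω) (d : Ω → ℝ) : Prop where
  mp : MeasurePreserving θ μ μ
  le : m ≤ mΩ
  le_comap : m ≤ m.comap θ
  meas : StronglyMeasurable[filt m θ 1] d
  condExp_eq : μ[d | m] =ᵐ[μ] 0

lemma IsStationaryMDS.stronglyMeasurable (h : IsStationaryMDS m μ θ d) : StronglyMeasurable d :=
  h.meas.mono (filt_le h.mp h.le 1)

lemma enorm_trunc_sq {Ω : Type*} {d : Ω → ℝ} (b : ℝ) (ω : Ω) :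
    ‖trunc b d ω‖ₑ ^ 2 = ENNReal.ofReal (if |d ω| ≤ b then |d ω| ^ 2 else 0) := by
  by_cases h : |d ω| ≤ b
  · rw [if_pos h, ENNReal.ofReal_pow (abs_nonneg _), ← Real.enorm_eq_ofReal_abs]
    simp [trunc, Set.indicator, h]
  · simp [trunc, Set.indicator, h]

lemma enorm_sub_trunc {Ω : Type*} {d : Ω → ℝ} (b : ℝ) (ω : Ω) :
    ‖d ω - trunc b d ω‖ₑ = ENNReal.ofReal (if |d ω| ≤ b then 0 else |d ω|) := by
  by_cases h : |d ω| ≤ b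
  · simp [trunc, Set.indicator, h]
  · simp [trunc, Set.indicator, h, Real.enorm_eq_ofReal_abs]

end StationaryMDS

/-- Complete-convergence form of the Marcinkiewicz–Zygmund maximal inequality for stationary
martingale differences. -/
lemma exists_tsum_measure_le {p : ℝ} (hp : 1 < p) (hp2 : p < 2) : ∃ C : ℝ, 0 < C ∧
    ∀ {Ω : Type u} {m : MeasurableSpace Ω} [MeasurableSpace Ω] {μ : Measure Ω}
      [IsProbabilityMeasure μ] {θ : Ω ≃ᵐ Ω} {d : Ω → ℝ}, IsStationaryMDS m μ θ d →
      Integrable d μ → ∀ ε : ℝ≥0, 0 < ε →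
      (ε : ℝ≥0∞) ^ p *
        ∑' k : ℕ, μ {ω | ∃ j ≤ 2 ^ (k + 1), ε * ((2 ^ k : ℕ) : ℝ) ^ (1 / p) ≤
          |partialSum (fun i => d ∘ iter θ i) j ω|} ≤
      ENNReal.ofReal C * ∫⁻ ω, ‖d ω‖ₑ ^ p ∂μ := by
  obtain ⟨C, hC, hsum⟩ := exists_sum_trunc_le hp hp2
  have hp0 : 0 < p := by linarith
  refine ⟨2 ^ p * (4 * C), by positivity, ?_⟩
  intro Ω m _ μ _ θ d hd hdi ε hε
  set l : ℝ≥0 := ε / 2 with hl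
  have hl0 : 0 < l := by positivity
  have hε2 : (ε : ℝ) = 2 * l := by rw [hl]; push_cast; ring
  -- The same number is the truncation level and the deviation level. With `l = ε / 2`, twice `b k`
  -- is the threshold `ε * 2 ^ (k / p)`.
  set b : ℕ → ℝ≥0 := fun k => l * ((2 : ℝ≥0) ^ k) ^ (1 / p) with hb
  have hb0 : ∀ k, 0 < b k := fun k => by positivity
  have hbR : ∀ k, (b k : ℝ) = l * ((2 : ℝ) ^ k) ^ (1 / p) := fun k => by simp [hb]
  have hdm := hd.stronglyMeasurable.measurable
  have htm : ∀ k, Measurable (trunc (b k) d) := fun k =>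
    (StronglyMeasurable.trunc hd.stronglyMeasurable).measurable
  set φ : ℕ → Ω → ℝ := fun k ω => if |d ω| / l ≤ ((2 : ℝ) ^ k) ^ (1 / p)
        then (2 : ℝ) ^ k * (|d ω| / l) ^ 2 / (((2 : ℝ) ^ k) ^ (1 / p)) ^ 2
        else (2 : ℝ) ^ k * (|d ω| / l) / ((2 : ℝ) ^ k) ^ (1 / p) with hφ
  have hφ0 : ∀ k ω, 0 ≤ φ k ω := fun k ω => by
    simp only [hφ]; split_ifs <;> positivity
  have hφm : ∀ k, Measurable (φ k) := fun k => by
    have hm1 : Measurable fun ω => |d ω| / (l : ℝ) := hdm.abs.div_const _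
    refine Measurable.ite (measurableSet_le hm1 measurable_const) ?_ ?_
    · exact ((hm1.pow_const 2).const_mul _).div_const _
    · exact (hm1.const_mul _).div_const _
  -- The block has length `2 ^ (k + 1)`. The truncated part therefore contributes `2 * φ k`, and the
  -- `L¹` part, with its extra factor 2, contributes `4 * φ k`. Only one of them is nonzero at a
  -- given `ω`, so `4 * φ k` covers both.
  have hk : ∀ k, μ {ω | ∃ j ≤ 2 ^ (k + 1), ε * ((2 ^ k : ℕ) : ℝ) ^ (1 / p) ≤
      |partialSum (fun i => d ∘ iter θ i) j ω|} ≤ ∫⁻ ω, ENNReal.ofReal (4 * φ k ω) ∂μ := by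
    intro k
    have h1 := measure_exists_abs_sum_le_trunc hd.mp hd.le hd.le_comap hd.meas hdi hd.condExp_eq
      (b k).coe_nonneg (hb0 k) (2 ^ (k + 1))
    have e : ∀ ω, (∃ j ≤ 2 ^ (k + 1), ε * ((2 ^ k : ℕ) : ℝ) ^ (1 / p) ≤
      |partialSum (fun i => d ∘ iter θ i) j ω|) ↔ ∃ j ≤ 2 ^ (k + 1), 2 * (b k : ℝ) ≤
        |∑ i ∈ Finset.range j, d (iter θ i ω)| := by
      intro ω
      rw [hbR, hε2]
      push_cast
      simp only [partialSum, Function.comp_apply, mul_assoc]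
    rw [show {ω | _} = {ω | _} from Set.ext e]
    refine h1.trans ?_
    have hsm : Measurable fun ω => ‖d ω - trunc (b k) d ω‖ₑ := (hdm.sub (htm k)).enorm
    rw [← lintegral_const_mul _ ((htm k).enorm.pow_const 2),
      ← lintegral_const_mul _ hsm]
    simp only [div_eq_mul_inv]
    rw [← lintegral_mul_const _ (((htm k).enorm.pow_const 2).const_mul _),
      ← lintegral_mul_const _ (hsm.const_mul _),
      ← lintegral_add_left ((((htm k).enorm.pow_const 2).const_mul _).mul_const _)]
    refine lintegral_mono fun ω => ?_
    have hbE : (b k : ℝ≥0∞) = ENNReal.ofReal (b k) := ENNReal.ofReal_coe_nnreal.symm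
    have hbp : (0 : ℝ) < b k := hb0 k
    have hlp : (0 : ℝ) < l := hl0
    have hn : ((2 ^ (k + 1) : ℕ) : ℝ≥0∞) = ENNReal.ofReal ((2 : ℝ) ^ (k + 1)) := by
      rw [ENNReal.ofReal_pow (by norm_num)]; push_cast; simp
    have h2 : (2 : ℝ≥0∞) = ENNReal.ofReal 2 := by simp
    have ha0 : (0 : ℝ) < ((2 : ℝ) ^ k) ^ (1 / p) := by positivity
    rw [enorm_trunc_sq, enorm_sub_trunc, hbE, hn, h2, ← ENNReal.ofReal_pow hbp.le,
      ← ENNReal.ofReal_inv_of_pos hbp, ← ENNReal.ofReal_inv_of_pos (by positivity),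
      ← ENNReal.ofReal_mul (by positivity), ← ENNReal.ofReal_mul (by positivity),
      ← ENNReal.ofReal_mul (by norm_num), ← ENNReal.ofReal_mul (by positivity),
      ← ENNReal.ofReal_mul (mul_nonneg (by positivity) (by split_ifs <;> positivity)),
      ← ENNReal.ofReal_add (mul_nonneg (mul_nonneg (by positivity) (by split_ifs <;> positivity))
          (by positivity))
        (mul_nonneg (mul_nonneg (by positivity) (by split_ifs <;> positivity)) (by positivity))]
    refine ENNReal.ofReal_le_ofReal ?_
    have hc : |d ω| / l ≤ ((2 : ℝ) ^ k) ^ (1 / p) ↔ |d ω| ≤ b k := by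
      rw [div_le_iff₀ hlp, hbR, mul_comm]
    by_cases h : |d ω| ≤ b k
    · simp only [hφ, hc, h, if_true]
      rw [hbR, pow_succ]
      refine le_trans (le_of_eq ?_) (mul_le_mul_of_nonneg_right (show (2 : ℝ) ≤ 4 by norm_num)
        (by positivity))
      field_simp
      simp
    · simp only [hφ, hc, h, if_false]
      rw [hbR, pow_succ]
      refine le_of_eq ?_
      field_simp
      norm_num
      ring
  have hεp : (ε : ℝ≥0∞) ^ p = ENNReal.ofReal (2 ^ p) * ENNReal.ofReal ((l : ℝ) ^ p) := by
    rw [← ENNReal.ofReal_mul (by positivity), ← Real.mul_rpow (by norm_num) l.coe_nonneg, ← hε2,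
      ← ENNReal.ofReal_coe_nnreal, ENNReal.ofReal_rpow_of_nonneg ε.coe_nonneg hp0.le]
  rw [hεp, ENNReal.ofReal_mul (by positivity), mul_assoc, mul_assoc]
  refine mul_le_mul_right ?_ _
  calc ENNReal.ofReal ((l : ℝ) ^ p) * ∑' k : ℕ, μ {ω | ∃ j ≤ 2 ^ (k + 1),
        ε * ((2 ^ k : ℕ) : ℝ) ^ (1 / p) ≤ |partialSum (fun i => d ∘ iter θ i) j ω|}
      ≤ ENNReal.ofReal ((l : ℝ) ^ p) * ∫⁻ ω, ∑' k : ℕ, ENNReal.ofReal (4 * φ k ω) ∂μ := by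
        rw [lintegral_tsum fun k => ((hφm k).const_mul 4).ennreal_ofReal.aemeasurable]
        gcongr with k
        exact hk k
    _ ≤ ENNReal.ofReal ((l : ℝ) ^ p) *
        ∫⁻ ω, ENNReal.ofReal (4 * C * (|d ω| / l) ^ p) ∂μ := by
        gcongr with ω
        refine ENNReal.tsum_le_of_sum_range_le fun n => ?_
        rw [← ENNReal.ofReal_sum_of_nonneg fun k _ => mul_nonneg (by norm_num) (hφ0 k ω)]
        refine ENNReal.ofReal_le_ofReal ?_
        rw [← Finset.mul_sum, mul_assoc]
        exact mul_le_mul_of_nonneg_left (hsum _ (by positivity) n) (by norm_num)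
    _ = ENNReal.ofReal (4 * C) * ∫⁻ ω, ‖d ω‖ₑ ^ p ∂μ := by
        rw [← lintegral_const_mul' _ _ ENNReal.ofReal_ne_top,
          ← lintegral_const_mul' _ _ ENNReal.ofReal_ne_top]
        refine lintegral_congr fun ω => ?_
        have hlp : (0 : ℝ) < l := hl0
        rw [Real.enorm_eq_ofReal_abs, ENNReal.ofReal_rpow_of_nonneg (abs_nonneg _) hp0.le,
          ← ENNReal.ofReal_mul (by positivity), ← ENNReal.ofReal_mul (by positivity),
          Real.div_rpow (abs_nonneg _) hlp.le]
        congr 1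
        field_simp

lemma rpow_scale_pos {p : ℝ} (n : ℕ) (hn : 1 ≤ n) : 0 < (n : ℝ) ^ (1 / p) := by
  have : (0 : ℝ) < n := by exact_mod_cast hn
  positivity

lemma rpow_scale_mono {p : ℝ} (hp : 0 < p) (m n : ℕ) (_ : 1 ≤ m) (h : m ≤ n) :
    (m : ℝ) ^ (1 / p) ≤ (n : ℝ) ^ (1 / p) := by
  have : (m : ℝ) ≤ n := by exact_mod_cast h
  gcongr

/-- Weak-type maximal inequality and strong law of Marcinkiewicz–Zygmund type for stationary
martingale differences. -/
lemma exists_weakNorm_maxFun_le {p : ℝ} (hp : 1 < p) (hp2 : p < 2) : ∃ C : ℝ, 0 < C ∧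
    ∀ {Ω : Type u} {m : MeasurableSpace Ω} [MeasurableSpace Ω] {μ : Measure Ω}
      [IsProbabilityMeasure μ] {θ : Ω ≃ᵐ Ω} {d : Ω → ℝ}, IsStationaryMDS m μ θ d →
      MemLp d (ENNReal.ofReal p) μ →
      weakNorm μ p (maxFun p fun i => d ∘ iter θ i) ≤
        ENNReal.ofReal C * eLpNorm d (ENNReal.ofReal p) μ ∧
      ∀ᵐ ω ∂μ, Tendsto (fun n : ℕ => |partialSum (fun i => d ∘ iter θ i) n ω| / (n : ℝ) ^ (1 / p))
        atTop (𝓝 0) := by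
  obtain ⟨C, hC, H⟩ := exists_tsum_measure_le.{u} hp hp2
  have hp0 : 0 < p := by linarith
  have hp1 : 1 ≤ ENNReal.ofReal p := by
    rw [← ENNReal.ofReal_one]; exact ENNReal.ofReal_le_ofReal hp.le
  have hpne : ENNReal.ofReal p ≠ 0 := (ENNReal.ofReal_pos.2 hp0).ne'
  refine ⟨C ^ (1 / p), by positivity, ?_⟩
  intro Ω m _ μ _ θ d hd hdp
  have hdi := hdp.integrable hp1
  have hN : eLpNorm d (ENNReal.ofReal p) μ ^ p = ∫⁻ ω, ‖d ω‖ₑ ^ p ∂μ := by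
    rw [eLpNorm_eq_lintegral_rpow_enorm_toReal hpne ENNReal.ofReal_ne_top,
      ENNReal.toReal_ofReal hp0.le, ← ENNReal.rpow_mul, one_div_mul_cancel hp0.ne',
      ENNReal.rpow_one]
  refine ⟨weakNorm_le_of_forall hp0 fun t ht => ?_, ?_⟩
  · rw [ENNReal.mul_rpow_of_nonneg _ _ hp0.le, hN, ENNReal.ofReal_rpow_of_nonneg (by positivity)
      hp0.le, ← Real.rpow_mul hC.le, one_div_mul_cancel hp0.ne', Real.rpow_one]
    refine le_trans ?_ (H hd hdi t ht)
    gcongr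
    exact (measure_mono (lt_wmax_subset (a := fun n => (n : ℝ) ^ (1 / p)) rpow_scale_pos
      (rpow_scale_mono hp0) _ t)).trans (measure_iUnion_le _)
  · refine ae_tendsto_of_tsum_ne_top (a := fun n => (n : ℝ) ^ (1 / p)) rpow_scale_pos
      (rpow_scale_mono hp0) _ fun ε hε htop => ?_
    have h1 := H hd hdi ε hε
    rw [htop, ENNReal.mul_top, ← hN] at h1
    · exact ENNReal.mul_ne_top ENNReal.ofReal_ne_top
        (ENNReal.rpow_ne_top_of_nonneg hp0.le hdp.2.ne) (top_le_iff.1 h1)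
    · have : (ε : ℝ≥0∞) ≠ 0 := by exact_mod_cast hε.ne'
      simp [hp0, this]

/-- The normalising sequence of the law of the iterated logarithm. -/
noncomputable def lilScale (n : ℕ) : ℝ := √((n : ℝ) * L (L (n : ℝ)))

lemma lilScale_pos (n : ℕ) (hn : 1 ≤ n) : 0 < lilScale n := by
  have : (0 : ℝ) < n := by exact_mod_cast hn
  have := one_le_L (L (n : ℝ))
  exact Real.sqrt_pos.2 (by positivity)

lemma lilScale_mono (m n : ℕ) (hm : 1 ≤ m) (h : m ≤ n) : lilScale m ≤ lilScale n := by
  have h1 : (0 : ℝ) < m := by exact_mod_cast hm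
  have h2 : (m : ℝ) ≤ n := by exact_mod_cast h
  have h3 := one_le_L (L (m : ℝ))
  have h4 : L (L (m : ℝ)) ≤ L (L (n : ℝ)) :=
    L_mono (by linarith [one_le_L (m : ℝ)]) (L_mono h1 h2)
  exact Real.sqrt_le_sqrt (mul_le_mul h2 h4 (by linarith) (by linarith))

/-- The exponential exceeds any monomial `y ^ n / n!`; the degree is chosen with `n * s ≥ q`. This
brings the exponential term of the iterated logarithm estimate to the polynomial rate of the others.
-/
lemma exists_exp_neg_rpow_le {q s : ℝ} (hs : 0 < s) :
    ∃ C : ℝ, 0 < C ∧ ∀ z : ℝ, 1 ≤ z → Real.exp (-(z ^ s / 4)) ≤ C * z ^ (-q) := by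
  set n := ⌈q / s⌉₊ with hn
  refine ⟨4 ^ n * n.factorial, by positivity, fun z hz => ?_⟩
  have hz0 : 0 < z := by linarith
  have h1 : z ^ q ≤ (z ^ s) ^ n := by
    rw [← Real.rpow_natCast, ← Real.rpow_mul hz0.le]
    refine Real.rpow_le_rpow_of_exponent_le hz ?_
    have := Nat.le_ceil (q / s)
    rw [div_le_iff₀ hs] at this
    linarith
  have h2 := Real.pow_div_factorial_le_exp (z ^ s / 4) (by positivity) n
  rw [div_le_iff₀ (by positivity), div_pow, div_le_iff₀ (by positivity)] at h2
  rw [Real.rpow_neg hz0.le, Real.exp_neg, ← div_eq_mul_inv, inv_eq_one_div,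
    div_le_div_iff₀ (Real.exp_pos _) (by positivity), one_mul]
  linarith

/-! ### Tail of the maximal function at the scale of the iterated logarithm. -/

section

variable {Ω : Type*} {m : MeasurableSpace Ω} [mΩ : MeasurableSpace Ω] {μ : Measure Ω}
  {θ : Ω ≃ᵐ Ω} {d : Ω → ℝ}

/-- The large parts of a square integrable variable, at the truncation levels of the law of the
iterated logarithm, are summable. -/
lemma tsum_mul_lintegral_sub_trunc_le (hd : StronglyMeasurable d) {l : ℝ} (hl : 0 < l) :
    ∑' k : ℕ, ENNReal.ofReal (l * √((2 : ℝ) ^ k / L (L ((2 : ℝ) ^ k)))) *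
      ∫⁻ ω, ‖d ω - trunc (l * √((2 : ℝ) ^ k / L (L ((2 : ℝ) ^ k)))) d ω‖ₑ ∂μ ≤
    ENNReal.ofReal (1.08 / (1.08 - 1)) * ∫⁻ ω, ENNReal.ofReal (d ω ^ 2) ∂μ := by
  set b : ℕ → ℝ := fun k => l * √((2 : ℝ) ^ k / L (L ((2 : ℝ) ^ k))) with hb
  have hb0 : ∀ k, 0 < b k := fun k => by
    have := one_le_L (L ((2 : ℝ) ^ k))
    exact mul_pos hl (Real.sqrt_pos.2 (by positivity))
  have hbg : ∀ k, 1.08 * b k ≤ b (k + 1) := fun k => by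
    have := mul_le_mul_of_nonneg_left (lilScale_geom k) hl.le
    simp only [hb]; linarith
  have hm1 : ∀ k, Measurable fun ω => ‖d ω - trunc (b k) d ω‖ₑ := fun k =>
    (hd.measurable.sub (StronglyMeasurable.trunc hd).measurable).enorm
  calc ∑' k : ℕ, ENNReal.ofReal (b k) * ∫⁻ ω, ‖d ω - trunc (b k) d ω‖ₑ ∂μ
      = ∫⁻ ω, ∑' k : ℕ, ENNReal.ofReal (b k) * ‖d ω - trunc (b k) d ω‖ₑ ∂μ := by
        rw [lintegral_tsum fun k => ((hm1 k).const_mul _).aemeasurable]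
        exact tsum_congr fun k => (lintegral_const_mul _ (hm1 k)).symm
    _ ≤ ∫⁻ ω, ENNReal.ofReal (1.08 / (1.08 - 1)) * ENNReal.ofReal (d ω ^ 2) ∂μ := by
        refine lintegral_mono fun ω => ENNReal.tsum_le_of_sum_range_le fun n => ?_
        have e : ∀ k, ENNReal.ofReal (b k) * ‖d ω - trunc (b k) d ω‖ₑ =
            ENNReal.ofReal ((if b k < |d ω| then b k else 0) * |d ω|) := fun k => by
          rw [enorm_sub_trunc, ← ENNReal.ofReal_mul (hb0 k).le]
          by_cases h : |d ω| ≤ b k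
          · simp [h, not_lt.2 h]
          · simp [h, not_le.1 h]
        have hnn : ∀ k, 0 ≤ (if b k < |d ω| then b k else 0) * |d ω| := fun k =>
          mul_nonneg (by split_ifs; exacts [(hb0 k).le, le_rfl]) (abs_nonneg _)
        rw [Finset.sum_congr rfl fun k _ => e k, ← ENNReal.ofReal_sum_of_nonneg fun k _ => hnn k,
          ← ENNReal.ofReal_mul (by norm_num), ← Finset.sum_mul]
        refine ENNReal.ofReal_le_ofReal ?_
        -- Exchanging sum and integral leaves, for each `ω`, the sum of the levels `b k` below `|d
        -- ω|`. It is geometric with ratio `1.08`, hence of order `|d ω|`.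
        have h := sum_ite_lt_le (c := b) (x := |d ω|) (by norm_num : (1 : ℝ) < 1.08) hb0 hbg
          (abs_nonneg _) n
        rw [← sq_abs, sq, ← mul_assoc]
        exact mul_le_mul_of_nonneg_right h (abs_nonneg _)
    _ = _ := lintegral_const_mul' _ _ ENNReal.ofReal_ne_top

/-- Union bound for the maximal function at the scale of the iterated logarithm: `l²` bounds the
ergodic averages of the conditional variance, and `t` is the level of the maximal function. -/
lemma measure_lt_maxFunLIL_le [IsProbabilityMeasure μ] (hd : IsStationaryMDS m μ θ d)
    (hd2 : MemLp d 2 μ) {l : ℝ} (hl : 0 < l) {t : ℝ≥0} (ht : 10 * l ≤ t) :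
    μ {ω | (t : ℝ≥0∞) < maxFunLIL (fun i => d ∘ iter θ i) ω} ≤
      ENNReal.ofReal (1 / l ^ 2) * ∫⁻ ω, ENNReal.ofReal (d ω ^ 2) ∂μ +
      ENNReal.ofReal (2 * Real.exp (5 / 2) * (∑' k : ℕ, Real.exp (-(2 * L (L ((2 : ℝ) ^ k))))) *
        Real.exp (-(t / l / 4))) +
      ENNReal.ofReal (8 * (1.08 / (1.08 - 1)) / (l * t)) * ∫⁻ ω, ENNReal.ofReal (d ω ^ 2) ∂μ := by
  have htp : (0 : ℝ) < t := by linarith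
  -- A version of the conditional variance that is nonnegative everywhere, as the exponential and
  -- ergodic inequalities require.
  set g : Ω → ℝ := fun ω => max 0 ((μ[d ^ 2 | m]) ω) with hg
  have hgm : StronglyMeasurable[m] g :=
    (continuous_const.max continuous_id).comp_stronglyMeasurable stronglyMeasurable_condExp
  have hg0 : ∀ ω, 0 ≤ g ω := fun ω => le_max_left _ _
  have hgc : μ[d ^ 2 | m] =ᵐ[μ] g := by
    have : 0 ≤ᵐ[μ] μ[d ^ 2 | m] := condExp_nonneg (ae_of_all _ fun ω => sq_nonneg _)
    filter_upwards [this] with ω h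
    exact (max_eq_right h).symm
  have hgi : Integrable g μ := integrable_condExp.congr hgc
  have hgI : ∫⁻ ω, ENNReal.ofReal (g ω) ∂μ = ∫⁻ ω, ENNReal.ofReal (d ω ^ 2) ∂μ := by
    rw [← ofReal_integral_eq_lintegral_ofReal hgi (ae_of_all _ hg0),
      ← ofReal_integral_eq_lintegral_ofReal hd2.integrable_sq (ae_of_all _ fun ω => sq_nonneg _),
      ← integral_congr_ae hgc, integral_condExp hd.le]
    rfl
  set ℓ : ℕ → ℝ := fun k => L (L ((2 : ℝ) ^ k)) with hℓ
  have hℓ1 : ∀ k, 1 ≤ ℓ k := fun k => one_le_L _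
  set b : ℕ → ℝ := fun k => l * √((2 : ℝ) ^ k / ℓ k) with hb
  have hb0 : ∀ k, 0 < b k := fun k => by
    have := hℓ1 k
    exact mul_pos hl (Real.sqrt_pos.2 (by positivity))
  -- On `B` some ergodic average of the conditional variance exceeds `l ^ 2`, which Hopf's
  -- inequality makes unlikely. Off `B` the sum of conditional variances over each block is at most
  -- `l ^ 2` times its length, the constraint `V` of the exponential inequality.
  set B : Set Ω := {ω | ∃ j : ℕ, l ^ 2 * j < ∑ i ∈ Finset.range j, g (iter θ i ω)} with hB
  set E : ℕ → Set Ω := fun k => {ω | (∃ j ≤ 2 ^ (k + 1),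
    t * lilScale (2 ^ k) ≤ |∑ i ∈ Finset.range j, d (iter θ i ω)|) ∧
      ∑ i ∈ Finset.range (2 ^ (k + 1)), g (iter θ i ω) ≤ l ^ 2 * (2 ^ (k + 1) : ℕ)} with hE
  have hsub : {ω | (t : ℝ≥0∞) < maxFunLIL (fun i => d ∘ iter θ i) ω} ⊆ B ∪ ⋃ k, E k := by
    intro ω hω
    by_cases hωB : ω ∈ B
    · exact Or.inl hωB
    · right
      obtain ⟨k, hk⟩ := Set.mem_iUnion.1 (lt_wmax_subset (a := lilScale) lilScale_pos lilScale_mono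
        (fun i => d ∘ iter θ i) t hω)
      refine Set.mem_iUnion.2 ⟨k, hk, ?_⟩
      by_contra hcon
      exact hωB ⟨2 ^ (k + 1), not_le.1 hcon⟩
  have hBm : μ B ≤ ENNReal.ofReal (1 / l ^ 2) * ∫⁻ ω, ENNReal.ofReal (d ω ^ 2) ∂μ := by
    have h := mul_measure_exists_lt_sum_le' hd.mp hgi hg0 (l ^ 2)
    rw [hgI] at h
    have h0 : ENNReal.ofReal (l ^ 2) ≠ 0 := (ENNReal.ofReal_pos.2 (by positivity)).ne'
    rw [one_div, ENNReal.ofReal_inv_of_pos (by positivity), mul_comm _ (∫⁻ _, _ ∂μ),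
      ← div_eq_mul_inv, ENNReal.le_div_iff_mul_le (Or.inl h0) (Or.inl ENNReal.ofReal_ne_top),
      mul_comm]
    exact h
  have hEm : ∀ k, μ (E k) ≤ ENNReal.ofReal (2 * Real.exp (5 / 2) * Real.exp (-(t / l / 4)) *
        Real.exp (-(2 * ℓ k))) + ENNReal.ofReal (8 / (l * t)) *
        (ENNReal.ofReal (b k) * ∫⁻ ω, ‖d ω - trunc (b k) d ω‖ₑ ∂μ) := by
    intro k
    have h1 := hℓ1 k
    have h2k : (0 : ℝ) < 2 ^ k := by positivity
    set x : ℝ≥0 := ⟨t * lilScale (2 ^ k) / 2,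
      div_nonneg (mul_nonneg htp.le (Real.sqrt_nonneg _)) zero_le_two⟩ with hx
    have hxv : (x : ℝ) = t * lilScale (2 ^ k) / 2 := rfl
    have hx0 : 0 < x := by
      have := lilScale_pos (2 ^ k) Nat.one_le_two_pow
      rw [← NNReal.coe_pos, hxv]; positivity
    have hls : lilScale (2 ^ k) = √((2 : ℝ) ^ k * ℓ k) := by simp [lilScale, hℓ]
    set r := √((2 : ℝ) ^ k) with hr
    set w := √(ℓ k) with hw
    have hr0 : 0 < r := Real.sqrt_pos.2 h2k
    have hw0 : 0 < w := Real.sqrt_pos.2 (by linarith)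
    have hr2 : (2 : ℝ) ^ k = r ^ 2 := (Real.sq_sqrt h2k.le).symm
    have hw2 : ℓ k = w ^ 2 := (Real.sq_sqrt (by linarith)).symm
    have hls' : lilScale (2 ^ k) = r * w := by rw [hls, Real.sqrt_mul h2k.le]
    have hbk : b k = l * (r / w) := by simp only [hb]; rw [Real.sqrt_div h2k.le]
    -- The parameter `1 / (2 * b k)` is the largest one allowed for increments bounded by `2 * b k`.
    have h := measure_exists_abs_sum_inter_le_exp hd.mp hd.le hd.le_comap hd.meas hd2 hd.condExp_eq
      (hb0 k).le hgm hg0 hgc.le (t := 1 / (2 * b k)) (by have := hb0 k; positivity)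
      (by have := (hb0 k).ne'; field_simp; exact le_rfl) hx0 (l ^ 2 * (2 ^ (k + 1) : ℕ))
      (2 ^ (k + 1))
    have hEe : E k = {ω | (∃ j ≤ 2 ^ (k + 1),
        2 * (x : ℝ) ≤ |∑ i ∈ Finset.range j, d (iter θ i ω)|) ∧
        ∑ i ∈ Finset.range (2 ^ (k + 1)), g (iter θ i ω) ≤ l ^ 2 * (2 ^ (k + 1) : ℕ)} := by
      rw [hxv, mul_div_cancel₀ _ (two_ne_zero' ℝ)]
    rw [hEe]
    refine h.trans (add_le_add ?_ (le_of_eq ?_))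
    · rw [mul_assoc, mul_assoc, ENNReal.ofReal_mul zero_le_two, ENNReal.ofReal_ofNat,
        ← Real.exp_add, ← Real.exp_add]
      refine mul_le_mul_right (ENNReal.ofReal_le_ofReal (Real.exp_le_exp.2 ?_)) _
      have e1 : 1 / (2 * b k) * (x : ℝ) = t / l / 4 * ℓ k := by
        rw [hxv, hls', hbk, hw2]; field_simp; norm_num
      have e2 : (1 / (2 * b k)) ^ 2 * (l ^ 2 * ((2 ^ (k + 1) : ℕ) : ℝ)) = ℓ k / 2 := by
        push_cast
        rw [pow_succ (2 : ℝ) k, hr2, hbk, hw2]; field_simp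
      rw [e1, e2]
      -- The target exponent minus the actual one is `(ℓ k - 1) * (t / l / 4 - 5 / 2)`. It is
      -- nonnegative since `ℓ k ≥ 1` and `t ≥ 10 * l`, which explains the constants `10` and `5 /
      -- 2`.
      have h3 : 10 ≤ t / l := by rw [le_div_iff₀ hl]; exact ht
      nlinarith
    · have e3 : (x : ℝ≥0∞) = ENNReal.ofReal x := ENNReal.ofReal_coe_nnreal.symm
      have hn : ((2 ^ (k + 1) : ℕ) : ℝ≥0∞) = ENNReal.ofReal ((2 : ℝ) ^ (k + 1)) := by
        rw [ENNReal.ofReal_pow (by norm_num)]; push_cast; simp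
      have h2 : (2 : ℝ≥0∞) = ENNReal.ofReal 2 := by simp
      rw [div_eq_mul_inv, e3, ← ENNReal.ofReal_inv_of_pos (by exact_mod_cast hx0), mul_right_comm,
        ← mul_assoc, hn, h2, ← ENNReal.ofReal_mul zero_le_two,
        ← ENNReal.ofReal_mul (by positivity), ← ENNReal.ofReal_mul (by positivity)]
      congr 2
      rw [hxv, hls', hbk, pow_succ (2 : ℝ) k, hr2]
      field_simp
      norm_num
  refine (measure_mono hsub).trans ((measure_union_le _ _).trans ?_)
  rw [add_assoc]
  refine add_le_add hBm ((measure_iUnion_le _).trans ((ENNReal.tsum_le_tsum hEm).trans ?_))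
  rw [ENNReal.tsum_add, ENNReal.tsum_mul_left, ← ENNReal.ofReal_tsum_of_nonneg
    (fun k => by positivity) (summable_exp_neg_two_mul_L_L.mul_left _), tsum_mul_left]
  refine add_le_add (le_of_eq (by congr 1; ring)) ?_
  refine (mul_le_mul_right (tsum_mul_lintegral_sub_trunc_le hd.stronglyMeasurable hl) _).trans
    (le_of_eq ?_)
  rw [← mul_assoc, ← ENNReal.ofReal_mul (by positivity)]
  congr 2
  ring

end

/-- Maximal inequality at the scale of the law of the iterated logarithm for stationary
martingale differences. -/
lemma exists_weakNorm_maxFunLIL_le {q : ℝ} (hq : 1 < q) (hq2 : q < 2) : ∃ C : ℝ, 0 < C ∧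
    ∀ {Ω : Type u} {m : MeasurableSpace Ω} [MeasurableSpace Ω] {μ : Measure Ω}
      [IsProbabilityMeasure μ] {θ : Ω ≃ᵐ Ω} {d : Ω → ℝ}, IsStationaryMDS m μ θ d →
      MemLp d 2 μ →
      weakNorm μ q (maxFunLIL fun i => d ∘ iter θ i) ≤ ENNReal.ofReal C * eLpNorm d 2 μ := by
  have hs : 0 < 1 - q / 2 := by linarith
  have hq0 : 0 < q := by linarith
  obtain ⟨C₁, hC₁, hexp⟩ := exists_exp_neg_rpow_le (q := q) hs
  set K := ∑' k : ℕ, Real.exp (-(2 * L (L ((2 : ℝ) ^ k)))) with hK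
  have hK0 : 0 ≤ K := tsum_nonneg fun k => (Real.exp_pos _).le
  -- Above `z₀` one has `z ^ (1 - q / 2) ≥ 10`, the condition `10 * l ≤ t` of the tail estimate.
  -- Below it, the trivial bound of a probability by 1 is enough.
  set z₀ : ℝ := 10 ^ (1 / (1 - q / 2)) with hz₀
  have hz₀1 : 1 ≤ z₀ := Real.one_le_rpow (by norm_num) (by positivity)
  set A : ℝ := 1 + 2 * Real.exp (5 / 2) * K * C₁ + 8 * (1.08 / (1.08 - 1)) with hA
  have hA1 : 1 ≤ A := by
    have : 0 ≤ 2 * Real.exp (5 / 2) * K * C₁ := by positivity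
    rw [hA]; norm_num; linarith
  refine ⟨z₀ + A ^ (1 / q), by positivity, ?_⟩
  intro Ω m _ μ _ θ d hd hd2
  set σ := (eLpNorm d 2 μ).toReal with hσ
  have hσe : eLpNorm d 2 μ = ENNReal.ofReal σ := (ENNReal.ofReal_toReal hd2.2.ne).symm
  have hI : ∫⁻ ω, ENNReal.ofReal (d ω ^ 2) ∂μ = ENNReal.ofReal (σ ^ 2) := by
    rw [ENNReal.ofReal_pow ENNReal.toReal_nonneg, ← hσe,
      eLpNorm_eq_lintegral_rpow_enorm_toReal two_ne_zero ENNReal.ofNat_ne_top,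
      ENNReal.toReal_ofNat, ← ENNReal.rpow_natCast, ← ENNReal.rpow_mul]
    simp only [Nat.cast_ofNat, one_div, isUnit_iff_ne_zero, ne_eq, OfNat.ofNat_ne_zero,
      not_false_eq_true, IsUnit.inv_mul_cancel, ENNReal.rpow_one, ENNReal.rpow_ofNat]
    refine lintegral_congr fun ω => ?_
    rw [Real.enorm_eq_ofReal_abs, ← ENNReal.ofReal_pow (abs_nonneg _), sq_abs]
  refine iSup_le fun t => ?_
  have hσn : 0 ≤ σ := ENNReal.toReal_nonneg
  rcases hσn.eq_or_lt' with h0 | hσ0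
  · have hd0 : d =ᵐ[μ] 0 := by
      rw [← eLpNorm_eq_zero_iff hd2.1 two_ne_zero, hσe]
      simp [h0]
    have : ∀ᵐ ω ∂μ, ¬ (t : ℝ≥0∞) < maxFunLIL (fun i => d ∘ iter θ i) ω := by
      filter_upwards [ae_all_iff.2 fun i : ℤ => ae_comp_iter hd.mp hd0 i] with ω h
      have : maxFunLIL (fun i => d ∘ iter θ i) ω = 0 := by
        simp [maxFunLIL, partialSum, h]
      simp [this]
    have h1 : μ {ω | (t : ℝ≥0∞) < maxFunLIL (fun i => d ∘ iter θ i) ω} = 0 := by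
      rw [measure_eq_zero_iff_ae_notMem]; exact this
    rw [h1, ENNReal.zero_rpow_of_pos (by positivity), mul_zero]
    exact zero_le
  set z := (t : ℝ) / σ with hz
  have hzt : (t : ℝ) = z * σ := by rw [hz]; field_simp
  rw [hσe, ← ENNReal.ofReal_mul (by positivity)]
  by_cases hzz : z ≤ z₀
  · calc (t : ℝ≥0∞) * μ {ω | (t : ℝ≥0∞) < maxFunLIL (fun i => d ∘ iter θ i) ω} ^ (1 / q)
        ≤ t * 1 := by
          gcongr
          exact ENNReal.rpow_le_one prob_le_one (by positivity)
      _ ≤ _ := by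
          rw [mul_one, ← ENNReal.ofReal_coe_nnreal, hzt]
          refine ENNReal.ofReal_le_ofReal (mul_le_mul_of_nonneg_right ?_ hσ0.le)
          have : 0 ≤ A ^ (1 / q) := by positivity
          linarith
  push Not at hzz
  have hz1 : 1 ≤ z := hz₀1.trans hzz.le
  have hz0 : 0 < z := by linarith
  -- The free parameter makes the ergodic term `σ ^ 2 / l ^ 2` equal to `z ^ (-q)`. The exponential
  -- term decays faster, since `t / l = z ^ (1 - q / 2)` with `q < 2`, and the truncation term is of
  -- order `z ^ (-(q / 2 + 1))`, at most `z ^ (-q)`.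
  set l := σ * z ^ (q / 2) with hl
  have hl0 : 0 < l := by positivity
  have htl : (t : ℝ) / l = z ^ (1 - q / 2) := by
    rw [hzt, hl, Real.rpow_sub hz0, Real.rpow_one]; field_simp
  have h10 : 10 ≤ z ^ (1 - q / 2) := by
    have : z₀ ^ (1 - q / 2) = 10 := by
      rw [hz₀, ← Real.rpow_mul (by norm_num), one_div_mul_cancel hs.ne', Real.rpow_one]
    rw [← this]
    exact Real.rpow_le_rpow (by positivity) hzz.le hs.le
  have hmain := measure_lt_maxFunLIL_le hd hd2 hl0 (t := t)
    (by rw [← le_div_iff₀ hl0, htl]; exact h10)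
  have hl2 : l ^ 2 = σ ^ 2 * z ^ q := by
    rw [hl, mul_pow, ← Real.rpow_natCast (z ^ (q / 2)), ← Real.rpow_mul hz0.le]
    norm_num
  have hle : μ {ω | (t : ℝ≥0∞) < maxFunLIL (fun i => d ∘ iter θ i) ω} ≤
      ENNReal.ofReal (A * z ^ (-q)) := by
    refine hmain.trans ?_
    rw [hI, ← ENNReal.ofReal_mul (by positivity), ← ENNReal.ofReal_mul (by positivity),
      ← ENNReal.ofReal_add (by positivity) (by positivity),
      ← ENNReal.ofReal_add (by positivity) (by positivity)]
    refine ENNReal.ofReal_le_ofReal ?_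
    rw [hA, add_mul, add_mul, htl]
    refine add_le_add (add_le_add ?_ ?_) ?_
    · rw [hl2, Real.rpow_neg hz0.le]; field_simp; exact le_rfl
    · rw [mul_assoc _ C₁]
      exact mul_le_mul_of_nonneg_left (hexp z hz1) (by positivity)
    · rw [div_mul_eq_mul_div, mul_div_assoc]
      refine mul_le_mul_of_nonneg_left ?_ (by norm_num)
      rw [hzt, hl, Real.rpow_neg hz0.le]
      have e : σ ^ 2 / (σ * z ^ (q / 2) * (z * σ)) = (z ^ (q / 2 + 1))⁻¹ := by
        rw [Real.rpow_add hz0, Real.rpow_one]; field_simp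
      rw [e]
      exact inv_anti₀ (by positivity) (Real.rpow_le_rpow_of_exponent_le hz1 (by linarith))
  calc (t : ℝ≥0∞) * μ {ω | (t : ℝ≥0∞) < maxFunLIL (fun i => d ∘ iter θ i) ω} ^ (1 / q)
      ≤ t * ENNReal.ofReal (A * z ^ (-q)) ^ (1 / q) := by gcongr
    _ = ENNReal.ofReal (A ^ (1 / q) * σ) := by
        rw [ENNReal.ofReal_rpow_of_nonneg (by positivity) (by positivity),
          ← ENNReal.ofReal_coe_nnreal, ← ENNReal.ofReal_mul t.coe_nonneg,
          Real.mul_rpow (by positivity) (by positivity), ← Real.rpow_mul hz0.le, hzt]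
        congr 1
        have : -q * (1 / q) = -1 := by field_simp
        rw [this, Real.rpow_neg_one]; field_simp
    _ ≤ _ := by
        refine ENNReal.ofReal_le_ofReal (mul_le_mul_of_nonneg_right ?_ hσ0.le)
        linarith

/-! ### Countable subadditivity of the weak norm. -/

section WeakSum

variable {Ω : Type*} [mΩ : MeasurableSpace Ω] {μ : Measure Ω}

lemma weakNorm_mono_ae {q : ℝ} (hq : 0 ≤ q) {Z Z' : Ω → ℝ≥0∞} (h : Z ≤ᵐ[μ] Z') :
    weakNorm μ q Z ≤ weakNorm μ q Z' := by
  refine iSup_mono fun t => mul_le_mul_right (ENNReal.rpow_le_rpow ?_ (by positivity)) _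
  refine measure_mono_ae ?_
  filter_upwards [h] with ω h h'
  exact lt_of_lt_of_le h' h

lemma mul_rpow_measure_le_weakNorm (q : ℝ) (Z : Ω → ℝ≥0∞) (t : ℝ≥0) :
    (t : ℝ≥0∞) * μ {ω | (t : ℝ≥0∞) < Z ω} ^ (1 / q) ≤ weakNorm μ q Z :=
  le_iSup (fun t : ℝ≥0 => (t : ℝ≥0∞) * μ {ω | (t : ℝ≥0∞) < Z ω} ^ (1 / q)) t

lemma measure_lt_le_of_weakNorm {q : ℝ} (hq : 0 < q) (Z : Ω → ℝ≥0∞) {t : ℝ≥0} (ht : 0 < t) :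
    μ {ω | (t : ℝ≥0∞) < Z ω} ≤ (weakNorm μ q Z / t) ^ q := by
  have ht0 : (t : ℝ≥0∞) ≠ 0 := by exact_mod_cast ht.ne'
  have h : μ {ω | (t : ℝ≥0∞) < Z ω} ^ (1 / q) ≤ weakNorm μ q Z / t := by
    rw [ENNReal.le_div_iff_mul_le (Or.inl ht0) (Or.inl ENNReal.coe_ne_top), mul_comm]
    exact mul_rpow_measure_le_weakNorm q Z t
  have h2 := ENNReal.rpow_le_rpow h hq.le
  rwa [← ENNReal.rpow_mul, one_div_mul_cancel hq.ne', ENNReal.rpow_one] at h2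

lemma weakNorm_le_of_le [IsProbabilityMeasure μ] {q q' : ℝ} (hq : 0 < q) (h : q ≤ q')
    (Z : Ω → ℝ≥0∞) : weakNorm μ q Z ≤ weakNorm μ q' Z := by
  refine iSup_mono fun t => mul_le_mul_right ?_ _
  exact ENNReal.rpow_le_rpow_of_exponent_ge prob_le_one (one_div_le_one_div_of_le hq h)

lemma ae_lt_top_of_weakNorm {q : ℝ} (hq : 0 < q) {Z : Ω → ℝ≥0∞} (h : weakNorm μ q Z ≠ ∞) :
    ∀ᵐ ω ∂μ, Z ω < ∞ := by
  rw [ae_iff]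
  have hle : ∀ t : ℝ≥0, 0 < t → μ {ω | ¬ Z ω < ∞} ≤ (weakNorm μ q Z / t) ^ q := fun t ht =>
    (measure_mono fun ω hω => by
      have : Z ω = ∞ := not_lt_top_iff.1 hω
      change (t : ℝ≥0∞) < Z ω
      rw [this]; exact ENNReal.coe_lt_top).trans (measure_lt_le_of_weakNorm hq Z ht)
  have hlim : Tendsto (fun n : ℕ => (weakNorm μ q Z / ((n : ℝ≥0) + 1 : ℝ≥0)) ^ q) atTop (𝓝 0) := by
    have h1 : Tendsto (fun n : ℕ => weakNorm μ q Z / (((n : ℝ≥0) + 1 : ℝ≥0) : ℝ≥0∞)) atTop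
        (𝓝 0) := by
      have h2 : Tendsto (fun n : ℕ => ((n + 1 : ℕ) : ℝ≥0∞)) atTop (𝓝 ∞) :=
        (tendsto_add_atTop_iff_nat 1).2 ENNReal.tendsto_nat_nhds_top
      have h3 := ENNReal.Tendsto.const_div h2 (Or.inr h)
      rw [ENNReal.div_top] at h3
      refine h3.congr fun n => ?_
      push_cast; rfl
    have h4 := h1.ennrpow_const q
    rwa [ENNReal.zero_rpow_of_pos hq] at h4
  exact le_antisymm (ge_of_tendsto' hlim fun n => hle _ (by positivity)) zero_le

lemma ae_eq_zero_of_weakNorm {q : ℝ} (hq : 0 < q) {Z : Ω → ℝ≥0∞} (h : weakNorm μ q Z = 0) :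
    Z =ᵐ[μ] 0 := by
  have : ∀ n : ℕ, ∀ᵐ ω ∂μ, Z ω ≤ ((1 / ((n : ℝ≥0) + 1) : ℝ≥0) : ℝ≥0∞) := by
    intro n
    have h1 := measure_lt_le_of_weakNorm (μ := μ) hq Z
      (t := 1 / ((n : ℝ≥0) + 1)) (by positivity)
    rw [h, ENNReal.zero_div, ENNReal.zero_rpow_of_pos hq] at h1
    rw [ae_iff]
    simpa only [not_le] using le_antisymm h1 zero_le
  filter_upwards [ae_all_iff.2 this] with ω hω
  have hlim : Tendsto (fun n : ℕ => ((1 / ((n : ℝ≥0) + 1) : ℝ≥0) : ℝ≥0∞)) atTop (𝓝 0) := by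
    rw [← ENNReal.coe_zero, ENNReal.tendsto_coe]
    exact tendsto_one_div_add_atTop_nhds_zero_nat
  exact le_antisymm (ge_of_tendsto' hlim hω) zero_le

/-- A dyadic majorant written with indicators of tail events. The term of the dyadic interval
containing `z` already suffices; if no interval contains it, `z` is infinite and so is the sum. -/
lemma le_add_tsum_dyadic (z a : ℝ≥0∞) (ha : 0 < a) :
    z ≤ a + ∑' j : ℕ, (if a * 2 ^ j < z then a * 2 ^ (j + 1) else 0) := by
  by_cases h : ∃ j : ℕ, z ≤ a * 2 ^ j
  · classical
    have hs := Nat.find_spec h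
    rcases hj : Nat.find h with _ | j
    · rw [hj, pow_zero, mul_one] at hs
      exact hs.trans le_self_add
    · rw [hj] at hs
      have hlt : a * 2 ^ j < z := not_le.1 (Nat.find_min h (by omega))
      refine le_trans (le_trans ?_ (ENNReal.le_tsum j)) le_add_self
      rw [if_pos hlt]; exact hs
  · push Not at h
    have hz : ∑' j : ℕ, (if a * 2 ^ j < z then a * 2 ^ (j + 1) else 0) = ∞ := by
      rw [← top_le_iff, ← ENNReal.tsum_const_eq_top_of_ne_zero (α := ℕ) ha.ne']
      refine ENNReal.tsum_le_tsum fun j => ?_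
      rw [if_pos (h j)]
      exact le_mul_of_one_le_right' (one_le_pow₀ one_le_two)
    rw [hz]; simp

/-- Integrals over sets are controlled by the weak norm. -/
lemma exists_setLIntegral_le_weakNorm {q : ℝ} (hq : 1 < q) : ∃ C : ℝ, 0 < C ∧
    ∀ {Ω : Type*} [MeasurableSpace Ω] {μ : Measure Ω} [IsProbabilityMeasure μ] {Z : Ω → ℝ≥0∞},
      Measurable Z → ∀ A : Set Ω, μ A ≠ 0 →
      ∫⁻ ω in A, Z ω ∂μ ≤ ENNReal.ofReal C * weakNorm μ q Z * μ A ^ (1 - 1 / q) := by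
  have hq0 : 0 < q := by linarith
  set ρ : ℝ := (2 : ℝ) ^ (1 - q) with hρ
  have hρ0 : 0 < ρ := by positivity
  have hρ1 : ρ < 1 := Real.rpow_lt_one_of_one_lt_of_neg (by norm_num) (by linarith)
  refine ⟨1 + 2 * (1 - ρ)⁻¹, by have : 0 < 1 - ρ := by linarith
                                positivity, ?_⟩
  intro Ω _ μ _ Z hZ A hA
  set W := weakNorm μ q Z with hW
  by_cases hWt : W = ∞
  · rw [hWt]
    have h1 : ENNReal.ofReal (1 + 2 * (1 - ρ)⁻¹) ≠ 0 := by
      refine (ENNReal.ofReal_pos.2 ?_).ne'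
      have : 0 < 1 - ρ := by linarith
      positivity
    have h2 : μ A ^ (1 - 1 / q) ≠ 0 := by
      simp [hA]
    rw [ENNReal.mul_top h1, ENNReal.top_mul h2]
    exact le_top
  by_cases hW0 : W = 0
  · have h := ae_eq_zero_of_weakNorm hq0 hW0
    rw [lintegral_congr_ae (ae_restrict_of_ae h)]
    simp
  -- The level at which the weak-type bound `(W / a) ^ q` equals `μ A`. Below it `Z` is bounded by
  -- `a` on `A`; above it the tail estimate is used.
  set a : ℝ≥0∞ := W * μ A ^ (-(1 / q)) with ha
  have hAt : μ A ≠ ∞ := measure_ne_top _ _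
  have hAp : μ A ^ (-(1 / q)) ≠ 0 := by
    intro h
    rcases ENNReal.rpow_eq_zero_iff.1 h with ⟨h, -⟩ | ⟨h, -⟩
    exacts [hA h, hAt h]
  have hAp' : μ A ^ (-(1 / q)) ≠ ∞ := ENNReal.rpow_ne_top_of_ne_zero hA hAt
  have ha0 : 0 < a := pos_iff_ne_zero.2 (mul_ne_zero hW0 hAp)
  have hat : a ≠ ∞ := ENNReal.mul_ne_top hWt hAp'
  -- Each doubling of the level gains `2 ^ (-q)` in probability and loses a factor 2 in height. The
  -- ratio `ρ = 2 ^ (1 - q)` is below 1 because `q > 1`.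
  have hterm : ∀ j : ℕ, ∫⁻ ω in A, (if a * 2 ^ j < Z ω then a * 2 ^ (j + 1) else 0) ∂μ ≤
      a * μ A * ENNReal.ofReal (2 * ρ ^ j) := by
    intro j
    have hms : MeasurableSet {ω | a * 2 ^ j < Z ω} := hZ measurableSet_Ioi
    have e : ∀ ω, (if a * 2 ^ j < Z ω then a * 2 ^ (j + 1) else 0) =
        {ω | a * 2 ^ j < Z ω}.indicator (fun _ => a * 2 ^ (j + 1)) ω := fun ω => by
      simp [Set.indicator]
    have h1 : ∫⁻ ω in A, (if a * 2 ^ j < Z ω then a * 2 ^ (j + 1) else 0) ∂μ ≤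
        a * 2 ^ (j + 1) * μ {ω | a * 2 ^ j < Z ω} := by
      refine (setLIntegral_le_lintegral _ _).trans (le_of_eq ?_)
      rw [lintegral_congr e, lintegral_indicator_const hms]
    refine h1.trans ?_
    have h2t : a * 2 ^ j ≠ ∞ := ENNReal.mul_ne_top hat (ENNReal.pow_ne_top ENNReal.ofNat_ne_top)
    have h2 := measure_lt_le_of_weakNorm (μ := μ) hq0 Z (t := (a * 2 ^ j).toNNReal)
      (ENNReal.toNNReal_pos (mul_ne_zero ha0.ne' (by simp)) h2t)
    rw [ENNReal.coe_toNNReal h2t] at h2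
    have h3 : (W / (a * 2 ^ j)) ^ q = μ A * ENNReal.ofReal (2 ^ (-(j * q))) := by
      have : W / (a * 2 ^ j) = μ A ^ (1 / q) * ENNReal.ofReal (2 ^ (-(j : ℝ))) := by
        rw [ENNReal.div_eq_inv_mul, ha, ENNReal.mul_inv (Or.inr (by simp))
          (Or.inr (by simp)), ENNReal.mul_inv (Or.inl hW0) (Or.inl hWt),
          ← ENNReal.rpow_neg, neg_neg, Real.rpow_neg (by norm_num), Real.rpow_natCast,
          ENNReal.ofReal_inv_of_pos (by positivity), ENNReal.ofReal_pow (by norm_num),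
          ENNReal.ofReal_ofNat]
        calc W⁻¹ * μ A ^ (1 / q) * (2 ^ j)⁻¹ * W = (W * W⁻¹) * (μ A ^ (1 / q) * (2 ^ j)⁻¹) := by
              ring
          _ = _ := by rw [ENNReal.mul_inv_cancel hW0 hWt, one_mul]
      rw [this, ENNReal.mul_rpow_of_nonneg _ _ hq0.le, ← ENNReal.rpow_mul,
        one_div_mul_cancel hq0.ne', ENNReal.rpow_one, ENNReal.ofReal_rpow_of_nonneg
        (by positivity) hq0.le, ← Real.rpow_mul (by norm_num)]
      congr 3; ring
    rw [← hW, h3] at h2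
    calc a * 2 ^ (j + 1) * μ {ω | a * 2 ^ j < Z ω}
        ≤ a * 2 ^ (j + 1) * (μ A * ENNReal.ofReal (2 ^ (-(j * q)))) := by gcongr
      _ = a * μ A * (2 ^ (j + 1) * ENNReal.ofReal (2 ^ (-(j * q)))) := by ring
      _ = a * μ A * ENNReal.ofReal (2 * ρ ^ j) := by
          congr 1
          have e2 : (2 : ℝ≥0∞) ^ (j + 1) = ENNReal.ofReal (2 ^ (j + 1)) := by
            rw [ENNReal.ofReal_pow (by norm_num), ENNReal.ofReal_ofNat]
          rw [e2, ← ENNReal.ofReal_mul (by positivity)]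
          congr 1
          rw [hρ, ← Real.rpow_natCast (2 ^ (1 - q)), ← Real.rpow_mul (by norm_num), pow_succ',
            mul_assoc, ← Real.rpow_natCast 2 j, ← Real.rpow_add (by norm_num)]
          congr 2; ring
  calc ∫⁻ ω in A, Z ω ∂μ
      ≤ ∫⁻ ω in A, (a + ∑' j : ℕ, (if a * 2 ^ j < Z ω then a * 2 ^ (j + 1) else 0)) ∂μ :=
        lintegral_mono fun ω => le_add_tsum_dyadic (Z ω) a ha0
    _ = a * μ A + ∑' j : ℕ, ∫⁻ ω in A, (if a * 2 ^ j < Z ω then a * 2 ^ (j + 1) else 0) ∂μ := by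
        rw [lintegral_add_left measurable_const, setLIntegral_const, lintegral_tsum]
        intro j
        exact (Measurable.ite (hZ measurableSet_Ioi) measurable_const
          measurable_const).aemeasurable
    _ ≤ a * μ A + ∑' j : ℕ, a * μ A * ENNReal.ofReal (2 * ρ ^ j) := by
        gcongr with j; exact hterm j
    _ = a * μ A * ENNReal.ofReal (1 + 2 * (1 - ρ)⁻¹) := by
        have hsum : Summable fun j : ℕ => 2 * ρ ^ j :=
          (summable_geometric_of_lt_one hρ0.le hρ1).mul_left 2
        rw [ENNReal.tsum_mul_left, ← ENNReal.ofReal_tsum_of_nonneg (fun j => by positivity) hsum,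
          tsum_mul_left, tsum_geometric_of_lt_one hρ0.le hρ1,
          ENNReal.ofReal_add zero_le_one, ENNReal.ofReal_one, mul_add, mul_one]
        have : 0 < 1 - ρ := by linarith
        positivity
    _ = ENNReal.ofReal (1 + 2 * (1 - ρ)⁻¹) * W * μ A ^ (1 - 1 / q) := by
        have : μ A ^ (1 - 1 / q) = μ A * μ A ^ (-(1 / q)) := by
          rw [sub_eq_add_neg, ENNReal.rpow_add _ _ hA hAt, ENNReal.rpow_one]
        rw [this, ha]; ring

/-- The weak norm is countably subadditive up to a constant. -/
lemma exists_weakNorm_tsum_le {q : ℝ} (hq : 1 < q) : ∃ C : ℝ, 0 < C ∧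
    ∀ {Ω : Type*} [MeasurableSpace Ω] {μ : Measure Ω} [IsProbabilityMeasure μ]
      {Z : ℕ → Ω → ℝ≥0∞}, (∀ k, Measurable (Z k)) →
      weakNorm μ q (fun ω => ∑' k, Z k ω) ≤ ENNReal.ofReal C * ∑' k, weakNorm μ q (Z k) := by
  obtain ⟨C, hC, H⟩ := exists_setLIntegral_le_weakNorm hq
  have hq0 : 0 < q := by linarith
  refine ⟨C, hC, fun {Ω} _ {μ} _ {Z} hZ => iSup_le fun t => ?_⟩
  set A := {ω | (t : ℝ≥0∞) < ∑' k, Z k ω} with hA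
  by_cases hA0 : μ A = 0
  · rw [hA0, ENNReal.zero_rpow_of_pos (by positivity), mul_zero]; exact zero_le
  have hAt : μ A ≠ ∞ := measure_ne_top _ _
  -- Integrals over a set, unlike weak norms, are countably additive. The sum exceeds `t` on `A`;
  -- integrating it term by term over `A` and dividing by `μ A ^ (1 - 1 / q)` gives the claim.
  have h1 : (t : ℝ≥0∞) * μ A ≤
      ENNReal.ofReal C * (∑' k, weakNorm μ q (Z k)) * μ A ^ (1 - 1 / q) := by
    calc (t : ℝ≥0∞) * μ A = ∫⁻ _ in A, (t : ℝ≥0∞) ∂μ := (setLIntegral_const _ _).symm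
      _ ≤ ∫⁻ ω in A, ∑' k, Z k ω ∂μ :=
          setLIntegral_mono (Measurable.tsum hZ) fun ω h => le_of_lt h
      _ = ∑' k, ∫⁻ ω in A, Z k ω ∂μ := lintegral_tsum fun k => (hZ k).aemeasurable
      _ ≤ ∑' k, ENNReal.ofReal C * weakNorm μ q (Z k) * μ A ^ (1 - 1 / q) :=
          ENNReal.tsum_le_tsum fun k => H (hZ k) A hA0
      _ = _ := by rw [ENNReal.tsum_mul_right, ENNReal.tsum_mul_left]
  have h0 : μ A ^ (1 - 1 / q) ≠ 0 := by
    intro h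
    rcases ENNReal.rpow_eq_zero_iff.1 h with ⟨h, -⟩ | ⟨h, -⟩
    exacts [hA0 h, hAt h]
  have ht : μ A ^ (1 - 1 / q) ≠ ∞ := ENNReal.rpow_ne_top_of_ne_zero hA0 hAt
  have e : μ A = μ A ^ (1 / q) * μ A ^ (1 - 1 / q) := by
    rw [← ENNReal.rpow_add _ _ hA0 hAt]; simp
  have h2 : (t : ℝ≥0∞) * μ A ^ (1 / q) * μ A ^ (1 - 1 / q) ≤
      ENNReal.ofReal C * (∑' k, weakNorm μ q (Z k)) * μ A ^ (1 - 1 / q) := by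
    rw [mul_assoc, ← e]; exact h1
  exact (ENNReal.mul_le_mul_iff_left h0 ht).1 h2

end WeakSum

/-! ### Series of random variables summable in `L^r`. -/

section Series

variable {Ω : Type*} [mΩ : MeasurableSpace Ω] {μ : Measure Ω}
  {ι : Type*} [Countable ι] {u : ι → Ω → ℝ} {r : ℝ≥0∞}

lemma ae_summable_of_tsum_eLpNorm [IsProbabilityMeasure μ] (hr : 1 ≤ r) (hu : ∀ k, AEStronglyMeasurable (u k) μ)
    (h : ∑' k, eLpNorm (u k) r μ ≠ ∞) : ∀ᵐ ω ∂μ, Summable fun k => |u k ω| := by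
  have h1 : ∫⁻ ω, ∑' k, ‖u k ω‖ₑ ∂μ ≠ ∞ := by
    rw [lintegral_tsum fun k => (hu k).enorm]
    refine ne_top_of_le_ne_top h (ENNReal.tsum_le_tsum fun k => ?_)
    rw [← eLpNorm_one_eq_lintegral_enorm]
    exact eLpNorm_le_eLpNorm_of_exponent_le hr (hu k)
  filter_upwards [ae_lt_top' (AEMeasurable.tsum fun k => (hu k).enorm) h1] with ω hω
  have : ∑' k, ‖u k ω‖ₑ ≠ ∞ := hω.ne
  have h2 := ENNReal.summable_toReal this
  refine h2.congr fun k => ?_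
  simp

/-- Fatou's lemma along a sequence of finite sets exhausting the index set, which is countable,
together with the triangle inequality. -/
lemma eLpNorm_le_tsum_of_hasSum (hr : 1 ≤ r) (hu : ∀ k, AEStronglyMeasurable (u k) μ) {f : Ω → ℝ}
    (hf : ∀ᵐ ω ∂μ, HasSum (fun k => u k ω) (f ω)) : eLpNorm f r μ ≤ ∑' k, eLpNorm (u k) r μ := by
  obtain ⟨s, hs⟩ := exists_seq_tendsto (atTop : Filter (Finset ι))
  have h1 : ∀ᵐ ω ∂μ, Tendsto (fun n => (∑ k ∈ s n, u k) ω) atTop (𝓝 (f ω)) := by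
    filter_upwards [hf] with ω h
    simp only [Finset.sum_apply]
    exact (show Tendsto (fun s : Finset ι => ∑ k ∈ s, u k ω) atTop (𝓝 (f ω)) from h).comp hs
  refine (Lp.eLpNorm_lim_le_liminf_eLpNorm (fun n => Finset.aestronglyMeasurable_sum (s n)
    fun k _ => hu k) f h1).trans ?_
  refine liminf_le_of_le (by isBoundedDefault) fun b hb => ?_
  obtain ⟨n, hn⟩ := hb.exists
  exact hn.trans ((eLpNorm_sum_le (fun k _ => hu k) hr).trans (ENNReal.sum_le_tsum _))

end Series

/-! ### From martingale differences to their sums, and boundary terms. -/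

section

variable {Ω : Type*} [mΩ : MeasurableSpace Ω] {μ : Measure Ω} {θ : Ω ≃ᵐ Ω}

lemma measurable_wmax (a : ℕ → ℝ) {X : ℤ → Ω → ℝ} (hX : ∀ i, Measurable (X i)) :
    Measurable (wmax a X) := by
  refine Measurable.iSup fun n => Measurable.iSup fun _ => ?_
  have h : Measurable (partialSum X n) :=
    Finset.measurable_fun_sum (Finset.range n) (f := fun i : ℕ => X i) fun i _ => hX i
  exact (h.abs.div_const (a n)).ennreal_ofReal

lemma ae_hasSum_iter (hθ : MeasurePreserving θ μ μ) {D : ℕ → Ω → ℝ} {X : Ω → ℝ}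
    (h : ∀ᵐ ω ∂μ, HasSum (fun k => D k ω) (X ω)) :
    ∀ᵐ ω ∂μ, ∀ i : ℤ, HasSum (fun k => D k (iter θ i ω)) (X (iter θ i ω)) :=
  ae_all_iff.2 fun i => ae_comp_iter hθ h i

lemma hasSum_partialSum {Ω : Type*} {D : ℕ → ℤ → Ω → ℝ} {X : ℤ → Ω → ℝ} {ω : Ω}
    (h : ∀ i : ℤ, HasSum (fun k => D k i ω) (X i ω)) (n : ℕ) :
    HasSum (fun k => partialSum (D k) n ω) (partialSum X n ω) :=
  hasSum_sum fun i _ => h i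

lemma wmax_le_tsum {Ω : Type*} {a : ℕ → ℝ} {D : ℕ → ℤ → Ω → ℝ} {X : ℤ → Ω → ℝ} {ω : Ω}
    (ha : ∀ n, 1 ≤ n → 0 < a n)
    (h : ∀ i : ℤ, HasSum (fun k => D k i ω) (X i ω)) :
    wmax a X ω ≤ ∑' k, wmax a (D k) ω := by
  refine iSup_le fun n => iSup_le fun hn => ?_
  have hcont : Continuous fun x : ℝ => ENNReal.ofReal (|x| / a n) :=
    ENNReal.continuous_ofReal.comp (continuous_abs.div_const _)
  refine le_of_tendsto' ((hcont.tendsto _).comp (hasSum_partialSum h n).tendsto_sum_nat)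
    fun N => ?_
  have h1 : |∑ k ∈ Finset.range N, partialSum (D k) n ω| / a n ≤
      ∑ k ∈ Finset.range N, |partialSum (D k) n ω| / a n := by
    rw [← Finset.sum_div]
    have := ha n hn
    gcongr
    exact Finset.abs_sum_le_sum_abs _ _
  refine (ENNReal.ofReal_le_ofReal h1).trans ?_
  rw [ENNReal.ofReal_sum_of_nonneg fun k _ => div_nonneg (abs_nonneg _) (ha n hn).le]
  refine (Finset.sum_le_sum fun k _ => ?_).trans (ENNReal.sum_le_tsum (Finset.range N))
  exact le_iSup₂ (f := fun n (_ : 1 ≤ n) => ENNReal.ofReal (|partialSum (D k) n ω| / a n)) n hn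

lemma abs_partialSum_div_le {Ω : Type*} {a : ℕ → ℝ} {X : ℤ → Ω → ℝ} {ω : Ω} (h : wmax a X ω ≠ ∞)
    {n : ℕ} (hn : 1 ≤ n) : |partialSum X n ω| / a n ≤ (wmax a X ω).toReal := by
  rw [← ENNReal.ofReal_le_iff_le_toReal h]
  exact le_iSup₂ (f := fun n (_ : 1 ≤ n) => ENNReal.ofReal (|partialSum X n ω| / a n)) n hn

/-- Dominated convergence for series of normalised sequences. -/
lemma tendsto_div_of_hasSum {a : ℕ → ℝ} (ha : ∀ n, 1 ≤ n → 0 < a n) {h : ℕ → ℕ → ℝ} {s : ℕ → ℝ}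
    (hs : ∀ n, HasSum (fun k => h k n) (s n)) {B : ℕ → ℝ} (hB : Summable B)
    (hle : ∀ k n, 1 ≤ n → |h k n| / a n ≤ B k)
    (h0 : ∀ k, Tendsto (fun n => |h k n| / a n) atTop (𝓝 0)) :
    Tendsto (fun n => |s n| / a n) atTop (𝓝 0) := by
  have h1 : Tendsto (fun n => ∑' k, h k n / a n) atTop (𝓝 (∑' _ : ℕ, (0 : ℝ))) := by
    refine tendsto_tsum_of_dominated_convergence hB (fun k => ?_) ?_
    · rw [tendsto_zero_iff_abs_tendsto_zero]
      refine (h0 k).congr' ?_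
      filter_upwards [eventually_ge_atTop 1] with n hn
      simp [abs_div, abs_of_pos (ha n hn)]
    · filter_upwards [eventually_ge_atTop 1] with n hn k
      rw [Real.norm_eq_abs, abs_div, abs_of_pos (ha n hn)]
      exact hle k n hn
  rw [tsum_zero, tendsto_zero_iff_abs_tendsto_zero] at h1
  refine h1.congr' ?_
  filter_upwards [eventually_ge_atTop 1] with n hn
  simp only [Function.comp_apply]
  rw [tsum_div_const, (hs n).tsum_eq, abs_div, abs_of_pos (ha n hn)]

/-- Telescoping: a shift by `j` leaves the first `j` values, killed by the normalisation alone, and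
`j` values near `n`, small by hypothesis. -/
lemma tendsto_sum_sub_shift {a : ℕ → ℝ} (ha : Tendsto (fun n => (a n)⁻¹) atTop (𝓝 0)) {h : ℤ → ℝ}
    (hh : ∀ j : ℕ, Tendsto (fun n : ℕ => h (n + j) / a n) atTop (𝓝 0)) (j : ℕ) :
    Tendsto (fun n : ℕ => (∑ i ∈ Finset.range n, (h i - h (i + j))) / a n) atTop (𝓝 0) := by
  induction j with
  | zero => simp
  | succ j ih =>
    have h1 := (ih.add (ha.const_mul (h j))).sub (hh j)
    rw [mul_zero, add_zero, sub_zero] at h1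
    refine h1.congr fun n => ?_
    have h2 := Finset.sum_range_sub' (fun i : ℕ => h (i + j)) n
    have h3 : ∑ i ∈ Finset.range n, (h i - h (i + (j + 1 : ℕ))) =
        ∑ i ∈ Finset.range n, (h i - h (i + j)) + (h j - h (n + j)) := by
      rw [show h j - h (n + j) = h ((0 : ℕ) + j) - h (n + j) by simp, ← h2,
        ← Finset.sum_add_distrib]
      refine Finset.sum_congr rfl fun i _ => ?_
      have : ((i : ℤ) + ((j + 1 : ℕ) : ℤ)) = ((i + 1 : ℕ) : ℤ) + j := by push_cast; ring
      rw [this]; ring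
    rw [h3]
    ring

lemma sqrt_le_lilScale (n : ℕ) : √(n : ℝ) ≤ lilScale n := by
  refine Real.sqrt_le_sqrt ?_
  exact le_mul_of_one_le_right (Nat.cast_nonneg n) (one_le_L _)

lemma tendsto_inv_lilScale : Tendsto (fun n => (lilScale n)⁻¹) atTop (𝓝 0) :=
  tendsto_inv_atTop_zero.comp (tendsto_atTop_mono sqrt_le_lilScale
    (Real.tendsto_sqrt_atTop.comp tendsto_natCast_atTop_atTop))

/-- By stationarity the series is the tail sum of one integrable variable, `W ^ 2 / ε ^ 2`. -/
lemma tsum_measure_sq_gt_lt_top [IsProbabilityMeasure μ] (hθ : MeasurePreserving θ μ μ) {W : Ω → ℝ}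
    (hW : MemLp W 2 μ) {ε : ℝ} :
    ∑' n : ℕ, μ {ω | (n : ℝ) < W (iter θ n ω) ^ 2 / ε ^ 2} ≠ ∞ := by
  let _ : MeasureSpace Ω := ⟨μ⟩
  have h := ProbabilityTheory.tsum_prob_mem_Ioi_lt_top (Ω := Ω) (X := fun ω => W ω ^ 2 / ε ^ 2)
    (hW.integrable_sq.div_const _) (fun ω => by positivity)
  refine (lt_of_le_of_lt (le_of_eq (tsum_congr fun n => ?_)) h).ne
  exact (measurePreserving_iter hθ n).measure_preimage_emb (measurableEmbedding_iter hθ n)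
    {ω | (n : ℝ) < W ω ^ 2 / ε ^ 2}

/-- The Borel–Cantelli lemma for the events `W ∘ θ ^ n > ε √n` in absolute value. This disposes of
the boundary terms in the martingale approximation. -/
lemma ae_tendsto_div_sqrt [IsProbabilityMeasure μ] (hθ : MeasurePreserving θ μ μ) {W : Ω → ℝ}
    (hW : MemLp W 2 μ) :
    ∀ᵐ ω ∂μ, Tendsto (fun n : ℕ => W (iter θ n ω) / √(n : ℝ)) atTop (𝓝 0) := by
  obtain ⟨u, -, hu0, hu⟩ := exists_seq_strictAnti_tendsto (0 : ℝ)
  filter_upwards [ae_all_iff.2 fun i =>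
    ae_eventually_notMem (tsum_measure_sq_gt_lt_top hθ hW (ε := u i))] with ω hω
  rw [Metric.tendsto_atTop']
  intro ε hε
  obtain ⟨i, hi⟩ := ((tendsto_order.1 hu).2 ε hε).exists
  obtain ⟨N, hN⟩ := eventually_atTop.1 (hω i)
  refine ⟨N, fun n hn => ?_⟩
  have h1 : W (iter θ n ω) ^ 2 / u i ^ 2 ≤ n := not_lt.1 (hN n hn.le)
  have hn0 : (0 : ℝ) < n := by exact_mod_cast (Nat.zero_le N).trans_lt hn
  have hs : 0 < √(n : ℝ) := Real.sqrt_pos.2 hn0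
  rw [div_le_iff₀ (pow_pos (hu0 i) 2)] at h1
  rw [Real.dist_0_eq_abs, abs_div, abs_of_pos hs, div_lt_iff₀ hs]
  have h2 : |W (iter θ n ω)| ≤ u i * √(n : ℝ) := by
    refine abs_le_of_sq_le_sq ?_ (mul_nonneg (hu0 i).le hs.le)
    rw [mul_pow, Real.sq_sqrt hn0.le]; linarith
  exact h2.trans_lt (mul_lt_mul_of_pos_right hi hs)

lemma MemLp.comp_iter (hθ : MeasurePreserving θ μ μ) {W : Ω → ℝ} {p : ℝ≥0∞} (hW : MemLp W p μ)
    (j : ℤ) : MemLp (W ∘ iter θ j) p μ :=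
  hW.comp_measurePreserving (measurePreserving_iter hθ j)

end

lemma IsStationaryMDS.comp_iter {Ω : Type*} {m : MeasurableSpace Ω} [MeasurableSpace Ω] {μ : Measure Ω}
    {θ : Ω ≃ᵐ Ω} [IsProbabilityMeasure μ] {d : Ω → ℝ}
    (h : IsStationaryMDS m μ θ d) (j : ℤ) :
    IsStationaryMDS (filt m θ j) μ θ (d ∘ iter θ j) where
  mp := h.mp
  le := filt_le h.mp h.le j
  le_comap := by
    have := filt_mono h.le_comap (show j ≤ j + 1 by omega)
    rwa [← filt_filt, filt_one] at this
  meas := by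
    have := StronglyMeasurable.comp_iter (θ := θ) h.meas j
    rw [filt_filt, add_comm] at this
    rwa [filt_filt]
  condExp_eq := by
    filter_upwards [condExp_comp_iter h.mp h.le d j, ae_comp_iter h.mp h.condExp_eq j] with ω h1 h2
    rw [h1]; exact h2

section

variable {Ω : Type u} [MeasurableSpace Ω] {μ : Measure Ω}

lemma ae_summable_wmax {q : ℝ} (hq : 0 < q) {a : ℕ → ℝ} {D : ℕ → ℤ → Ω → ℝ}
    (h : weakNorm μ q (fun ω => ∑' k, wmax a (D k) ω) ≠ ∞) :
    ∀ᵐ ω ∂μ, (∀ k, wmax a (D k) ω ≠ ∞) ∧ Summable fun k => (wmax a (D k) ω).toReal := by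
  filter_upwards [ae_lt_top_of_weakNorm hq h] with ω hω
  exact ⟨ENNReal.ne_top_of_tsum_ne_top hω.ne, ENNReal.summable_toReal hω.ne⟩

end

/-- Maximal inequality and strong law for stationary processes with a martingale decomposition
summable in `L^p`, `1 < p < 2`. -/
lemma exists_maxFun_of_hasSum {p : ℝ} (hp : 1 < p) (hp2 : p < 2) : ∃ C : ℝ, 0 < C ∧
    ∀ {Ω : Type u} {m : ℕ → MeasurableSpace Ω} [MeasurableSpace Ω] {μ : Measure Ω}
      [IsProbabilityMeasure μ] {θ : Ω ≃ᵐ Ω} {D : ℕ → Ω → ℝ} {X : Ω → ℝ},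
      (∀ k, IsStationaryMDS (m k) μ θ (D k)) → (∀ k, MemLp (D k) (ENNReal.ofReal p) μ) →
      ∑' k, eLpNorm (D k) (ENNReal.ofReal p) μ ≠ ∞ → (∀ᵐ ω ∂μ, HasSum (fun k => D k ω) (X ω)) →
      weakNorm μ p (maxFun p fun i => X ∘ iter θ i) ≤
        ENNReal.ofReal C * ∑' k, eLpNorm (D k) (ENNReal.ofReal p) μ ∧
      ∀ᵐ ω ∂μ, Tendsto (fun n : ℕ => |partialSum (fun i => X ∘ iter θ i) n ω| / (n : ℝ) ^ (1 / p))
        atTop (𝓝 0) := by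
  have hp0 : 0 < p := by linarith
  obtain ⟨C₁, hC₁, H₁⟩ := exists_weakNorm_maxFun_le.{u} hp hp2
  obtain ⟨C₂, hC₂, H₂⟩ := exists_weakNorm_tsum_le.{u} hp
  refine ⟨C₂ * C₁, by positivity, ?_⟩
  intro Ω m _ μ _ θ D X hD hDp hfin hX
  have hθ := (hD 0).mp
  have hmeas : ∀ k (i : ℤ), Measurable (D k ∘ iter θ i) := fun k i =>
    (hD k).stronglyMeasurable.measurable.comp (measurePreserving_iter hθ i).measurable
  have hw : weakNorm μ p (fun ω => ∑' k, wmax (fun n => (n : ℝ) ^ (1 / p))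
      (fun i => D k ∘ iter θ i) ω) ≤
      ENNReal.ofReal (C₂ * C₁) * ∑' k, eLpNorm (D k) (ENNReal.ofReal p) μ := by
    refine (H₂ fun k => measurable_wmax _ (hmeas k)).trans ?_
    rw [ENNReal.ofReal_mul hC₂.le, mul_assoc,
      ← ENNReal.tsum_mul_left (a := ENNReal.ofReal C₁)]
    refine mul_le_mul_right (ENNReal.tsum_le_tsum fun k => ?_) _
    exact (H₁ (hD k) (hDp k)).1
  have hsum := ae_hasSum_iter hθ hX
  refine ⟨(weakNorm_mono_ae hp0.le ?_).trans hw, ?_⟩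
  · filter_upwards [hsum] with ω h
    exact wmax_le_tsum (a := fun n => (n : ℝ) ^ (1 / p)) rpow_scale_pos h
  · filter_upwards [hsum, ae_summable_wmax hp0 (ne_top_of_le_ne_top
      (ENNReal.mul_ne_top ENNReal.ofReal_ne_top hfin) hw),
      ae_all_iff.2 fun k => (H₁ (hD k) (hDp k)).2] with ω h1 h2 h3
    exact tendsto_div_of_hasSum rpow_scale_pos (hasSum_partialSum h1) h2.2
      (fun k n hn => abs_partialSum_div_le (h2.1 k) hn) h3

/-- Maximal inequality at the scale of the iterated logarithm for stationary processes with a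
martingale decomposition summable in `L²`. -/
lemma exists_maxFunLIL_of_hasSum {q : ℝ} (hq : 1 < q) (hq2 : q < 2) : ∃ C : ℝ, 0 < C ∧
    ∀ {Ω : Type u} {m : ℕ → MeasurableSpace Ω} [MeasurableSpace Ω] {μ : Measure Ω}
      [IsProbabilityMeasure μ] {θ : Ω ≃ᵐ Ω} {D : ℕ → Ω → ℝ} {X : Ω → ℝ},
      (∀ k, IsStationaryMDS (m k) μ θ (D k)) → (∀ k, MemLp (D k) 2 μ) →
      (∀ᵐ ω ∂μ, HasSum (fun k => D k ω) (X ω)) →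
      weakNorm μ q (maxFunLIL fun i => X ∘ iter θ i) ≤
        ENNReal.ofReal C * ∑' k, eLpNorm (D k) 2 μ ∧
      weakNorm μ q (fun ω => ∑' k, wmax lilScale (fun i => D k ∘ iter θ i) ω) ≤
        ENNReal.ofReal C * ∑' k, eLpNorm (D k) 2 μ := by
  have hq0 : 0 < q := by linarith
  obtain ⟨C₁, hC₁, H₁⟩ := exists_weakNorm_maxFunLIL_le.{u} hq hq2
  obtain ⟨C₂, hC₂, H₂⟩ := exists_weakNorm_tsum_le.{u} hq
  refine ⟨C₂ * C₁, by positivity, ?_⟩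
  intro Ω m _ μ _ θ D X hD hDp hX
  have hθ := (hD 0).mp
  have hmeas : ∀ k (i : ℤ), Measurable (D k ∘ iter θ i) := fun k i =>
    (hD k).stronglyMeasurable.measurable.comp (measurePreserving_iter hθ i).measurable
  -- The bound is kept for the sum of the maximal functions as well: its almost sure finiteness
  -- later dominates the interchange of limit and series.
  have hw : weakNorm μ q (fun ω => ∑' k, wmax lilScale (fun i => D k ∘ iter θ i) ω) ≤
      ENNReal.ofReal (C₂ * C₁) * ∑' k, eLpNorm (D k) 2 μ := by
    refine (H₂ fun k => measurable_wmax _ (hmeas k)).trans ?_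
    rw [ENNReal.ofReal_mul hC₂.le, mul_assoc,
      ← ENNReal.tsum_mul_left (a := ENNReal.ofReal C₁)]
    refine mul_le_mul_right (ENNReal.tsum_le_tsum fun k => ?_) _
    exact H₁ (hD k) (hDp k)
  refine ⟨(weakNorm_mono_ae hq0.le ?_).trans hw, hw⟩
  filter_upwards [ae_hasSum_iter hθ hX] with ω h
  exact wmax_le_tsum (a := lilScale) lilScale_pos h

/-- Almost sure martingale approximation at the scale of the iterated logarithm. -/
lemma ae_isLittleO_of_hasSum {Ω : Type u} {m : ℕ → MeasurableSpace Ω} [MeasurableSpace Ω]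
    {μ : Measure Ω} [IsProbabilityMeasure μ] {θ : Ω ≃ᵐ Ω} {D : ℕ → Ω → ℝ} {X d : Ω → ℝ}
    (hD : ∀ k, IsStationaryMDS (m k) μ θ (D k)) (hD2 : ∀ k, MemLp (D k) 2 μ)
    (hfin : ∑' k, eLpNorm (D k) 2 μ ≠ ∞) (hX : ∀ᵐ ω ∂μ, HasSum (fun k => D k ω) (X ω))
    (hd : ∀ᵐ ω ∂μ, HasSum (fun k : ℕ => D k (iter θ (k + 1) ω)) (d ω)) :
    ∀ᵐ ω ∂μ, (fun n : ℕ => partialSum (fun i => X ∘ iter θ i) n ω -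
      partialSum (fun i => d ∘ iter θ i) n ω) =o[atTop] lilScale := by
  have hθ := (hD 0).mp
  -- The shift by `k + 1` brings all the components, which live at the times `-k`, to the common
  -- time 1, where they add up to `d`.
  set E : ℕ → Ω → ℝ := fun k => D k ∘ iter θ (k + 1) with hE
  have hEM : ∀ k, IsStationaryMDS (filt (m k) θ (k + 1)) μ θ (E k) := fun k =>
    (hD k).comp_iter (k + 1)
  have hE2 : ∀ k, MemLp (E k) 2 μ := fun k => MemLp.comp_iter hθ (hD2 k) _
  have hEfin : ∑' k, eLpNorm (E k) 2 μ ≠ ∞ := by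
    simpa only [hE, eLpNorm_comp_iter hθ] using hfin
  -- Any exponent strictly between 1 and 2 would do: only the almost sure finiteness of the sums of
  -- maximal functions is used.
  obtain ⟨C, -, H⟩ := exists_maxFunLIL_of_hasSum.{u} (q := 3 / 2) (by norm_num) (by norm_num)
  have hw1 := ne_top_of_le_ne_top (ENNReal.mul_ne_top ENNReal.ofReal_ne_top hfin) (H hD hD2 hX).2
  have hw2 := ne_top_of_le_ne_top (ENNReal.mul_ne_top ENNReal.ofReal_ne_top hEfin)
    (H hEM hE2 hd).2
  have hshift : ∀ᵐ ω ∂μ, ∀ (k : ℕ) (j : ℕ),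
      Tendsto (fun n : ℕ => D k (iter θ (n + j) ω) / √(n : ℝ)) atTop (𝓝 0) := by
    refine ae_all_iff.2 fun k => ae_all_iff.2 fun j => ?_
    filter_upwards [ae_tendsto_div_sqrt hθ (MemLp.comp_iter hθ (hD2 k) j)] with ω h
    refine h.congr fun n => ?_
    rw [add_comm (n : ℤ), iter_add]; rfl
  filter_upwards [ae_hasSum_iter hθ hX, ae_hasSum_iter hθ hd,
    ae_summable_wmax (by norm_num) hw1, ae_summable_wmax (by norm_num) hw2, hshift]
    with ω h1 h2 h3 h4 h5
  have ht := tendsto_div_of_hasSum (a := lilScale) lilScale_pos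
    (h := fun k n => partialSum (fun i => D k ∘ iter θ i) n ω - partialSum (fun i => E k ∘ iter θ i) n ω)
    (s := fun n => partialSum (fun i => X ∘ iter θ i) n ω - partialSum (fun i => d ∘ iter θ i) n ω)
    (fun n => (hasSum_partialSum h1 n).sub (hasSum_partialSum h2 n)) (h3.2.add h4.2) ?_ ?_
  · rw [isLittleO_iff_tendsto']
    · rw [tendsto_zero_iff_abs_tendsto_zero]
      refine ht.congr' ?_
      filter_upwards [eventually_ge_atTop 1] with n hn
      simp only [Function.comp_apply, abs_div, abs_of_pos (lilScale_pos n hn)]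
    · filter_upwards [eventually_ge_atTop 1] with n hn h
      exact absurd h (lilScale_pos n hn).ne'
  · intro k n hn
    have e1 := abs_partialSum_div_le (h3.1 k) hn
    have e2 := abs_partialSum_div_le (h4.1 k) hn
    refine le_trans ?_ (add_le_add e1 e2)
    rw [← add_div]
    have := lilScale_pos n hn
    gcongr
    exact abs_sub _ _
  · intro k
    have hh : ∀ j : ℕ, Tendsto (fun n : ℕ => D k (iter θ (n + j) ω) / lilScale n) atTop (𝓝 0) := by
      intro j
      rw [tendsto_zero_iff_abs_tendsto_zero]
      refine squeeze_zero' (Eventually.of_forall fun n => abs_nonneg _) ?_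
        (tendsto_zero_iff_abs_tendsto_zero _ |>.1 (h5 k j))
      filter_upwards [eventually_ge_atTop 1] with n hn
      have hs : 0 < √(n : ℝ) := Real.sqrt_pos.2 (by exact_mod_cast hn)
      simp only [Function.comp_apply, abs_div, abs_of_pos hs, abs_of_pos (lilScale_pos n hn)]
      exact div_le_div_of_nonneg_left (abs_nonneg _) hs (sqrt_le_lilScale n)
    have h6 := tendsto_sum_sub_shift tendsto_inv_lilScale
      (h := fun i : ℤ => D k (iter θ i ω)) hh (k + 1)
    rw [tendsto_zero_iff_abs_tendsto_zero] at h6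
    refine h6.congr' ?_
    filter_upwards [eventually_ge_atTop 1] with n hn
    simp only [Function.comp_apply, abs_div, abs_of_pos (lilScale_pos n hn)]
    congr 2
    simp only [partialSum, hE, Finset.sum_sub_distrib, Function.comp_apply]
    congr 1
    refine Finset.sum_congr rfl fun i _ => ?_
    rw [← Function.comp_apply (f := iter θ (k + 1)), ← iter_add]
    congr 2
    push_cast; ring

/-! ### Uniform convexity of `|x| ^ r`. -/

section Pointwise

variable {r : ℝ}

/-- This is the derivative of `|x| ^ r` minus a quadratic whose second derivative is the minimum of
that of `|x| ^ r` on `[-R, R]`, attained at the ends because `r ≤ 2`. The function is odd, so the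
half `[0, R]` is enough and the singularity at 0 is avoided. -/
lemma monotoneOn_rpow_sub_mul (hr : 1 < r) (hr2 : r ≤ 2) {R : ℝ} (hR : 0 < R) :
    MonotoneOn (fun x : ℝ => r * |x| ^ (r - 2) * x - r * (r - 1) * R ^ (r - 2) * x)
      (Set.Icc (-R) R) := by
  set g : ℝ → ℝ := fun x => r * |x| ^ (r - 2) * x - r * (r - 1) * R ^ (r - 2) * x with hg
  have hodd : ∀ x, g (-x) = -g x := fun x => by simp only [hg, abs_neg]; ring
  have hpos : ∀ x, 0 ≤ x → g x = r * x ^ (r - 1) - r * (r - 1) * R ^ (r - 2) * x := by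
    intro x hx
    rcases hx.eq_or_lt with rfl | hx
    · simp [hg, Real.zero_rpow (sub_pos.2 hr).ne']
    · simp only [hg]
      rw [abs_of_pos hx, mul_assoc, ← Real.rpow_add_one hx.ne']
      congr 3; ring
  have hmono : MonotoneOn g (Set.Icc 0 R) := by
    have : MonotoneOn (fun x : ℝ => r * x ^ (r - 1) - r * (r - 1) * R ^ (r - 2) * x)
        (Set.Icc 0 R) := by
      refine monotoneOn_of_hasDerivWithinAt_nonneg (convex_Icc 0 R)
        (f' := fun x => r * ((r - 1) * x ^ (r - 1 - 1)) - r * (r - 1) * R ^ (r - 2) * 1) ?_ ?_ ?_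
      · refine ContinuousOn.sub (continuousOn_const.mul ?_) (by fun_prop)
        exact (Real.continuous_rpow_const (by linarith)).continuousOn
      · intro x hx
        rw [interior_Icc] at hx
        refine HasDerivAt.hasDerivWithinAt ?_
        exact ((Real.hasDerivAt_rpow_const (Or.inl hx.1.ne')).const_mul r).sub
          ((hasDerivAt_id x).const_mul _)
      · intro x hx
        rw [interior_Icc] at hx
        have h1 : R ^ (r - 2) ≤ x ^ (r - 2) :=
          Real.rpow_le_rpow_of_nonpos hx.1 hx.2.le (by linarith)
        have h2 : 0 ≤ r * (r - 1) := mul_nonneg (by linarith) (by linarith)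
        have e : r - 1 - 1 = r - 2 := by ring
        rw [e]
        nlinarith [mul_le_mul_of_nonneg_left h1 h2]
    intro x hx y hy hxy
    have := this hx hy hxy
    rwa [hpos x hx.1, hpos y hy.1]
  have h0 : g 0 = 0 := by simp [hg]
  intro x hx y hy hxy
  rcases le_total 0 x with h | h
  · exact hmono ⟨h, hx.2⟩ ⟨h.trans hxy, hy.2⟩ hxy
  · rcases le_total y 0 with h' | h'
    · have := hmono (a := -y) (b := -x) ⟨by linarith, by linarith [hy.1]⟩
        ⟨by linarith, by linarith [hx.1]⟩ (by linarith)
      rw [hodd, hodd] at this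
      linarith
    · have h1 := hmono (a := 0) (b := y) ⟨le_rfl, hR.le⟩ ⟨h', hy.2⟩ h'
      have h2 := hmono (a := 0) (b := -x) ⟨le_rfl, hR.le⟩ ⟨by linarith, by linarith [hx.1]⟩
        (by linarith)
      rw [hodd] at h2
      linarith

/-- Uniform convexity of `|x|^r`, `1 < r ≤ 2`. -/
lemma abs_rpow_add_ge (hr : 1 < r) (hr2 : r ≤ 2) (a d : ℝ) :
    |a| ^ r + r * |a| ^ (r - 2) * a * d + r * (r - 1) / 2 * (d ^ 2 * (|a| + |d|) ^ (r - 2)) ≤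
      |a + d| ^ r := by
  wlog hd : 0 ≤ d generalizing a d
  · have := this (-a) (-d) (by linarith)
    simp only [abs_neg, ← neg_add] at this
    linarith
  rcases hd.eq_or_lt with rfl | hd
  · simp
  set R := |a| + |d| with hR
  have hR0 : 0 < R := by have := abs_nonneg a; have := abs_pos.2 hd.ne'; linarith
  -- `F` is convex on `[-R, R]`, an interval containing `a` and `a + d`; the claim says that it lies
  -- above its tangent at `a`. The term in `d ^ 2` comes from expanding the subtracted quadratic.
  set F : ℝ → ℝ := fun x => |x| ^ r - r * (r - 1) / 2 * R ^ (r - 2) * x ^ 2 with hF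
  set g : ℝ → ℝ := fun x : ℝ => r * |x| ^ (r - 2) * x - r * (r - 1) * R ^ (r - 2) * x with hg
  have hder : ∀ x, HasDerivAt F (g x) x := by
    intro x
    have h := (hasDerivAt_abs_rpow x hr).sub
      ((hasDerivAt_pow 2 x).const_mul (r * (r - 1) / 2 * R ^ (r - 2)))
    exact HasDerivAt.congr_deriv (f := F) h (by simp only [hg]; push_cast; ring)
  obtain ⟨x, hx, hxe⟩ := exists_hasDerivAt_eq_slope F g (show a < a + d by linarith)
    (fun x _ => (hder x).continuousAt.continuousWithinAt) (fun x _ => hder x)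
  have ha1 := neg_abs_le a
  have ha2 := le_abs_self a
  have hdd : |d| = d := abs_of_pos hd
  have h1 := monotoneOn_rpow_sub_mul hr hr2 hR0 (a := a) (b := x)
    ⟨by linarith, by linarith⟩ ⟨by linarith [hx.1], by linarith [hx.2]⟩ hx.1.le
  change g a ≤ g x at h1
  rw [hxe, le_div_iff₀ (by linarith)] at h1
  simp only [hg, hF] at h1
  linarith

end Pointwise

/-! ### Cotype 2 of `L^r` for martingales. -/

section Cotype

variable {Ω : Type*} {m : MeasurableSpace Ω} [mΩ : MeasurableSpace Ω] {μ : Measure Ω} {r : ℝ}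

lemma ofReal_ne_zero_of_one_lt (hr : 1 < r) : ENNReal.ofReal r ≠ 0 :=
  (ENNReal.ofReal_pos.2 (by linarith)).ne'

lemma one_le_ofReal (hr : 1 < r) : 1 ≤ ENNReal.ofReal r := by
  rw [← ENNReal.ofReal_one]; exact ENNReal.ofReal_le_ofReal hr.le

lemma eLpNorm_rpow_eq (hr : 1 < r) (Z : Ω → ℝ) :
    eLpNorm Z (ENNReal.ofReal r) μ ^ r = ∫⁻ ω, ENNReal.ofReal (|Z ω| ^ r) ∂μ := by
  have hr0 : 0 < r := by linarith
  rw [eLpNorm_eq_lintegral_rpow_enorm_toReal (ofReal_ne_zero_of_one_lt hr) ENNReal.ofReal_ne_top,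
    ENNReal.toReal_ofReal hr0.le, ← ENNReal.rpow_mul, one_div_mul_cancel hr0.ne', ENNReal.rpow_one]
  refine lintegral_congr fun ω => ?_
  rw [Real.enorm_eq_ofReal_abs, ENNReal.ofReal_rpow_of_nonneg (abs_nonneg _) hr0.le]

lemma integrable_abs_rpow (hr : 1 < r) {Z : Ω → ℝ} (hZ : MemLp Z (ENNReal.ofReal r) μ) :
    Integrable (fun ω => |Z ω| ^ r) μ := by
  have := hZ.integrable_norm_rpow (ofReal_ne_zero_of_one_lt hr) ENNReal.ofReal_ne_top
  rwa [ENNReal.toReal_ofReal (by linarith)] at this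

lemma abs_mul_self_rpow_le (hr : 1 < r) (a d : ℝ) :
    |(|a| ^ (r - 2) * a) * d| ≤ |a| ^ r + |d| ^ r := by
  rcases eq_or_ne a 0 with rfl | ha
  · simp only [mul_zero, zero_mul, abs_zero]; positivity
  have ha0 := abs_pos.2 ha
  rw [abs_mul, abs_mul, abs_of_nonneg (by positivity : (0 : ℝ) ≤ |a| ^ (r - 2)),
    ← Real.rpow_add_one ha0.ne']
  have hm : ∀ x y : ℝ, 0 < x → 0 ≤ y → x ≤ y → x ^ (r - 2 + 1) * y ≤ y ^ r := by
    intro x y hx hy hxy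
    have hy0 : 0 < y := hx.trans_le hxy
    calc x ^ (r - 2 + 1) * y ≤ y ^ (r - 2 + 1) * y := by
          gcongr; linarith
      _ = y ^ r := by rw [← Real.rpow_add_one hy0.ne']; congr 1; ring
  rcases le_total |a| |d| with h | h
  · have h1 := hm |a| |d| ha0 (abs_nonneg _) h
    have h2 : 0 ≤ |a| ^ r := by positivity
    linarith
  · have h1 := hm |a| |a| ha0 (abs_nonneg _) le_rfl
    have h2 : 0 ≤ |d| ^ r := by positivity
    have h3 : |a| ^ (r - 2 + 1) * |d| ≤ |a| ^ (r - 2 + 1) * |a| := by gcongr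
    linarith

/-- The uniform convexity inequality is integrated. Its linear term `|N| ^ (r - 2) * N * D` has mean
zero, as `D` is conditionally centred and the factor in front is `m`-measurable. -/
lemma lintegral_add_le_of_condExp_eq_zero [IsProbabilityMeasure μ] (hr : 1 < r) (hr2 : r ≤ 2) (hm : m ≤ mΩ) {N D : Ω → ℝ}
    (hN : StronglyMeasurable[m] N) (hNr : MemLp N (ENNReal.ofReal r) μ)
    (hDr : MemLp D (ENNReal.ofReal r) μ) (h0 : μ[D | m] =ᵐ[μ] 0) :
    ∫⁻ ω, ENNReal.ofReal (|N ω| ^ r) ∂μ + ENNReal.ofReal (r * (r - 1) / 2) *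
      ∫⁻ ω, ENNReal.ofReal (D ω ^ 2 * (|N ω| + |D ω|) ^ (r - 2)) ∂μ ≤
      ∫⁻ ω, ENNReal.ofReal (|N ω + D ω| ^ r) ∂μ := by
  have hr1 := one_le_ofReal hr
  set c := r * (r - 1) / 2 with hc
  have hc0 : 0 < c := by rw [hc]; have : 0 < r - 1 := by linarith
                         positivity
  set Q : Ω → ℝ := fun ω => D ω ^ 2 * (|N ω| + |D ω|) ^ (r - 2) with hQ
  have hQ0 : ∀ ω, 0 ≤ Q ω := fun ω => by positivity
  have i1 := integrable_abs_rpow hr hNr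
  have i2 := integrable_abs_rpow hr hDr
  have i3 : Integrable (fun ω => |N ω + D ω| ^ r) μ := integrable_abs_rpow hr (hNr.add hDr)
  set K : Ω → ℝ := fun ω => |N ω| ^ (r - 2) * N ω with hK
  have hKm : StronglyMeasurable[m] K :=
    ((by fun_prop : Measurable fun x : ℝ => |x| ^ (r - 2) * x).comp
      hN.measurable).stronglyMeasurable
  have hDm := hDr.1
  have hNm := hNr.1
  have i4 : Integrable (K * D) μ := by
    refine (i1.add i2).mono' ((hKm.mono hm).aestronglyMeasurable.mul hDm) (ae_of_all _ fun ω => ?_)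
    exact abs_mul_self_rpow_le hr _ _
  have e4 : ∫ ω, K ω * D ω ∂μ = 0 :=
    integral_mul_eq_zero_of_condExp hm hKm i4 (hDr.integrable hr1) h0
  have hpt : ∀ ω, |N ω| ^ r + r * (K ω * D ω) + c * Q ω ≤ |N ω + D ω| ^ r := fun ω => by
    have := abs_rpow_add_ge hr hr2 (N ω) (D ω)
    simp only [hK, hQ, hc]
    linarith
  have i5 : Integrable (fun ω => |N ω + D ω| ^ r - |N ω| ^ r - r * (K ω * D ω)) μ :=
    (i3.sub i1).sub (i4.const_mul r)
  have hQm : AEStronglyMeasurable Q μ := by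
    have h1 : AEMeasurable Q μ :=
      (hDm.aemeasurable.pow_const 2).mul
        ((hNm.aemeasurable.abs.add hDm.aemeasurable.abs).pow_const _)
    exact h1.aestronglyMeasurable
  have i6 : Integrable Q μ := by
    refine (i5.const_mul c⁻¹).mono' hQm (ae_of_all _ fun ω => ?_)
    rw [Real.norm_eq_abs, abs_of_nonneg (hQ0 ω), inv_mul_eq_div, le_div_iff₀ hc0]
    linarith [hpt ω]
  rw [← ofReal_integral_eq_lintegral_ofReal i1 (ae_of_all _ fun ω => by positivity),
    ← ofReal_integral_eq_lintegral_ofReal i6 (ae_of_all _ hQ0),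
    ← ofReal_integral_eq_lintegral_ofReal i3 (ae_of_all _ fun ω => by positivity),
    ← ENNReal.ofReal_mul hc0.le, ← ENNReal.ofReal_add (integral_nonneg fun ω => by positivity)
      (mul_nonneg hc0.le (integral_nonneg hQ0))]
  refine ENNReal.ofReal_le_ofReal ?_
  have h := integral_mono ((i1.add (i4.const_mul r)).add (i6.const_mul c)) i3 hpt
  have i4' : Integrable (fun ω => r * (K ω * D ω)) μ := i4.const_mul r
  have i6' : Integrable (fun ω => c * Q ω) μ := i6.const_mul c
  have i7 : Integrable (fun ω => |N ω| ^ r + r * (K ω * D ω)) μ := i1.add i4'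
  have e : ∫ ω, (|N ω| ^ r + r * (K ω * D ω) + c * Q ω) ∂μ =
      ∫ ω, |N ω| ^ r ∂μ + c * ∫ ω, Q ω ∂μ := by
    rw [integral_add i7 i6', integral_add i1 i4', integral_const_mul, integral_const_mul, e4,
      mul_zero, add_zero]
  rw [← e]
  exact h

/-- Hölder's inequality with weights `r / 2` and `1 - r / 2`, since `|D| ^ r` is the product of `(D
^ 2 * (|N| + |D|) ^ (r - 2)) ^ (r / 2)` and `((|N| + |D|) ^ r) ^ (1 - r / 2)`. It turns the
convexity defect into a bound on the norm of `D`. -/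
lemma eLpNorm_sq_le_mul (hr : 1 < r) (hr2 : r ≤ 2) {N D : Ω → ℝ}
    (hNm : AEStronglyMeasurable N μ) (hDm : AEStronglyMeasurable D μ) :
    eLpNorm D (ENNReal.ofReal r) μ ^ 2 ≤
      (∫⁻ ω, ENNReal.ofReal (D ω ^ 2 * (|N ω| + |D ω|) ^ (r - 2)) ∂μ) *
      (eLpNorm N (ENNReal.ofReal r) μ + eLpNorm D (ENNReal.ofReal r) μ) ^ (2 - r) := by
  have hr0 : 0 < r := by linarith
  set Q : Ω → ℝ := fun ω => D ω ^ 2 * (|N ω| + |D ω|) ^ (r - 2) with hQ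
  have hQ0 : ∀ ω, 0 ≤ Q ω := fun ω => by positivity
  have hQm : AEMeasurable Q μ :=
      (hDm.aemeasurable.pow_const 2).mul
        ((hNm.aemeasurable.abs.add hDm.aemeasurable.abs).pow_const _)
  have hBm : AEMeasurable (fun ω => (|N ω| + |D ω|) ^ r) μ :=
    (hNm.aemeasurable.abs.add hDm.aemeasurable.abs).pow_const _
  have hpt : ∀ ω, ENNReal.ofReal (|D ω| ^ r) = ENNReal.ofReal (Q ω) ^ (r / 2) *
      ENNReal.ofReal ((|N ω| + |D ω|) ^ r) ^ (1 - r / 2) := by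
    intro ω
    rw [ENNReal.ofReal_rpow_of_nonneg (hQ0 ω) (by positivity),
      ENNReal.ofReal_rpow_of_nonneg (by positivity) (by linarith),
      ← ENNReal.ofReal_mul (by have := hQ0 ω; positivity)]
    congr 1
    rcases eq_or_ne (D ω) 0 with h | h
    · have : r / 2 ≠ 0 := by positivity
      simp [hQ, h, Real.zero_rpow hr0.ne', Real.zero_rpow this]
    · have hD := abs_pos.2 h
      have hs : 0 < |N ω| + |D ω| := by have := abs_nonneg (N ω); linarith
      simp only [hQ]
      rw [← sq_abs, Real.mul_rpow (by positivity) (by positivity), ← Real.rpow_natCast,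
        ← Real.rpow_mul hD.le, ← Real.rpow_mul hs.le, ← Real.rpow_mul hs.le, mul_assoc,
        ← Real.rpow_add hs]
      have e1 : (r - 2) * (r / 2) + r * (1 - r / 2) = 0 := by ring
      rw [e1, Real.rpow_zero, mul_one]
      congr 1; push_cast; ring
  have h1 := ENNReal.lintegral_mul_norm_pow_le (μ := μ) hQm.ennreal_ofReal hBm.ennreal_ofReal
    (p := r / 2) (q := 1 - r / 2) (by positivity) (by linarith) (by ring)
  rw [← lintegral_congr hpt, ← eLpNorm_rpow_eq hr D] at h1
  have hB : ∫⁻ ω, ENNReal.ofReal ((|N ω| + |D ω|) ^ r) ∂μ ≤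
      (eLpNorm N (ENNReal.ofReal r) μ + eLpNorm D (ENNReal.ofReal r) μ) ^ r := by
    have e : ∀ ω, (|N ω| + |D ω|) ^ r = |(|N ω| + |D ω|)| ^ r := fun ω => by
      rw [abs_of_nonneg (add_nonneg (abs_nonneg (N ω)) (abs_nonneg (D ω)))]
    rw [lintegral_congr fun ω => by rw [e ω], ← eLpNorm_rpow_eq hr]
    refine ENNReal.rpow_le_rpow ?_ hr0.le
    refine (eLpNorm_add_le (f := fun ω => |N ω|) (g := fun ω => |D ω|) hNm.norm hDm.norm
      (one_le_ofReal hr)).trans (le_of_eq ?_)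
    congr 1
    · exact eLpNorm_norm N
    · exact eLpNorm_norm D
  have h2 := ENNReal.rpow_le_rpow h1 (show 0 ≤ 2 / r by positivity)
  rw [ENNReal.mul_rpow_of_nonneg _ _ (by positivity), ← ENNReal.rpow_mul, ← ENNReal.rpow_mul,
    ← ENNReal.rpow_mul] at h2
  have e1 : r * (2 / r) = (2 : ℕ) := by field_simp; norm_num
  have e2 : r / 2 * (2 / r) = 1 := by field_simp
  rw [e1, e2, ENNReal.rpow_natCast, ENNReal.rpow_one] at h2
  refine h2.trans (mul_le_mul_right ?_ _)
  have h3 := ENNReal.rpow_le_rpow hB (show 0 ≤ (1 - r / 2) * (2 / r) by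
    have : 0 ≤ 1 - r / 2 := by linarith
    positivity)
  refine h3.trans (le_of_eq ?_)
  rw [← ENNReal.rpow_mul]
  congr 1; field_simp

end Cotype

/-! ### From cotype 2 to the summability of projections. -/

section Cotype

variable {Ω : Type*} {m : MeasurableSpace Ω} [mΩ : MeasurableSpace Ω] {μ : Measure Ω} {r : ℝ}

/-- With one majorant `K` along the whole martingale, the `r`-th powers of the norms, all weighted
by `K ^ (2 - r)`, telescope. -/
lemma mul_sq_eLpNorm_add_le [IsProbabilityMeasure μ] (hr : 1 < r) (hr2 : r ≤ 2) (hm : m ≤ mΩ)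
    {N D : Ω → ℝ} (hN : StronglyMeasurable[m] N) (hNr : MemLp N (ENNReal.ofReal r) μ)
    (hDr : MemLp D (ENNReal.ofReal r) μ) (h0 : μ[D | m] =ᵐ[μ] 0) {K : ℝ≥0∞}
    (hK : eLpNorm N (ENNReal.ofReal r) μ + eLpNorm D (ENNReal.ofReal r) μ ≤ K) :
    ENNReal.ofReal (r * (r - 1) / 2) * eLpNorm D (ENNReal.ofReal r) μ ^ 2 +
        eLpNorm N (ENNReal.ofReal r) μ ^ r * K ^ (2 - r) ≤
      eLpNorm (N + D) (ENNReal.ofReal r) μ ^ r * K ^ (2 - r) := by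
  have h1 := lintegral_add_le_of_condExp_eq_zero hr hr2 hm hN hNr hDr h0
  have h2 := eLpNorm_sq_le_mul hr hr2 hNr.1 hDr.1
  set Q := ∫⁻ ω, ENNReal.ofReal (D ω ^ 2 * (|N ω| + |D ω|) ^ (r - 2)) ∂μ
  rw [← eLpNorm_rpow_eq hr, ← eLpNorm_rpow_eq hr (fun ω => N ω + D ω)] at h1
  have h3 : eLpNorm D (ENNReal.ofReal r) μ ^ 2 ≤ Q * K ^ (2 - r) :=
    h2.trans (mul_le_mul_right (ENNReal.rpow_le_rpow hK (by linarith)) _)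
  calc _ ≤ ENNReal.ofReal (r * (r - 1) / 2) * (Q * K ^ (2 - r)) +
        eLpNorm N (ENNReal.ofReal r) μ ^ r * K ^ (2 - r) := by gcongr
    _ = (eLpNorm N (ENNReal.ofReal r) μ ^ r + ENNReal.ofReal (r * (r - 1) / 2) * Q) *
        K ^ (2 - r) := by ring
    _ ≤ _ := mul_le_mul_left h1 _

variable {F : ℕ → MeasurableSpace Ω} {X : Ω → ℝ}

lemma eLpNorm_condExp_antitone [IsProbabilityMeasure μ] (hr : 1 < r) (hF : Antitone F)
    (hle : ∀ j, F j ≤ mΩ) {i j : ℕ} (hij : i ≤ j) :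
    eLpNorm (μ[X | F j]) (ENNReal.ofReal r) μ ≤ eLpNorm (μ[X | F i]) (ENNReal.ofReal r) μ := by
  rw [← eLpNorm_congr_ae (condExp_condExp_of_le (hF hij) (hle i))]
  exact eLpNorm_condExp_le_eLpNorm _ (one_le_ofReal hr)

/-- The conditional expectations have norm at most `K`, hence the increments at most `2 * K`, and `3
* K` is a common majorant in each step. The factor 9 is `3 ^ r * 3 ^ (2 - r)`. -/
lemma sum_sq_eLpNorm_sub_le [IsProbabilityMeasure μ] (hr : 1 < r) (hr2 : r ≤ 2) (hF : Antitone F)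
    (hle : ∀ j, F j ≤ mΩ) (hX : MemLp X (ENNReal.ofReal r) μ) (J n : ℕ) :
    ENNReal.ofReal (r * (r - 1) / 2) * ∑ j ∈ Finset.range n,
        eLpNorm (μ[X | F (J + j)] - μ[X | F (J + j + 1)]) (ENNReal.ofReal r) μ ^ 2 ≤
      9 * eLpNorm (μ[X | F J]) (ENNReal.ofReal r) μ ^ 2 := by
  have hr1 := one_le_ofReal hr
  set K := eLpNorm (μ[X | F J]) (ENNReal.ofReal r) μ with hK
  have hmem : ∀ j, MemLp (μ[X | F j]) (ENNReal.ofReal r) μ := fun j => hX.condExp hr1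
  have hstep : ∀ j, ENNReal.ofReal (r * (r - 1) / 2) *
      eLpNorm (μ[X | F (J + j)] - μ[X | F (J + j + 1)]) (ENNReal.ofReal r) μ ^ 2 +
        eLpNorm (μ[X | F (J + j + 1)]) (ENNReal.ofReal r) μ ^ r * (3 * K) ^ (2 - r) ≤
      eLpNorm (μ[X | F (J + j)]) (ENNReal.ofReal r) μ ^ r * (3 * K) ^ (2 - r) := by
    intro j
    have e1 := eLpNorm_condExp_antitone (μ := μ) (X := X) hr hF hle (Nat.le_add_right J j)
    have e2 := eLpNorm_condExp_antitone (μ := μ) (X := X) hr hF hle (Nat.le_add_right J (j + 1))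
    have h0 : μ[μ[X | F (J + j)] - μ[X | F (J + j + 1)] | F (J + j + 1)] =ᵐ[μ] 0 := by
      have h1 := condExp_sub (μ := μ) (integrable_condExp (m := F (J + j)) (f := X))
        (integrable_condExp (m := F (J + j + 1)) (f := X)) (F (J + j + 1))
      have h2 := condExp_condExp_of_le (μ := μ) (f := X) (hF (Nat.le_succ (J + j))) (hle (J + j))
      rw [condExp_of_stronglyMeasurable (hle (J + j + 1)) stronglyMeasurable_condExp
        integrable_condExp] at h1
      filter_upwards [h1, h2] with ω h1 h2
      rw [h1, Pi.sub_apply, h2, sub_self, Pi.zero_apply]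
    have h := mul_sq_eLpNorm_add_le hr hr2 (hle (J + j + 1)) stronglyMeasurable_condExp
      (hmem (J + j + 1)) ((hmem (J + j)).sub (hmem (J + j + 1))) h0 (K := 3 * K) ?_
    · rwa [add_sub_cancel] at h
    · calc _ ≤ K + (K + K) := by
            refine add_le_add e2 ((eLpNorm_sub_le (hmem _).1 (hmem _).1 hr1).trans ?_)
            exact add_le_add e1 e2
        _ = 3 * K := by ring
  have hsum : ∀ n, ENNReal.ofReal (r * (r - 1) / 2) * ∑ j ∈ Finset.range n,
        eLpNorm (μ[X | F (J + j)] - μ[X | F (J + j + 1)]) (ENNReal.ofReal r) μ ^ 2 +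
      eLpNorm (μ[X | F (J + n)]) (ENNReal.ofReal r) μ ^ r * (3 * K) ^ (2 - r) ≤
      K ^ r * (3 * K) ^ (2 - r) := by
    intro n
    induction n with
    | zero => simp [hK]
    | succ n ih =>
      rw [Finset.sum_range_succ, mul_add, add_assoc]
      exact (add_le_add le_rfl (hstep n)).trans ih
  calc _ ≤ K ^ r * (3 * K) ^ (2 - r) := le_self_add.trans (hsum n)
    _ ≤ (3 * K) ^ r * (3 * K) ^ (2 - r) := by
        refine mul_le_mul_left (ENNReal.rpow_le_rpow ?_ (by linarith)) _
        exact le_mul_of_one_le_left (zero_le) (by norm_num)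
    _ = 9 * K ^ 2 := by
        rw [← ENNReal.rpow_add_of_nonneg _ _ (by linarith) (by linarith), add_sub_cancel,
          ENNReal.rpow_two, mul_pow]
        norm_num

/-- The Cauchy–Schwarz inequality applied to the cotype estimate; this is the origin of the weight
`1 / √k` in the hypothesis of the theorem. -/
lemma exists_sum_eLpNorm_sub_le (hr : 1 < r) (hr2 : r ≤ 2) : ∃ C : ℝ≥0∞, C ≠ ∞ ∧
    ∀ {Ω : Type*} [mΩ : MeasurableSpace Ω] {μ : Measure Ω} [IsProbabilityMeasure μ]
      {F : ℕ → MeasurableSpace Ω} {X : Ω → ℝ}, Antitone F → (∀ j, F j ≤ mΩ) →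
      MemLp X (ENNReal.ofReal r) μ → ∀ J n : ℕ, ∑ j ∈ Finset.range n,
        eLpNorm (μ[X | F (J + j)] - μ[X | F (J + j + 1)]) (ENNReal.ofReal r) μ ≤
      C * ((n : ℝ≥0∞) ^ (1 / 2 : ℝ) * eLpNorm (μ[X | F J]) (ENNReal.ofReal r) μ) := by
  set c := ENNReal.ofReal (r * (r - 1) / 2) with hc
  have hc0 : c ≠ 0 := by
    have : 0 < r - 1 := by linarith
    rw [hc, Ne, ENNReal.ofReal_eq_zero, not_le]; positivity
  have hct : c ≠ ∞ := ENNReal.ofReal_ne_top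
  refine ⟨(9 / c) ^ (1 / 2 : ℝ), ENNReal.rpow_ne_top_of_nonneg (by norm_num)
    (ENNReal.div_ne_top (by norm_num) hc0), ?_⟩
  intro Ω mΩ μ _ F X hF hle hX J n
  have h1 := sum_sq_eLpNorm_sub_le hr hr2 hF hle hX J n
  have h2 := ENNReal.rpow_sum_le_const_mul_sum_rpow (Finset.range n)
    (fun j => eLpNorm (μ[X | F (J + j)] - μ[X | F (J + j + 1)]) (ENNReal.ofReal r) μ)
    (p := 2) (by norm_num)
  simp only [ENNReal.rpow_two, Finset.card_range] at h2
  set B := ∑ j ∈ Finset.range n,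
        eLpNorm (μ[X | F (J + j)] - μ[X | F (J + j + 1)]) (ENNReal.ofReal r) μ
  set S := ∑ j ∈ Finset.range n,
        eLpNorm (μ[X | F (J + j)] - μ[X | F (J + j + 1)]) (ENNReal.ofReal r) μ ^ 2
  set K := eLpNorm (μ[X | F J]) (ENNReal.ofReal r) μ
  have e1 : (2 : ℝ) - 1 = 1 := by norm_num
  rw [e1, ENNReal.rpow_one] at h2
  have h3 : S ≤ 9 / c * K ^ 2 := by
    rw [mul_comm] at h1
    rw [← ENNReal.mul_div_right_comm, ENNReal.le_div_iff_mul_le (Or.inl hc0) (Or.inl hct)]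
    exact h1
  have h4 : B ^ 2 ≤ 9 / c * (n * K ^ 2) := h2.trans ((mul_le_mul_right h3 _).trans (by
    rw [mul_left_comm]))
  have h5 := ENNReal.rpow_le_rpow h4 (show (0 : ℝ) ≤ 1 / 2 by norm_num)
  rw [ENNReal.mul_rpow_of_nonneg _ _ (by norm_num), ENNReal.mul_rpow_of_nonneg _ _ (by norm_num),
    ← ENNReal.rpow_two, ← ENNReal.rpow_two, ← ENNReal.rpow_mul, ← ENNReal.rpow_mul] at h5
  simpa using h5

lemma sum_range_two_pow (b : ℕ → ℝ≥0∞) (n : ℕ) : ∑ j ∈ Finset.range (2 ^ n), b j =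
    b 0 + ∑ k ∈ Finset.range n, ∑ i ∈ Finset.range (2 ^ k), b (2 ^ k + i) := by
  induction n with
  | zero => simp
  | succ n ih => rw [pow_succ, mul_two, Finset.sum_range_add, ih, Finset.sum_range_succ, add_assoc]

lemma tsum_eq_add_tsum_two_pow (b : ℕ → ℝ≥0∞) :
    ∑' j, b j = b 0 + ∑' k : ℕ, ∑ i ∈ Finset.range (2 ^ k), b (2 ^ k + i) := by
  rw [ENNReal.tsum_eq_iSup_nat' (f := b) (tendsto_pow_atTop_atTop_of_one_lt (one_lt_two (α := ℕ))),
    ENNReal.tsum_eq_iSup_nat, ENNReal.add_iSup]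
  exact iSup_congr fun n => sum_range_two_pow b n

/-- Cauchy condensation for `a j / √j`, as `2 ^ k / √(2 ^ k) = √(2 ^ k)`. Condensation gives the
first term plus twice the series, hence 3. -/
lemma tsum_two_pow_rpow_mul_le {a : ℕ → ℝ≥0∞} (ha : Antitone a) :
    ∑' k : ℕ, ((2 ^ k : ℕ) : ℝ≥0∞) ^ (1 / 2 : ℝ) * a (2 ^ k) ≤
      3 * ∑' k : ℕ, a (k + 1) / ((k + 1 : ℕ) : ℝ≥0∞) ^ (1 / 2 : ℝ) := by
  -- The value 0 at `j = 0` avoids a division by zero and does not affect condensation.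
  set f : ℕ → ℝ≥0∞ := fun j => if j = 0 then 0 else a j / (j : ℝ≥0∞) ^ (1 / 2 : ℝ) with hf
  have hfa : ∀ ⦃m n : ℕ⦄, 1 < m → m ≤ n → f n ≤ f m := by
    intro m n hm hmn
    simp only [hf]
    rw [if_neg (by omega), if_neg (by omega)]
    exact ENNReal.div_le_div (ha hmn) (ENNReal.rpow_le_rpow (by exact_mod_cast hmn) (by norm_num))
  have h := ENNReal.tsum_condensed_le hfa
  have e1 : ∑' k, f k = ∑' k : ℕ, a (k + 1) / ((k + 1 : ℕ) : ℝ≥0∞) ^ (1 / 2 : ℝ) := by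
    rw [tsum_eq_zero_add' ENNReal.summable]
    simp [hf]
  have e2 : f 1 ≤ ∑' k, f k := ENNReal.le_tsum 1
  have e3 : ∀ k : ℕ, 2 ^ k * f (2 ^ k) = ((2 ^ k : ℕ) : ℝ≥0∞) ^ (1 / 2 : ℝ) * a (2 ^ k) := by
    intro k
    simp only [hf]
    rw [if_neg (by positivity)]
    push_cast
    have h0 : (2 : ℝ≥0∞) ^ k ≠ 0 := by simp
    have ht : (2 : ℝ≥0∞) ^ k ≠ ∞ := by finiteness
    have : (2 : ℝ≥0∞) ^ k = (2 ^ k) ^ (1 / 2 : ℝ) * (2 ^ k) ^ (1 / 2 : ℝ) := by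
      rw [← ENNReal.rpow_add _ _ h0 ht]; norm_num
    have h0' : ((2 : ℝ≥0∞) ^ k) ^ (1 / 2 : ℝ) ≠ 0 := by simp
    have ht' : ((2 : ℝ≥0∞) ^ k) ^ (1 / 2 : ℝ) ≠ ∞ := by finiteness
    nth_rewrite 1 [this]
    rw [mul_assoc, ENNReal.mul_div_cancel h0' ht']
  rw [tsum_congr e3] at h
  rw [← e1]
  refine h.trans ((add_le_add e2 le_rfl).trans (le_of_eq ?_))
  ring

/-- A Hannan-type criterion: the martingale differences of a reverse martingale are summable
in `L^r` as soon as `∑ ‖𝔼(X | F k)‖_r / √k` is finite. -/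
lemma tsum_eLpNorm_condExp_sub_ne_top [IsProbabilityMeasure μ] (hr : 1 < r) (hr2 : r ≤ 2)
    (hF : Antitone F) (hle : ∀ j, F j ≤ mΩ) (hX : MemLp X (ENNReal.ofReal r) μ)
    (hs : ∑' k : ℕ, eLpNorm (μ[X | F (k + 1)]) (ENNReal.ofReal r) μ /
      ((k + 1 : ℕ) : ℝ≥0∞) ^ (1 / 2 : ℝ) ≠ ∞) :
    ∑' j : ℕ, eLpNorm (μ[X | F j] - μ[X | F (j + 1)]) (ENNReal.ofReal r) μ ≠ ∞ ∧
      ∀ᵐ ω ∂μ, HasSum (fun j : ℕ => (μ[X | F j] - μ[X | F (j + 1)]) ω) (μ[X | F 0] ω) := by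
  have hr1 := one_le_ofReal hr
  have hmem : ∀ j, MemLp (μ[X | F j]) (ENNReal.ofReal r) μ := fun j => hX.condExp hr1
  have hanti : Antitone fun j => eLpNorm (μ[X | F j]) (ENNReal.ofReal r) μ :=
    fun i j hij => eLpNorm_condExp_antitone hr hF hle hij
  have hdy := ne_top_of_le_ne_top (ENNReal.mul_ne_top (by norm_num) hs)
    (tsum_two_pow_rpow_mul_le hanti)
  have hfin : ∑' j : ℕ, eLpNorm (μ[X | F j] - μ[X | F (j + 1)]) (ENNReal.ofReal r) μ ≠ ∞ := by
    obtain ⟨C, hC, h⟩ := exists_sum_eLpNorm_sub_le hr hr2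
    rw [tsum_eq_add_tsum_two_pow]
    refine ENNReal.add_ne_top.2 ⟨((hmem 0).sub (hmem 1)).2.ne, ?_⟩
    refine ne_top_of_le_ne_top (ENNReal.mul_ne_top hC hdy) ?_
    rw [← ENNReal.tsum_mul_left]
    exact ENNReal.tsum_le_tsum fun k => h hF hle hX (2 ^ k) (2 ^ k)
  refine ⟨hfin, ?_⟩
  -- These norms are summable too, so the conditional expectations tend to 0 almost surely along `2
  -- ^ k`. This identifies the sum of the telescoping series without any reverse martingale theorem.
  have h2 : ∑' k : ℕ, eLpNorm (μ[X | F (2 ^ k)]) (ENNReal.ofReal r) μ ≠ ∞ := by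
    refine ne_top_of_le_ne_top hdy (ENNReal.tsum_le_tsum fun k => ?_)
    refine le_mul_of_one_le_left zero_le (ENNReal.one_le_rpow ?_ (by norm_num))
    exact_mod_cast Nat.one_le_two_pow
  filter_upwards [ae_summable_of_tsum_eLpNorm hr1 (fun j => ((hmem j).sub (hmem (j + 1))).1) hfin,
    ae_summable_of_tsum_eLpNorm hr1 (fun k => (hmem (2 ^ k)).1) h2] with ω h1 h2
  have hsum := h1.of_abs
  have ht := hsum.hasSum.tendsto_sum_nat.comp
    (tendsto_pow_atTop_atTop_of_one_lt (one_lt_two (α := ℕ)))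
  have e : ∀ n, ∑ j ∈ Finset.range n, (μ[X | F j] - μ[X | F (j + 1)]) ω =
      μ[X | F 0] ω - μ[X | F n] ω := fun n => by
    simp only [Pi.sub_apply]
    exact Finset.sum_range_sub' (fun j => μ[X | F j] ω) n
  have ht2 : Tendsto (fun k : ℕ => μ[X | F 0] ω - μ[X | F (2 ^ k)] ω) atTop
      (𝓝 (μ[X | F 0] ω - 0)) :=
    tendsto_const_nhds.sub h2.of_abs.tendsto_atTop_zero
  have := tendsto_nhds_unique (ht.congr fun k => e (2 ^ k)) ht2
  rw [← sub_zero (μ[X | F 0] ω), ← this]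
  exact hsum.hasSum

end Cotype

/-! ### Comparison of two measures through their distribution functions. -/

section TwoMeasures

variable {κ ν : Measure ℝ} {c ε : ℝ}

/-- An upper set of reals is empty, everything, an open half-line or a closed one. The open
half-lines are complements of the sets in the hypothesis, and the closed ones are decreasing limits
of open ones. In the application `κ` is the law of `Y` restricted to an event of probability `c`,
and `ν` is the law of `Y`. -/
lemma abs_real_sub_le_of_isUpperSet [IsFiniteMeasure κ] [IsProbabilityMeasure ν]
    (hc : κ.real Set.univ = c) (hε : 0 ≤ ε)
    (h : ∀ x, |κ.real (Set.Iic x) - c * ν.real (Set.Iic x)| ≤ ε) {S : Set ℝ} (hS : IsUpperSet S) :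
    |κ.real S - c * ν.real S| ≤ ε := by
  have hIoi : ∀ x, |κ.real (Set.Ioi x) - c * ν.real (Set.Ioi x)| ≤ ε := by
    intro x
    rw [← Set.compl_Iic, measureReal_compl measurableSet_Iic, measureReal_compl measurableSet_Iic,
      hc, probReal_univ, ← abs_neg]
    convert h x using 2
    ring
  have hIci : ∀ x, |κ.real (Set.Ici x) - c * ν.real (Set.Ici x)| ≤ ε := by
    intro x
    obtain ⟨u, hu, hux, hut⟩ := exists_seq_strictMono_tendsto x
    have he : Set.Ici x = ⋂ n, Set.Ioi (u n) := by
      ext y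
      simp only [Set.mem_Ici, Set.mem_iInter, Set.mem_Ioi]
      exact ⟨fun hy n => (hux n).trans_le hy, fun hy => le_of_tendsto' hut fun n => (hy n).le⟩
    have ht : ∀ ρ : Measure ℝ, IsFiniteMeasure ρ →
        Tendsto (fun n => ρ.real (Set.Ioi (u n))) atTop (𝓝 (ρ.real (Set.Ici x))) := by
      intro ρ _
      rw [he]
      refine (ENNReal.tendsto_toReal (measure_ne_top ρ _)).comp ?_
      exact tendsto_measure_iInter_atTop (fun n => measurableSet_Ioi.nullMeasurableSet)
        (fun i j hij => Set.Ioi_subset_Ioi (hu.monotone hij)) ⟨0, measure_ne_top ρ _⟩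
    exact le_of_tendsto' ((ht κ inferInstance).sub ((ht ν inferInstance).const_mul c)).abs
      fun n => hIoi (u n)
  rcases S.eq_empty_or_nonempty with rfl | hne
  · simpa using hε
  by_cases hb : BddBelow S
  · by_cases hs : sInf S ∈ S
    · have : S = Set.Ici (sInf S) :=
        Set.Subset.antisymm (fun y hy => csInf_le hb hy) fun y hy => hS hy hs
      rw [this]; exact hIci _
    · have : S = Set.Ioi (sInf S) := by
        refine Set.Subset.antisymm (fun y hy => ?_) fun y hy => ?_
        · exact lt_of_le_of_ne (csInf_le hb hy) (fun h => hs (h ▸ hy))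
        · obtain ⟨z, hz, hzy⟩ := exists_lt_of_csInf_lt hne hy
          exact hS hzy.le hz
      rw [this]; exact hIoi _
  · have : S = Set.univ := by
      refine Set.eq_univ_of_forall fun y => ?_
      rw [not_bddBelow_iff] at hb
      obtain ⟨z, hz, hzy⟩ := hb y
      exact hS hzy.le hz
    rw [this, hc, probReal_univ]
    simpa using hε

/-- The layer-cake formula: the superlevel sets of a monotone function are upper sets, and the
levels range over an interval of length `T`. -/
lemma abs_integral_sub_le_of_monotone [IsFiniteMeasure κ] [IsProbabilityMeasure ν]
    (hc : κ.real Set.univ = c) (hε : 0 ≤ ε)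
    (h : ∀ x, |κ.real (Set.Iic x) - c * ν.real (Set.Iic x)| ≤ ε) {u : ℝ → ℝ} (hu : Monotone u)
    {T : ℝ} (hT : 0 ≤ T) (hu0 : ∀ x, 0 ≤ u x) (huT : ∀ x, u x ≤ T) :
    |∫ x, u x ∂κ - c * ∫ x, u x ∂ν| ≤ ε * T := by
  have hint : ∀ ρ : Measure ℝ, IsFiniteMeasure ρ → Integrable u ρ := fun ρ _ =>
    Integrable.of_bound hu.measurable.aestronglyMeasurable T
      (ae_of_all _ fun x => by rw [Real.norm_eq_abs, abs_of_nonneg (hu0 x)]; exact huT x)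
  have hlc : ∀ ρ : Measure ℝ, IsFiniteMeasure ρ →
      ∫ x, u x ∂ρ = ∫ t in Set.Ioc 0 T, ρ.real {x | t ≤ u x} := fun ρ _ =>
    (hint ρ inferInstance).integral_eq_integral_Ioc_meas_le (ae_of_all _ hu0) (ae_of_all _ huT)
  have hi : ∀ ρ : Measure ℝ, IsFiniteMeasure ρ →
      Integrable (fun t => ρ.real {x | t ≤ u x}) (volume.restrict (Set.Ioc 0 T)) := fun ρ _ => by
    have ha : Antitone fun t : ℝ => ρ.real {x | t ≤ u x} :=
      fun s t hst => measureReal_mono fun x (hx : t ≤ u x) => hst.trans hx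
    exact (intervalIntegrable_iff_integrableOn_Ioc_of_le hT).1 (ha.intervalIntegrable)
  rw [hlc κ inferInstance, hlc ν inferInstance, ← integral_const_mul,
    ← integral_sub (hi κ inferInstance) ((hi ν inferInstance).const_mul c)]
  have := norm_setIntegral_le_of_norm_le_const (μ := volume) (s := Set.Ioc 0 T) (C := ε)
    (f := fun t => κ.real {x | t ≤ u x} - c * ν.real {x | t ≤ u x}) (by simp)
    (fun t _ => abs_real_sub_le_of_isUpperSet hc hε h fun x y hxy (hx : t ≤ u x) =>
      hx.trans (hu hxy))
  simpa [hT] using this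

end TwoMeasures

/-! ### The mixing coefficient and bounded monotone functions. -/

section Phi

variable {Ω : Type*} {m : MeasurableSpace Ω} [mΩ : MeasurableSpace Ω] {μ : Measure Ω}
  {Y : Ω → ℝ} {φ : ℝ}

lemma integral_center [IsProbabilityMeasure μ] {Z : Ω → ℝ} (hZ : Integrable Z μ) :
    ∫ ω, center μ Z ω ∂μ = 0 := by
  simp [center, integral_sub hZ (integrable_const _)]

lemma integrable_center [IsProbabilityMeasure μ] {Z : Ω → ℝ} (hZ : Integrable Z μ) :
    Integrable (center μ Z) μ :=
  hZ.sub (integrable_const _)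

lemma center_eq_self {Z : Ω → ℝ} (h : ∫ ω, Z ω ∂μ = 0) : center μ Z = Z := by
  ext ω; simp [center, h]

lemma condExp_center_ae_eq [IsProbabilityMeasure μ] (hm : m ≤ mΩ) {Z : Ω → ℝ}
    (hZ : Integrable Z μ) : μ[center μ Z | m] =ᵐ[μ] fun ω => μ[Z | m] ω - ∫ ω', Z ω' ∂μ := by
  have h := condExp_sub hZ (integrable_const (μ := μ) (∫ ω', Z ω' ∂μ)) m
  rw [condExp_const hm] at h
  exact h

lemma abs_measureReal_inter_sub_le [IsProbabilityMeasure μ] (hm : m ≤ mΩ) (hY : Measurable Y)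
    (hφ0 : 0 ≤ φ) (hφ : phi m μ Y ≤ ENNReal.ofReal φ) {A : Set Ω} (hA : MeasurableSet[m] A)
    (x : ℝ) : |μ.real (A ∩ Y ⁻¹' Set.Iic x) - μ.real A * μ.real (Y ⁻¹' Set.Iic x)| ≤
      φ * μ.real A := by
  set Z : Ω → ℝ := Set.indicator {ω | Y ω ≤ x} (fun _ => (1 : ℝ)) with hZ
  have hs : MeasurableSet (Y ⁻¹' Set.Iic x) := hY measurableSet_Iic
  have hZi : Integrable Z μ := (integrable_const 1).indicator hs
  -- The outer centring in `phi` is void: the conditional expectation of a centred variable has mean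
  -- zero.
  have hW : ∫ ω, μ[center μ Z | m] ω ∂μ = 0 := by
    rw [integral_condExp hm, integral_center hZi]
  have h1 : eLpNorm (μ[center μ Z | m]) ∞ μ ≤ ENNReal.ofReal φ := by
    have := (le_iSup (fun x : ℝ => eLpNorm (center μ (μ[center μ
      (Set.indicator {ω | Y ω ≤ x} (fun _ => (1 : ℝ))) | m])) ∞ μ) x).trans hφ
    rwa [center_eq_self hW] at this
  have h2 : ∀ᵐ ω ∂μ, ‖μ[center μ Z | m] ω‖ ≤ φ := by
    filter_upwards [enorm_ae_le_eLpNormEssSup (μ[center μ Z | m]) μ] with ω hω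
    have := hω.trans (eLpNorm_exponent_top (f := μ[center μ Z | m]) (μ := μ) ▸ h1)
    rwa [← ofReal_norm, ENNReal.ofReal_le_ofReal_iff hφ0] at this
  have h3 := norm_setIntegral_le_of_norm_le_const_ae (μ := μ) (s := A) (measure_lt_top μ A)
    (ae_restrict_of_ae h2)
  rw [setIntegral_condExp hm (integrable_center hZi) hA] at h3
  have h4 : ∫ ω in A, center μ Z ω ∂μ =
      μ.real (A ∩ Y ⁻¹' Set.Iic x) - μ.real A * μ.real (Y ⁻¹' Set.Iic x) := by
    have e1 : ∫ ω, Z ω ∂μ = μ.real (Y ⁻¹' Set.Iic x) := integral_indicator_one hs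
    have e2 : ∫ ω in A, Z ω ∂μ = μ.real (A ∩ Y ⁻¹' Set.Iic x) := by
      have := setIntegral_indicator (μ := μ) (s := A) (f := fun _ => (1 : ℝ)) hs
      rw [setIntegral_const, smul_eq_mul, mul_one] at this
      exact this
    simp only [center]
    rw [integral_sub hZi.integrableOn (integrable_const _), e2, e1, setIntegral_const, smul_eq_mul]
  rwa [h4] at h3

/-- For the trimmed measure all measurable sets are in `m`, so `g` and `-g` are determined up to
null sets by these integrals. -/
lemma ae_abs_le_of_forall_setIntegral [IsProbabilityMeasure μ] (hm : m ≤ mΩ) {g : Ω → ℝ}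
    (hg : StronglyMeasurable[m] g) (hgi : Integrable g μ) {c : ℝ}
    (h : ∀ A, MeasurableSet[m] A → |∫ ω in A, g ω ∂μ| ≤ c * μ.real A) :
    ∀ᵐ ω ∂μ, |g ω| ≤ c := by
  have key : ∀ g : Ω → ℝ, StronglyMeasurable[m] g → Integrable g μ →
      (∀ A, MeasurableSet[m] A → ∫ ω in A, g ω ∂μ ≤ c * μ.real A) → ∀ᵐ ω ∂μ, g ω ≤ c := by
    intro g hg hgi h
    have := ae_le_of_forall_setIntegral_le (μ := μ.trim hm) (hgi.trim hm hg)
      (integrable_const c) (fun s hs _ => by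
        rw [← setIntegral_trim hm hg hs, setIntegral_const, smul_eq_mul, mul_comm]
        refine (h s hs).trans (le_of_eq ?_)
        rw [measureReal_def, measureReal_def, trim_measurableSet_eq hm hs])
    exact ae_le_of_ae_le_trim this
  filter_upwards [key g hg hgi fun A hA => (abs_le.1 (h A hA)).2,
    key (-g) hg.neg hgi.neg fun A hA => by
      simp only [Pi.neg_apply, integral_neg]; linarith [(abs_le.1 (h A hA)).1]] with ω h1 h2
  exact abs_le.2 ⟨by simp only [Pi.neg_apply] at h2; linarith, h1⟩

/-- Bounded monotone functions of `Y` have conditional expectation close to their mean. -/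
lemma ae_abs_condExp_center_le_of_monotone [IsProbabilityMeasure μ] (hm : m ≤ mΩ)
    (hY : Measurable Y) (hφ0 : 0 ≤ φ) (hφ : phi m μ Y ≤ ENNReal.ofReal φ) {u : ℝ → ℝ}
    (hu : Monotone u) {T : ℝ} (hT : 0 ≤ T) (hu0 : ∀ x, 0 ≤ u x) (huT : ∀ x, u x ≤ T) :
    ∀ᵐ ω ∂μ, |μ[center μ (u ∘ Y) | m] ω| ≤ φ * T := by
  have hi : Integrable (u ∘ Y) μ :=
    Integrable.of_bound (hu.measurable.comp hY).aestronglyMeasurable T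
      (ae_of_all _ fun x => by
        rw [Real.norm_eq_abs, Function.comp, abs_of_nonneg (hu0 _)]; exact huT _)
  refine ae_abs_le_of_forall_setIntegral hm stronglyMeasurable_condExp integrable_condExp
    fun A hA => ?_
  rw [setIntegral_condExp hm (integrable_center hi) hA]
  have : IsProbabilityMeasure (μ.map Y) := Measure.isProbabilityMeasure_map hY.aemeasurable
  have hc : ((μ.restrict A).map Y).real Set.univ = μ.real A := by
    rw [map_measureReal_apply hY MeasurableSet.univ]; simp
  -- The comparison is made between the law of `Y` on the event `A` and `μ A` times the law of `Y`.
  -- Their distribution functions differ by at most `φ * μ A`, by the definition of `phi`.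
  have h := abs_integral_sub_le_of_monotone (κ := (μ.restrict A).map Y) (ν := μ.map Y) hc
    (ε := φ * μ.real A) (by positivity) (fun x => by
      rw [map_measureReal_apply hY measurableSet_Iic, map_measureReal_apply hY measurableSet_Iic,
        measureReal_restrict_apply (hY measurableSet_Iic), Set.inter_comm]
      exact abs_measureReal_inter_sub_le hm hY hφ0 hφ hA x) hu hT hu0 huT
  rw [integral_map hY.aemeasurable hu.measurable.aestronglyMeasurable,
    integral_map hY.aemeasurable hu.measurable.aestronglyMeasurable] at h
  have e : ∫ ω in A, center μ (u ∘ Y) ω ∂μ =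
      ∫ ω in A, u (Y ω) ∂μ - μ.real A * ∫ ω, u (Y ω) ∂μ := by
    simp only [center]
    rw [integral_sub hi.integrableOn (integrable_const _), setIntegral_const, smul_eq_mul]
    rfl
  rw [e]
  exact h.trans (le_of_eq (by ring))

end Phi

/-! ### Functions monotone on an interval: decomposition and clipping. -/

section MonotoneOn

variable {f : ℝ → ℝ} {I : Set ℝ}

/-- A bounded function that is monotone on an interval and null elsewhere is a combination of
monotone functions. -/
lemma exists_monotone_of_monotoneOn (hI : I.OrdConnected) (hf : MonotoneOn f I)
    (h0 : ∀ x ∉ I, f x = 0) {T : ℝ} (hT : ∀ x, |f x| ≤ T) :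
    ∃ h u v : ℝ → ℝ, Monotone h ∧ Monotone u ∧ Monotone v ∧ (∀ x, 0 ≤ h x ∧ h x ≤ 2 * T) ∧
      (∀ x, 0 ≤ u x ∧ u x ≤ T) ∧ (∀ x, 0 ≤ v x ∧ v x ≤ T) ∧ f = h - u - v := by
  have hT0 : 0 ≤ T := (abs_nonneg _).trans (hT 0)
  -- `S` consists of `I` and all points after it, `R` of the points strictly beyond `I`; both are
  -- upper sets. Adding `T` on `S` and again on `R` gives the values `0` before `I`, `f + T` on it
  -- and `2 * T` beyond it, which is monotone because `|f| ≤ T`.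
  set S : Set ℝ := {x | ∃ y ∈ I, y ≤ x} with hS
  set R : Set ℝ := {x | x ∉ I ∧ ∃ y ∈ I, y ≤ x} with hR
  have hSu : IsUpperSet S := fun x z hxz ⟨y, hy, hyx⟩ => ⟨y, hy, hyx.trans hxz⟩
  have hRu : IsUpperSet R := fun x z hxz ⟨hx, y, hy, hyx⟩ =>
    ⟨fun hz => hx (hI.out hy hz ⟨hyx, hxz⟩), y, hy, hyx.trans hxz⟩
  have hmono : ∀ A : Set ℝ, IsUpperSet A → Monotone (A.indicator fun _ => T) := by
    intro A hA x z hxz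
    by_cases hx : x ∈ A
    · rw [Set.indicator_of_mem hx, Set.indicator_of_mem (hA hxz hx)]
    · rw [Set.indicator_of_notMem hx]
      exact Set.indicator_nonneg (fun _ _ => hT0) _
  have hb : ∀ A : Set ℝ, ∀ x, 0 ≤ A.indicator (fun _ => T) x ∧ A.indicator (fun _ => T) x ≤ T :=
    fun A x => ⟨Set.indicator_nonneg (fun _ _ => hT0) _,
      Set.indicator_le_self' (fun _ _ => hT0) _⟩
  have hIS : ∀ x, x ∈ I → x ∈ S := fun x hx => ⟨x, hx, le_rfl⟩
  have hval1 : ∀ x, x ∉ S → f x + S.indicator (fun _ => T) x + R.indicator (fun _ => T) x = 0 := by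
    intro x hx
    have hxR : x ∉ R := fun h => hx h.2
    rw [h0 x fun h => hx (hIS x h), Set.indicator_of_notMem hx, Set.indicator_of_notMem hxR]
    simp
  have hval2 : ∀ x, x ∈ R →
      f x + S.indicator (fun _ => T) x + R.indicator (fun _ => T) x = 2 * T := by
    intro x hx
    rw [h0 x hx.1, Set.indicator_of_mem (show x ∈ S from hx.2), Set.indicator_of_mem hx]
    ring
  have hval3 : ∀ x, x ∈ I →
      f x + S.indicator (fun _ => T) x + R.indicator (fun _ => T) x = f x + T := by
    intro x hx
    have hxR : x ∉ R := fun h => h.1 hx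
    rw [Set.indicator_of_mem (hIS x hx), Set.indicator_of_notMem hxR, add_zero]
  have hcase : ∀ x, x ∉ S ∨ x ∈ R ∨ x ∈ I := by
    intro x
    by_cases hx : x ∈ S
    · by_cases hxI : x ∈ I
      · exact Or.inr (Or.inr hxI)
      · exact Or.inr (Or.inl ⟨hxI, hx⟩)
    · exact Or.inl hx
  have hbound : ∀ x, 0 ≤ f x + S.indicator (fun _ => T) x + R.indicator (fun _ => T) x ∧
      f x + S.indicator (fun _ => T) x + R.indicator (fun _ => T) x ≤ 2 * T := by
    intro x
    rcases hcase x with h | h | h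
    · rw [hval1 x h]; constructor <;> linarith
    · rw [hval2 x h]; constructor <;> linarith
    · rw [hval3 x h]; have := abs_le.1 (hT x); constructor <;> linarith
  refine ⟨fun x => f x + S.indicator (fun _ => T) x + R.indicator (fun _ => T) x,
    S.indicator fun _ => T, R.indicator fun _ => T, ?_, hmono S hSu, hmono R hRu, hbound,
    hb S, hb R, ?_⟩
  · intro x z hxz
    rcases hcase x with hx | hx | hx
    · exact (hval1 x hx).le.trans (hbound z).1
    · exact (hval2 x hx).le.trans (hval2 z (hRu hxz hx)).ge
    · rcases hcase z with hz | hz | hz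
      · exact absurd (hSu hxz (hIS x hx)) hz
      · exact (hbound x).2.trans (hval2 z hz).ge
      · refine (hval3 x hx).le.trans ((add_le_add (hf hx hz hxz) le_rfl).trans (hval3 z hz).ge)
  · ext x
    simp only [Pi.sub_apply]
    ring

lemma abs_clip_le {T : ℝ} (hT : 0 ≤ T) (x : ℝ) : |max (-T) (min x T)| ≤ T :=
  abs_le.2 ⟨le_max_left _ _, max_le (by linarith) (min_le_right _ _)⟩

lemma clip_zero {T : ℝ} (hT : 0 ≤ T) : max (-T) (min 0 T) = 0 := by
  rw [min_eq_left hT, max_eq_right (by linarith)]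

lemma clip_eq_self {T x : ℝ} (hx : |x| ≤ T) : max (-T) (min x T) = x := by
  rw [min_eq_left (abs_le.1 hx).2, max_eq_right (abs_le.1 hx).1]

lemma monotone_clip (T : ℝ) : Monotone fun x : ℝ => max (-T) (min x T) :=
  fun _ _ h => max_le_max le_rfl (min_le_min_right _ h)

/-- The decomposition into monotone functions needs a bound, so it is applied to the clipped
functions, which converge pointwise to `f`. -/
lemma measurable_of_monotoneOn (hI : I.OrdConnected) (hf : MonotoneOn f I)
    (h0 : ∀ x ∉ I, f x = 0) : Measurable f := by
  have hn : ∀ n : ℕ, Measurable fun x => max (-(n : ℝ)) (min (f x) n) := by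
    intro n
    obtain ⟨h, u, v, hh, hu, hv, -, -, -, he⟩ := exists_monotone_of_monotoneOn
      (f := fun x => max (-(n : ℝ)) (min (f x) n)) hI
      (fun x hx y hy hxy => monotone_clip n (hf hx hy hxy))
      (fun x hx => by rw [h0 x hx]; exact clip_zero n.cast_nonneg)
      (fun x => abs_clip_le n.cast_nonneg (f x))
    rw [he]
    exact (hh.measurable.sub hu.measurable).sub hv.measurable
  refine measurable_of_tendsto_metrizable hn (tendsto_pi_nhds.2 fun x => ?_)
  refine tendsto_const_nhds.congr' ?_
  obtain ⟨N, hN⟩ := exists_nat_ge |f x|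
  filter_upwards [eventually_ge_atTop N] with n hnN
  exact (clip_eq_self (hN.trans (by exact_mod_cast hnN))).symm

lemma abs_sub_clip_le {p : ℝ} (hp : 1 < p) {T : ℝ} (hT : 0 < T) (x : ℝ) :
    |x - max (-T) (min x T)| ≤ T ^ (1 - p) * |x| ^ p := by
  rcases le_or_gt |x| T with h | h
  · rw [clip_eq_self h, sub_self, abs_zero]; positivity
  · have hx : 0 < |x| := hT.trans h
    have h1 : |x - max (-T) (min x T)| ≤ |x| := by
      rcases le_total 0 x with h' | h'
      · rw [abs_of_nonneg h'] at h ⊢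
        rw [min_eq_right h.le, max_eq_right (by linarith), abs_of_nonneg (by linarith)]
        linarith
      · rw [abs_of_nonpos h'] at h ⊢
        rw [min_eq_left (by linarith), max_eq_left (by linarith), abs_of_nonpos (by linarith)]
        linarith
    refine h1.trans ?_
    have h2 : |x| ^ (1 - p) ≤ T ^ (1 - p) :=
      Real.rpow_le_rpow_of_nonpos hT h.le (by linarith)
    calc |x| = |x| ^ (1 - p) * |x| ^ p := by
          rw [← Real.rpow_add hx]; simp
      _ ≤ _ := by gcongr

end MonotoneOn

/-! ### Optimisation of the truncation level. -/

section Optimise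

/-- The level `(B / a) ^ p⁻¹` balances the two terms. It is replaced by a rational between it and
its double, at the cost of a factor 2 in the first term: `9 = 4 * 2 + 1`. Rational levels are
countable, so in the application the bounds hold for all of them outside one null set. -/
lemma le_rpow_mul_rpow_of_forall_rat_pos {p x a B : ℝ} (hp : 1 < p) (ha : 0 < a) (hB : 0 < B)
    (h : ∀ T : ℚ, 0 < T → x ≤ 4 * a * T + (T : ℝ) ^ (1 - p) * B) :
    x ≤ 9 * (a ^ (1 - p⁻¹) * B ^ p⁻¹) := by
  have hp0 : 0 < p := by linarith
  set T := (B / a) ^ p⁻¹ with hT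
  have hT0 : 0 < T := by positivity
  obtain ⟨q, hq1, hq2⟩ := exists_rat_btwn (show T < 2 * T by linarith)
  have hq0 : 0 < (q : ℝ) := hT0.trans hq1
  have h1 := h q (by exact_mod_cast hq0)
  have h2 : (q : ℝ) ^ (1 - p) ≤ T ^ (1 - p) :=
    Real.rpow_le_rpow_of_nonpos hT0 hq1.le (by linarith)
  have e1 : a * T = a ^ (1 - p⁻¹) * B ^ p⁻¹ := by
    rw [hT, Real.div_rpow hB.le ha.le, Real.rpow_sub ha, Real.rpow_one]
    ring
  have e2 : T ^ (1 - p) * B = a ^ (1 - p⁻¹) * B ^ p⁻¹ := by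
    have hh : p⁻¹ * (1 - p) = p⁻¹ - 1 := by field_simp
    rw [hT, ← Real.rpow_mul (by positivity), hh, Real.div_rpow hB.le ha.le,
      Real.rpow_sub hB, Real.rpow_sub ha, Real.rpow_sub ha, Real.rpow_one, Real.rpow_one]
    field_simp
  calc x ≤ 4 * a * q + (q : ℝ) ^ (1 - p) * B := h1
    _ ≤ 4 * a * (2 * T) + T ^ (1 - p) * B := by gcongr
    _ = 8 * (a * T) + T ^ (1 - p) * B := by ring
    _ = _ := by rw [e1, e2]; ring

/-- When `a` or `B` vanishes there is no optimal level; both are increased by `ε`, which tends to 0.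
-/
lemma le_rpow_mul_rpow_of_forall_rat {p x a B : ℝ} (hp : 1 < p) (ha : 0 ≤ a) (hB : 0 ≤ B)
    (h : ∀ T : ℚ, 0 < T → x ≤ 4 * a * T + (T : ℝ) ^ (1 - p) * B) :
    x ≤ 9 * (a ^ (1 - p⁻¹) * B ^ p⁻¹) := by
  have hp1 : p⁻¹ < 1 := inv_lt_one_of_one_lt₀ hp
  have hp2 : 0 < p⁻¹ := by positivity
  have hcont : ContinuousAt (fun ε : ℝ => 9 * ((a + ε) ^ (1 - p⁻¹) * (B + ε) ^ p⁻¹)) 0 := by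
    refine continuousAt_const.mul (ContinuousAt.mul ?_ ?_)
    · exact (Real.continuous_rpow_const (by linarith)).continuousAt.comp (by fun_prop)
    · exact (Real.continuous_rpow_const hp2.le).continuousAt.comp (by fun_prop)
  have ht := hcont.tendsto.mono_left (nhdsWithin_le_nhds (s := Set.Ioi 0))
  simp only [add_zero] at ht
  refine ge_of_tendsto ht ?_
  filter_upwards [self_mem_nhdsWithin] with ε (hε : 0 < ε)
  refine le_rpow_mul_rpow_of_forall_rat_pos hp (by linarith) (by linarith) fun T hT => ?_
  have hT' : (0 : ℝ) < T := by exact_mod_cast hT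
  refine (h T hT).trans ?_
  gcongr <;> linarith

end Optimise

/-! ### The covariance inequality for one monotone function. -/

section Phi

variable {Ω : Type*} {m : MeasurableSpace Ω} [mΩ : MeasurableSpace Ω] {μ : Measure Ω}
  {Y : Ω → ℝ} {φ : ℝ} {f : ℝ → ℝ} {I : Set ℝ}

lemma condExp_center_sub [IsProbabilityMeasure μ] {Z W : Ω → ℝ} (hZ : Integrable Z μ)
    (hW : Integrable W μ) :
    μ[center μ (Z - W) | m] =ᵐ[μ] μ[center μ Z | m] - μ[center μ W | m] := by
  have e : center μ (Z - W) = center μ Z - center μ W := by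
    ext ω
    simp only [center, Pi.sub_apply]
    rw [integral_sub hZ hW]; ring
  rw [e]
  exact condExp_sub (integrable_center hZ) (integrable_center hW) m

lemma integrable_comp_of_bound [IsProbabilityMeasure μ] (hY : Measurable Y) (hf : Measurable f)
    {T : ℝ} (h : ∀ x, |f x| ≤ T) : Integrable (f ∘ Y) μ :=
  Integrable.of_bound (hf.comp hY).aestronglyMeasurable T (ae_of_all _ fun ω => h (Y ω))

/-- The three monotone components have ranges of lengths `2 * T`, `T` and `T`, hence the factor 4.
-/
lemma ae_abs_condExp_center_le_of_monotoneOn [IsProbabilityMeasure μ] (hm : m ≤ mΩ)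
    (hY : Measurable Y) (hφ0 : 0 ≤ φ) (hφ : phi m μ Y ≤ ENNReal.ofReal φ) (hI : I.OrdConnected)
    (hf : MonotoneOn f I) (h0 : ∀ x ∉ I, f x = 0) {T : ℝ} (hT : ∀ x, |f x| ≤ T) :
    ∀ᵐ ω ∂μ, |μ[center μ (f ∘ Y) | m] ω| ≤ 4 * φ * T := by
  have hT0 : 0 ≤ T := (abs_nonneg _).trans (hT 0)
  obtain ⟨h, u, v, hh, hu, hv, bh, bu, bv, rfl⟩ := exists_monotone_of_monotoneOn hI hf h0 hT
  have ih : Integrable (h ∘ Y) μ := integrable_comp_of_bound hY hh.measurable fun x => by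
    rw [abs_of_nonneg (bh x).1]; exact (bh x).2
  have iu : Integrable (u ∘ Y) μ := integrable_comp_of_bound hY hu.measurable fun x => by
    rw [abs_of_nonneg (bu x).1]; exact (bu x).2
  have iv : Integrable (v ∘ Y) μ := integrable_comp_of_bound hY hv.measurable fun x => by
    rw [abs_of_nonneg (bv x).1]; exact (bv x).2
  filter_upwards [condExp_center_sub (m := m) (ih.sub iu) iv, condExp_center_sub (m := m) ih iu,
    ae_abs_condExp_center_le_of_monotone hm hY hφ0 hφ hh (by linarith) (fun x => (bh x).1)
      (fun x => (bh x).2),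
    ae_abs_condExp_center_le_of_monotone hm hY hφ0 hφ hu hT0 (fun x => (bu x).1)
      (fun x => (bu x).2),
    ae_abs_condExp_center_le_of_monotone hm hY hφ0 hφ hv hT0 (fun x => (bv x).1)
      (fun x => (bv x).2)] with ω h1 h2 h3 h4 h5
  have e : (h - u - v) ∘ Y = h ∘ Y - u ∘ Y - v ∘ Y := rfl
  rw [e, h1, Pi.sub_apply, h2, Pi.sub_apply]
  rw [abs_le] at *
  constructor <;> nlinarith

/-- The function is clipped at `T`. Clipping preserves monotonicity on `I`, so mixing handles the
bounded part; the remainder is at most `T ^ (1 - p) * |f| ^ p` and is estimated without mixing. -/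
lemma ae_abs_condExp_center_le_add [IsProbabilityMeasure μ] (hm : m ≤ mΩ)
    (hY : Measurable Y) (hφ0 : 0 ≤ φ) (hφ : phi m μ Y ≤ ENNReal.ofReal φ) (hI : I.OrdConnected)
    (hf : MonotoneOn f I) (h0 : ∀ x ∉ I, f x = 0) {p : ℝ} (hp : 1 < p)
    (hfp : MemLp (f ∘ Y) (ENNReal.ofReal p) μ) {T : ℝ} (hT : 0 < T) :
    ∀ᵐ ω ∂μ, |μ[center μ (f ∘ Y) | m] ω| ≤ 4 * φ * T + T ^ (1 - p) *
      (μ[fun ω => |f (Y ω)| ^ p | m] ω + ∫ ω, |f (Y ω)| ^ p ∂μ) := by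
  set g : ℝ → ℝ := fun x => max (-T) (min (f x) T) with hg
  have hfm := measurable_of_monotoneOn hI hf h0
  have hgI : MonotoneOn g I := fun x hx y hy hxy => monotone_clip T (hf hx hy hxy)
  have hg0 : ∀ x ∉ I, g x = 0 := fun x hx => by
    simp only [hg]; rw [h0 x hx]; exact clip_zero hT.le
  have hgT : ∀ x, |g x| ≤ T := fun x => abs_clip_le hT.le (f x)
  have ifY : Integrable (f ∘ Y) μ := hfp.integrable (one_le_ofReal hp)
  have igY : Integrable (g ∘ Y) μ :=
    integrable_comp_of_bound hY (measurable_of_monotoneOn hI hgI hg0) hgT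
  have ip : Integrable (fun ω => |f (Y ω)| ^ p) μ := integrable_abs_rpow hp hfp
  have ip' : Integrable (fun ω => T ^ (1 - p) * |f (Y ω)| ^ p) μ := ip.const_mul _
  set R : Ω → ℝ := f ∘ Y - g ∘ Y with hR
  have hRi : Integrable R μ := ifY.sub igY
  have hRle : ∀ ω, |R ω| ≤ T ^ (1 - p) * |f (Y ω)| ^ p := fun ω => abs_sub_clip_le hp hT (f (Y ω))
  have hc : μ[fun ω => T ^ (1 - p) * |f (Y ω)| ^ p | m] =ᵐ[μ]
      fun ω => T ^ (1 - p) * μ[fun ω => |f (Y ω)| ^ p | m] ω :=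
    condExp_smul (T ^ (1 - p)) (fun ω => |f (Y ω)| ^ p) m
  have h1 : μ[R | m] ≤ᵐ[μ] μ[fun ω => T ^ (1 - p) * |f (Y ω)| ^ p | m] :=
    condExp_mono hRi ip' (ae_of_all _ fun ω => (le_abs_self _).trans (hRle ω))
  have h2 : μ[-R | m] ≤ᵐ[μ] μ[fun ω => T ^ (1 - p) * |f (Y ω)| ^ p | m] :=
    condExp_mono hRi.neg ip' (ae_of_all _ fun ω => (neg_le_abs _).trans (hRle ω))
  have h3 : |∫ ω, R ω ∂μ| ≤ T ^ (1 - p) * ∫ ω, |f (Y ω)| ^ p ∂μ := by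
    rw [← integral_const_mul]
    exact abs_integral_le_integral_abs.trans (integral_mono hRi.abs ip' hRle)
  filter_upwards [h1, h2, hc, condExp_neg R m (μ := μ), condExp_center_ae_eq hm hRi,
    condExp_center_sub (m := m) ifY igY,
    ae_abs_condExp_center_le_of_monotoneOn hm hY hφ0 hφ hI hgI hg0 hgT]
    with ω h1 h2 hc hn h4 h5 h6
  rw [h4, Pi.sub_apply] at h5
  rw [hn, Pi.neg_apply] at h2
  rw [hc] at h1 h2
  rw [abs_le] at h3 h6 ⊢
  constructor <;> linarith

/-- The truncation level is optimised separately at each `ω`, against the conditional moment. This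
is why the bound survives in `L^p` with the exponent `1 - 1 / p`. -/
lemma ae_abs_condExp_center_le_rpow [IsProbabilityMeasure μ] (hm : m ≤ mΩ)
    (hY : Measurable Y) (hφ0 : 0 ≤ φ) (hφ : phi m μ Y ≤ ENNReal.ofReal φ) (hI : I.OrdConnected)
    (hf : MonotoneOn f I) (h0 : ∀ x ∉ I, f x = 0) {p : ℝ} (hp : 1 < p)
    (hfp : MemLp (f ∘ Y) (ENNReal.ofReal p) μ) :
    ∀ᵐ ω ∂μ, |μ[center μ (f ∘ Y) | m] ω| ≤ 9 * (φ ^ (1 - p⁻¹) *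
      (μ[fun ω => |f (Y ω)| ^ p | m] ω + ∫ ω, |f (Y ω)| ^ p ∂μ) ^ p⁻¹) := by
  have hnn : 0 ≤ᵐ[μ] μ[fun ω => |f (Y ω)| ^ p | m] :=
    condExp_nonneg (ae_of_all _ fun ω => by positivity)
  have hall : ∀ᵐ ω ∂μ, ∀ T : ℚ, 0 < T → |μ[center μ (f ∘ Y) | m] ω| ≤ 4 * φ * T +
      (T : ℝ) ^ (1 - p) * (μ[fun ω => |f (Y ω)| ^ p | m] ω + ∫ ω, |f (Y ω)| ^ p ∂μ) := by
    refine ae_all_iff.2 fun T => ?_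
    by_cases hT : 0 < T
    · filter_upwards [ae_abs_condExp_center_le_add hm hY hφ0 hφ hI hf h0 hp hfp
        (T := T) (by exact_mod_cast hT)] with ω h _ using h
    · exact ae_of_all _ fun ω h => absurd h hT
  filter_upwards [hnn, hall] with ω h1 h2
  exact le_rpow_mul_rpow_of_forall_rat hp hφ0
    (add_nonneg h1 (integral_nonneg fun ω => by positivity)) h2

/-- Raised to the power `p`, the pointwise bound integrates exactly, because the sum of the
conditional and the full moment has mean `2 * 𝔼|f(Y)| ^ p`. The resulting factor `2 ^ (1 / p)` is
bounded by 2. -/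
lemma eLpNorm_condExp_center_le_of_monotoneOn [IsProbabilityMeasure μ] (hm : m ≤ mΩ)
    (hY : Measurable Y) (hφ0 : 0 ≤ φ) (hφ : phi m μ Y ≤ ENNReal.ofReal φ) (hI : I.OrdConnected)
    (hf : MonotoneOn f I) (h0 : ∀ x ∉ I, f x = 0) {p : ℝ} (hp : 1 < p)
    (hfp : MemLp (f ∘ Y) (ENNReal.ofReal p) μ) :
    eLpNorm (μ[center μ (f ∘ Y) | m]) (ENNReal.ofReal p) μ ≤
      18 * ENNReal.ofReal (φ ^ (1 - p⁻¹)) * eLpNorm (f ∘ Y) (ENNReal.ofReal p) μ := by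
  have hp0 : 0 < p := by linarith
  have ip : Integrable (fun ω => |f (Y ω)| ^ p) μ := integrable_abs_rpow hp hfp
  set B : Ω → ℝ := fun ω => μ[fun ω => |f (Y ω)| ^ p | m] ω + ∫ ω, |f (Y ω)| ^ p ∂μ with hB
  have hnn : 0 ≤ᵐ[μ] B := by
    filter_upwards [condExp_nonneg (m := m) (μ := μ) (f := fun ω => |f (Y ω)| ^ p)
      (ae_of_all _ fun ω => by positivity)] with ω h
    exact add_nonneg h (integral_nonneg fun ω => by positivity)
  have iB : Integrable B μ := integrable_condExp.add (integrable_const _)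
  have eB : ∫ ω, B ω ∂μ = 2 * ∫ ω, |f (Y ω)| ^ p ∂μ := by
    simp only [hB]
    rw [integral_add integrable_condExp (integrable_const _), integral_condExp hm]
    simp; ring
  have lB : ∫⁻ ω, ENNReal.ofReal (B ω) ∂μ = 2 * eLpNorm (f ∘ Y) (ENNReal.ofReal p) μ ^ p := by
    rw [← ofReal_integral_eq_lintegral_ofReal iB hnn, eB, ENNReal.ofReal_mul (by norm_num),
      ofReal_integral_eq_lintegral_ofReal ip (ae_of_all _ fun ω => by positivity),
      eLpNorm_rpow_eq hp]
    simp
  set K : ℝ≥0∞ := 9 * ENNReal.ofReal (φ ^ (1 - p⁻¹)) with hK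
  have h1 : eLpNorm (μ[center μ (f ∘ Y) | m]) (ENNReal.ofReal p) μ ^ p ≤
      K ^ p * (2 * eLpNorm (f ∘ Y) (ENNReal.ofReal p) μ ^ p) := by
    rw [eLpNorm_rpow_eq hp, ← lB, ← lintegral_const_mul' _ _
      (ENNReal.rpow_ne_top_of_nonneg hp0.le (by finiteness))]
    refine lintegral_mono_ae ?_
    filter_upwards [hnn, ae_abs_condExp_center_le_rpow hm hY hφ0 hφ hI hf h0 hp hfp] with ω h h'
    have h : 0 ≤ B ω := h
    rw [← ENNReal.ofReal_rpow_of_nonneg (abs_nonneg _) hp0.le]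
    refine (ENNReal.rpow_le_rpow (ENNReal.ofReal_le_ofReal h') hp0.le).trans (le_of_eq ?_)
    rw [ENNReal.ofReal_mul (by norm_num), ENNReal.ofReal_mul (by positivity), ← mul_assoc,
      ENNReal.mul_rpow_of_nonneg _ _ hp0.le, ← ENNReal.ofReal_rpow_of_nonneg h (by positivity),
      ← ENNReal.rpow_mul, inv_mul_cancel₀ hp0.ne', ENNReal.rpow_one]
    norm_num [hK]
  have h2 : K ^ p * (2 * eLpNorm (f ∘ Y) (ENNReal.ofReal p) μ ^ p) ≤
      (18 * ENNReal.ofReal (φ ^ (1 - p⁻¹)) * eLpNorm (f ∘ Y) (ENNReal.ofReal p) μ) ^ p := by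
    have e : 18 * ENNReal.ofReal (φ ^ (1 - p⁻¹)) * eLpNorm (f ∘ Y) (ENNReal.ofReal p) μ =
        K * (2 * eLpNorm (f ∘ Y) (ENNReal.ofReal p) μ) := by
      rw [hK]; ring
    rw [e, ENNReal.mul_rpow_of_nonneg K _ hp0.le, ENNReal.mul_rpow_of_nonneg 2 _ hp0.le]
    have h2 : (2 : ℝ≥0∞) ≤ 2 ^ p := by
      simpa using ENNReal.rpow_le_rpow_of_exponent_le (show (1 : ℝ≥0∞) ≤ 2 by norm_num) hp.le
    exact mul_le_mul_right (mul_le_mul_left h2 _) _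
  exact (ENNReal.rpow_le_rpow_iff hp0).1 (h1.trans h2)

end Phi

/-! ### The covariance inequality on the closure and for bounded variation. -/

section Closure

variable {Ω : Type*} {m : MeasurableSpace Ω} [mΩ : MeasurableSpace Ω] {μ : Measure Ω}
  {Y : Ω → ℝ} {f : ℝ → ℝ} {M : ℝ} {ν : Measure ℝ}

lemma measurable_of_mem_Mon {p : ℝ≥0∞} (hf : f ∈ Mon p M ν) : Measurable f := by
  obtain ⟨⟨I, hI, hf | hf, h0⟩, -⟩ := hf
  · exact measurable_of_monotoneOn hI hf h0
  · have := measurable_of_monotoneOn (f := -f) hI hf.neg fun x hx => by simp [h0 x hx]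
    simpa using this.neg

lemma eLpNorm_condExp_center_le_of_mem_Mon [IsProbabilityMeasure μ] (hm : m ≤ mΩ)
    (hY : Measurable Y) {φ : ℝ} (hφ0 : 0 ≤ φ) (hφ : phi m μ Y ≤ ENNReal.ofReal φ) {p : ℝ}
    (hp : 1 < p) (hf : f ∈ Mon (ENNReal.ofReal p) M (μ.map Y)) :
    MemLp (f ∘ Y) (ENNReal.ofReal p) μ ∧
      eLpNorm (μ[center μ (f ∘ Y) | m]) (ENNReal.ofReal p) μ ≤
        18 * ENNReal.ofReal (φ ^ (1 - p⁻¹)) * ENNReal.ofReal M := by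
  have hfm := measurable_of_mem_Mon hf
  obtain ⟨⟨I, hI, hf, h0⟩, hM⟩ := hf
  rw [eLpNorm_map_measure hfm.aestronglyMeasurable hY.aemeasurable] at hM
  have hmem : MemLp (f ∘ Y) (ENNReal.ofReal p) μ :=
    ⟨(hfm.comp hY).aestronglyMeasurable, hM.trans_lt ENNReal.ofReal_lt_top⟩
  refine ⟨hmem, ?_⟩
  suffices h : eLpNorm (μ[center μ (f ∘ Y) | m]) (ENNReal.ofReal p) μ ≤
      18 * ENNReal.ofReal (φ ^ (1 - p⁻¹)) * eLpNorm (f ∘ Y) (ENNReal.ofReal p) μ from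
    h.trans (mul_le_mul_right hM _)
  rcases hf with hf | hf
  · exact eLpNorm_condExp_center_le_of_monotoneOn hm hY hφ0 hφ hI hf h0 hp hmem
  · have h := eLpNorm_condExp_center_le_of_monotoneOn (f := -f) hm hY hφ0 hφ hI hf.neg
      (fun x hx => by simp [h0 x hx]) hp hmem.neg
    have e1 : (-f) ∘ Y = -(f ∘ Y) := rfl
    have e2 : center μ (-(f ∘ Y)) = -center μ (f ∘ Y) := by
      ext ω
      simp only [center, Pi.neg_apply, integral_neg]
      ring
    rw [e1, e2, eLpNorm_neg, eLpNorm_congr_ae (condExp_neg _ _), eLpNorm_neg] at h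
    exact h

lemma eLpNorm_condExp_center_le_of_mem_MonComb [IsProbabilityMeasure μ] (hm : m ≤ mΩ)
    (hY : Measurable Y) {φ : ℝ} (hφ0 : 0 ≤ φ) (hφ : phi m μ Y ≤ ENNReal.ofReal φ) {p : ℝ}
    (hp : 1 < p) (hf : f ∈ MonComb (ENNReal.ofReal p) M (μ.map Y)) :
    MemLp (f ∘ Y) (ENNReal.ofReal p) μ ∧
      eLpNorm (μ[center μ (f ∘ Y) | m]) (ENNReal.ofReal p) μ ≤
        18 * ENNReal.ofReal (φ ^ (1 - p⁻¹)) * ENNReal.ofReal M := by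
  obtain ⟨N, a, u, ha, hu, rfl⟩ := hf
  have hp1 := one_le_ofReal hp
  have h := fun l => eLpNorm_condExp_center_le_of_mem_Mon hm hY hφ0 hφ hp (hu l)
  have e : (fun x => ∑ l, a l * u l x) ∘ Y = fun ω => ∑ l, (a l • (u l ∘ Y)) ω := rfl
  refine ⟨?_, ?_⟩
  · rw [e]
    exact memLp_finsetSum _ fun l _ => (h l).1.const_smul (a l)
  · have hi : ∀ l, Integrable (u l ∘ Y) μ := fun l => (h l).1.integrable hp1
    have e2 : center μ ((fun x => ∑ l, a l * u l x) ∘ Y) =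
        ∑ l, a l • center μ (u l ∘ Y) := by
      ext ω
      simp only [center, Function.comp, Finset.sum_apply, Pi.smul_apply, smul_eq_mul]
      rw [integral_finsetSum _ fun l _ => (show Integrable (fun ω => a l * u l (Y ω)) μ from
        (hi l).const_mul (a l)), ← Finset.sum_sub_distrib]
      refine Finset.sum_congr rfl fun l _ => ?_
      rw [integral_const_mul]
      ring
    have e3 : μ[∑ l, a l • center μ (u l ∘ Y) | m] =ᵐ[μ]
        ∑ l, a l • μ[center μ (u l ∘ Y) | m] := by
      refine (condExp_finsetSum (fun l _ => (integrable_center (hi l)).smul (a l)) m).trans ?_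
      exact eventuallyEq_sum fun l _ => condExp_smul (a l) _ m
    rw [e2, eLpNorm_congr_ae e3]
    refine (eLpNorm_sum_le (fun l _ => (integrable_condExp.smul (a l)).1) hp1).trans ?_
    set K := 18 * ENNReal.ofReal (φ ^ (1 - p⁻¹)) * ENNReal.ofReal M with hK
    calc ∑ l, eLpNorm (a l • μ[center μ (u l ∘ Y) | m]) (ENNReal.ofReal p) μ
        ≤ ∑ l, ENNReal.ofReal |a l| * K := by
          refine Finset.sum_le_sum fun l _ => ?_
          rw [eLpNorm_const_smul, Real.enorm_eq_ofReal_abs]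
          exact mul_le_mul_right (h l).2 _
      _ = ENNReal.ofReal (∑ l, |a l|) * K := by
          rw [← Finset.sum_mul, ENNReal.ofReal_sum_of_nonneg fun l _ => abs_nonneg _]
      _ ≤ 1 * K := by
          refine mul_le_mul_left ?_ _
          rw [← ENNReal.ofReal_one]
          exact ENNReal.ofReal_le_ofReal ha
      _ = K := one_mul _

/-- Continuity in `L^p`, which carries the covariance inequality to the closure. -/
lemma eLpNorm_condExp_center_le [IsProbabilityMeasure μ] {p : ℝ≥0∞} (hp : 1 ≤ p) {Z : Ω → ℝ}
    (hZ : AEStronglyMeasurable Z μ) :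
    eLpNorm (μ[center μ Z | m]) p μ ≤ 2 * eLpNorm Z p μ := by
  refine (eLpNorm_condExp_le_eLpNorm _ hp).trans ?_
  refine (eLpNorm_sub_le (g := fun _ => ∫ ω, Z ω ∂μ) hZ aestronglyMeasurable_const hp).trans ?_
  rw [two_mul]
  gcongr
  rw [eLpNorm_const _ (zero_lt_one.trans_le hp).ne' (IsProbabilityMeasure.ne_zero μ)]
  simp only [measure_univ, ENNReal.one_rpow, mul_one]
  refine (enorm_integral_le_lintegral_enorm _).trans ?_
  rw [← eLpNorm_one_eq_lintegral_enorm]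
  exact eLpNorm_le_eLpNorm_of_exponent_le hp hZ

lemma eLpNorm_condExp_center_le_of_mem_MonClosure [IsProbabilityMeasure μ] (hm : m ≤ mΩ)
    (hY : Measurable Y) {φ : ℝ} (hφ0 : 0 ≤ φ) (hφ : phi m μ Y ≤ ENNReal.ofReal φ) {p : ℝ}
    (hp : 1 < p) (hf : f ∈ MonClosure (ENNReal.ofReal p) M (μ.map Y)) :
    MemLp (f ∘ Y) (ENNReal.ofReal p) μ ∧
      eLpNorm (μ[center μ (f ∘ Y) | m]) (ENNReal.ofReal p) μ ≤
        18 * ENNReal.ofReal (φ ^ (1 - p⁻¹)) * ENNReal.ofReal M := by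
  have hp1 := one_le_ofReal hp
  have hmem := hf.1.comp_of_map hY.aemeasurable
  refine ⟨hmem, ENNReal.le_of_forall_pos_le_add fun ε hε _ => ?_⟩
  obtain ⟨g, hg, hfg⟩ := hf.2 (ε / 2) (by
    rw [ENNReal.div_pos_iff]; exact ⟨by exact_mod_cast hε.ne', by norm_num⟩)
  obtain ⟨hg1, hg2⟩ := eLpNorm_condExp_center_le_of_mem_MonComb hm hY hφ0 hφ hp hg
  have hgm : Measurable g := by
    obtain ⟨N, a, u, -, hu, rfl⟩ := hg
    exact Finset.measurable_fun_sum _ fun l _ => (measurable_of_mem_Mon (hu l)).const_mul (a l)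
  rw [eLpNorm_map_measure (hf.1.1.sub hgm.aestronglyMeasurable) hY.aemeasurable] at hfg
  have e : (f - g) ∘ Y = f ∘ Y - g ∘ Y := rfl
  rw [e] at hfg
  have h1 : μ[center μ (f ∘ Y) | m] =ᵐ[μ]
      μ[center μ (g ∘ Y) | m] + μ[center μ (f ∘ Y - g ∘ Y) | m] := by
    filter_upwards [condExp_center_sub (m := m) (hmem.integrable hp1) (hg1.integrable hp1)]
      with ω h
    rw [Pi.add_apply, h, Pi.sub_apply]; ring
  rw [eLpNorm_congr_ae h1]
  refine (eLpNorm_add_le integrable_condExp.1 integrable_condExp.1 hp1).trans ?_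
  refine add_le_add hg2 ((eLpNorm_condExp_center_le hp1 (hmem.1.sub hg1.1)).trans ?_)
  calc 2 * eLpNorm (f ∘ Y - g ∘ Y) (ENNReal.ofReal p) μ ≤ 2 * (ε / 2) :=
        mul_le_mul_right hfg.le _
    _ = ε := ENNReal.mul_div_cancel (by norm_num) (by norm_num)

/-- The Jordan decomposition `f = w - (w - f)`, with `w` the signed variation from 0. Here `|w| ≤ V`
and `|w - f| ≤ |f 0| + 2 * V`, so adding this constant makes both parts nonnegative. -/
lemma exists_monotone_sub_of_boundedVariationOn (hf : BoundedVariationOn f Set.univ) :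
    ∃ (u v : ℝ → ℝ) (K : ℝ), 0 ≤ K ∧ Monotone u ∧ Monotone v ∧ (∀ x, 0 ≤ u x ∧ u x ≤ K) ∧
      (∀ x, 0 ≤ v x ∧ v x ≤ K) ∧ f = u - v := by
  set V := (eVariationOn f Set.univ).toReal with hV
  have hV0 : 0 ≤ V := ENNReal.toReal_nonneg
  set w := variationOnFromTo f Set.univ 0 with hw
  have hw1 : Monotone w := monotoneOn_univ.1
    (variationOnFromTo.monotoneOn hf.locallyBoundedVariationOn (Set.mem_univ 0))
  have hw2 : Monotone (w - f) := monotoneOn_univ.1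
    (variationOnFromTo.sub_self_monotoneOn hf.locallyBoundedVariationOn (Set.mem_univ 0))
  have hw3 : ∀ x, |w x| ≤ V := fun x => variationOnFromTo.abs_le_eVariationOn hf
  have hf3 : ∀ x, |f x| ≤ |f 0| + V := fun x => by
    have h := hf.dist_le (Set.mem_univ x) (Set.mem_univ 0)
    rw [Real.dist_eq] at h
    have := abs_sub_abs_le_abs_sub (f x) (f 0)
    linarith
  have hf0 := abs_nonneg (f 0)
  set K := |f 0| + 2 * V with hK
  refine ⟨fun x => w x + K, fun x => (w - f) x + K, 2 * K, by positivity,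
    fun x y h => add_le_add (hw1 h) le_rfl, fun x y h => add_le_add (hw2 h) le_rfl, fun x => ?_,
    fun x => ?_, ?_⟩
  · have := abs_le.1 (hw3 x)
    constructor <;> linarith
  · have h1 := abs_le.1 (hw3 x)
    have h2 := abs_le.1 (hf3 x)
    simp only [Pi.sub_apply]
    constructor <;> linarith
  · ext x; simp

lemma eLpNorm_condExp_center_le_of_monotone_sub [IsProbabilityMeasure μ] (hm : m ≤ mΩ)
    (hY : Measurable Y) {φ : ℝ} (hφ0 : 0 ≤ φ) (hφ : phi m μ Y ≤ ENNReal.ofReal φ) {u v : ℝ → ℝ}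
    {K : ℝ} (hK : 0 ≤ K) (hu : Monotone u) (hv : Monotone v) (bu : ∀ x, 0 ≤ u x ∧ u x ≤ K)
    (bv : ∀ x, 0 ≤ v x ∧ v x ≤ K) :
    eLpNorm (μ[center μ ((u - v) ∘ Y) | m]) ∞ μ ≤ ENNReal.ofReal (2 * K) * ENNReal.ofReal φ := by
  have iu : Integrable (u ∘ Y) μ := integrable_comp_of_bound hY hu.measurable fun x => by
    rw [abs_of_nonneg (bu x).1]; exact (bu x).2
  have iv : Integrable (v ∘ Y) μ := integrable_comp_of_bound hY hv.measurable fun x => by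
    rw [abs_of_nonneg (bv x).1]; exact (bv x).2
  rw [← ENNReal.ofReal_mul (by positivity), eLpNorm_exponent_top]
  refine eLpNormEssSup_le_of_ae_bound ?_
  filter_upwards [condExp_center_sub (m := m) iu iv,
    ae_abs_condExp_center_le_of_monotone hm hY hφ0 hφ hu hK (fun x => (bu x).1)
      (fun x => (bu x).2),
    ae_abs_condExp_center_le_of_monotone hm hY hφ0 hφ hv hK (fun x => (bv x).1)
      (fun x => (bv x).2)] with ω h1 h2 h3
  have e : (u - v) ∘ Y = u ∘ Y - v ∘ Y := rfl
  rw [e, h1, Pi.sub_apply, Real.norm_eq_abs]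
  rw [abs_le] at *
  constructor <;> linarith

/-- The covariance inequality: the conditional expectation of a centred function of `Y` is
controlled by the mixing coefficient. -/
lemma exists_eLpNorm_condExp_center_le {p : ℝ≥0∞} (hp : 1 < p)
    (h1 : p < ∞ → ∃ M : ℝ, 0 < M ∧ f ∈ MonClosure p M ν)
    (h2 : p = ∞ → BoundedVariationOn f Set.univ) :
    ∃ C : ℝ≥0∞, C ≠ ∞ ∧ ∀ {Ω : Type*} {m : MeasurableSpace Ω} [mΩ : MeasurableSpace Ω]
      {μ : Measure Ω} [IsProbabilityMeasure μ] {Y : Ω → ℝ}, m ≤ mΩ → Measurable Y → μ.map Y = ν →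
      MemLp (f ∘ Y) p μ ∧
        (phi m μ Y ≠ ∞ → eLpNorm (μ[center μ (f ∘ Y) | m]) p μ ≤
          C * phi m μ Y ^ (1 - p⁻¹).toReal) := by
  rcases eq_or_ne p ∞ with rfl | hpt
  · obtain ⟨u, v, K, hK, hu, hv, bu, bv, rfl⟩ := exists_monotone_sub_of_boundedVariationOn (h2 rfl)
    refine ⟨ENNReal.ofReal (2 * K), ENNReal.ofReal_ne_top, ?_⟩
    intro Ω m mΩ μ _ Y hm hY _
    refine ⟨?_, fun hφ => ?_⟩
    · refine memLp_top_of_bound ((hu.measurable.sub hv.measurable).comp hY).aestronglyMeasurable K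
        (ae_of_all _ fun ω => ?_)
      rw [Real.norm_eq_abs, abs_le]
      have h1 := bu (Y ω)
      have h2 := bv (Y ω)
      simp only [Function.comp, Pi.sub_apply]
      constructor <;> linarith
    · have := eLpNorm_condExp_center_le_of_monotone_sub hm hY ENNReal.toReal_nonneg
        (ENNReal.ofReal_toReal hφ).ge hK hu hv bu bv
      rw [ENNReal.ofReal_toReal hφ] at this
      simpa using this
  · obtain ⟨M, hM, hf⟩ := h1 (lt_top_iff_ne_top.2 hpt)
    have hp' : 1 < p.toReal := by
      rwa [← ENNReal.toReal_one, ENNReal.toReal_lt_toReal (by simp) hpt]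
    have hpe : ENNReal.ofReal p.toReal = p := ENNReal.ofReal_toReal hpt
    have he : (1 - p⁻¹).toReal = 1 - p.toReal⁻¹ := by
      rw [ENNReal.toReal_sub_of_le (ENNReal.inv_le_one.2 hp.le) ENNReal.one_ne_top]
      simp
    refine ⟨18 * ENNReal.ofReal M, by finiteness, ?_⟩
    intro Ω m mΩ μ _ Y hm hY hν
    refine ⟨(hν ▸ hf.1).comp_of_map hY.aemeasurable, fun hφ => ?_⟩
    have := (eLpNorm_condExp_center_le_of_mem_MonClosure (f := f) (M := M) (p := p.toReal) hm hY
      ENNReal.toReal_nonneg (ENNReal.ofReal_toReal hφ).ge hp' (by rw [hpe, hν]; exact hf)).2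
    rw [hpe] at this
    refine this.trans (le_of_eq ?_)
    rw [he, ← ENNReal.ofReal_rpow_of_nonneg ENNReal.toReal_nonneg
      (sub_nonneg.2 (inv_le_one_of_one_le₀ hp'.le)), ENNReal.ofReal_toReal hφ]
    ring

end Closure

lemma stronglyMeasurable_tsum {Ω : Type*} {m : MeasurableSpace Ω} {e : ℤ → Ω → ℝ}
    (he : ∀ n, StronglyMeasurable (e n)) : StronglyMeasurable fun ω => ∑' n, e n ω :=
  (Measurable.tsum fun n => (he n).measurable).stronglyMeasurable

/-! ### Hannan's condition and the approximating martingale. -/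

section Decomposition

variable {Ω : Type u} {F0 : MeasurableSpace Ω} [mΩ : MeasurableSpace Ω] {μ : Measure Ω}
  {θ : Ω ≃ᵐ Ω} {X : Ω → ℝ} {r : ℝ}

lemma condExp_proj_ae_eq_zero [IsProbabilityMeasure μ] (hθ : MeasurePreserving θ μ μ)
    (hm : F0 ≤ mΩ) (hF : F0 ≤ F0.comap θ) (Z : Ω → ℝ) (n : ℤ) :
    μ[proj μ (filt F0 θ) n Z | filt F0 θ (n - 1)] =ᵐ[μ] 0 := by
  have h1 := condExp_sub (μ := μ) (integrable_condExp (m := filt F0 θ n) (f := Z))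
    (integrable_condExp (m := filt F0 θ (n - 1)) (f := Z)) (filt F0 θ (n - 1))
  have h2 := condExp_condExp_of_le (μ := μ) (f := Z) (filt_mono hF (show n - 1 ≤ n by omega))
    (filt_le hθ hm n)
  rw [condExp_of_stronglyMeasurable (filt_le hθ hm (n - 1)) stronglyMeasurable_condExp
    integrable_condExp] at h1
  filter_upwards [h1, h2] with ω h1 h2
  rw [proj, h1, Pi.sub_apply, h2, sub_self, Pi.zero_apply]

lemma stronglyMeasurable_proj (hF : F0 ≤ F0.comap θ) (Z : Ω → ℝ) (n : ℤ) :
    StronglyMeasurable[filt F0 θ n] (proj μ (filt F0 θ) n Z) :=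
  stronglyMeasurable_condExp.sub
    (stronglyMeasurable_condExp.mono (filt_mono hF (show n - 1 ≤ n by omega)))

lemma isStationaryMDS_proj [IsProbabilityMeasure μ] (hθ : MeasurePreserving θ μ μ)
    (hm : F0 ≤ mΩ) (hF : F0 ≤ F0.comap θ) (Z : Ω → ℝ) (n : ℤ) :
    IsStationaryMDS (filt F0 θ (n - 1)) μ θ (proj μ (filt F0 θ) n Z) where
  mp := hθ
  le := filt_le hθ hm _
  le_comap := by
    have := filt_mono hF (show n - 1 ≤ n - 1 + 1 by omega)
    rwa [← filt_filt, filt_one] at this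
  meas := by
    rw [filt_filt, sub_add_cancel]
    exact stronglyMeasurable_proj hF Z n
  condExp_eq := condExp_proj_ae_eq_zero hθ hm hF Z n

lemma MemLp.proj {p : ℝ≥0∞} (hp : 1 ≤ p) {Z : Ω → ℝ} (hZ : MemLp Z p μ) (n : ℤ) :
    MemLp (proj μ (filt F0 θ) n Z) p μ :=
  (hZ.condExp hp).sub (hZ.condExp hp)

/-- `X` is known at time 0, so later information does not change its conditional expectation. Only
the projections at times `n ≤ 0` enter the Hannan norm. -/
lemma proj_ae_eq_zero [IsProbabilityMeasure μ] (hθ : MeasurePreserving θ μ μ)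
    (hm : F0 ≤ mΩ) (hF : F0 ≤ F0.comap θ) (hX : Integrable X μ)
    (hX0 : AEStronglyMeasurable[F0] X μ) {n : ℤ} (hn : 1 ≤ n) :
    proj μ (filt F0 θ) n X =ᵐ[μ] 0 := by
  have h : ∀ i : ℤ, 0 ≤ i → μ[X | filt F0 θ i] =ᵐ[μ] X := fun i hi => by
    refine condExp_of_aestronglyMeasurable' (filt_le hθ hm i) (hX0.mono ?_) hX
    have := filt_mono hF hi
    rwa [filt_zero] at this
  filter_upwards [h n (by omega), h (n - 1) (by omega)] with ω h1 h2
  rw [proj, Pi.sub_apply, h1, h2, sub_self, Pi.zero_apply]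

lemma hannanNorm_eq_tsum [IsProbabilityMeasure μ] (hθ : MeasurePreserving θ μ μ)
    (hm : F0 ≤ mΩ) (hF : F0 ≤ F0.comap θ) (hX : Integrable X μ)
    (hX0 : AEStronglyMeasurable[F0] X μ) (p : ℝ≥0∞) :
    hannanNorm μ (filt F0 θ) p X = ∑' k : ℕ, eLpNorm (proj μ (filt F0 θ) (-k) X) p μ := by
  have hinj : Function.Injective fun k : ℕ => -(k : ℤ) := fun i j h => by simpa using h
  refine (hinj.tsum_eq (f := fun n : ℤ => eLpNorm (proj μ (filt F0 θ) n X) p μ)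
    fun n hn => ?_).symm
  by_contra hr
  refine hn ?_
  have h1 : 1 ≤ n := by
    by_contra h
    exact hr ⟨n.natAbs, by simp only; omega⟩
  exact (eLpNorm_congr_ae (proj_ae_eq_zero hθ hm hF hX hX0 h1)).trans eLpNorm_zero

/-- A process adapted to the past with `∑ ‖𝔼(X k | F0)‖_r / √k < ∞` is a sum of stationary
martingale differences. -/
lemma hannan_of_condExp [IsProbabilityMeasure μ] (hθ : MeasurePreserving θ μ μ)
    (hm : F0 ≤ mΩ) (hF : F0 ≤ F0.comap θ) (hr : 1 < r) (hr2 : r ≤ 2)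
    (hX : MemLp X (ENNReal.ofReal r) μ) (hX0 : AEStronglyMeasurable[F0] X μ)
    (hs : ∑' k : ℕ, eLpNorm (μ[X ∘ iter θ ((k + 1 : ℕ) : ℤ) | F0]) (ENNReal.ofReal r) μ /
      ((k + 1 : ℕ) : ℝ≥0∞) ^ (1 / 2 : ℝ) ≠ ∞) :
    hannanNorm μ (filt F0 θ) (ENNReal.ofReal r) X ≠ ∞ ∧
      ∀ᵐ ω ∂μ, HasSum (fun k : ℕ => proj μ (filt F0 θ) (-k) X ω) (X ω) := by
  have hi := hX.integrable (one_le_ofReal hr)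
  -- Stationarity turns the prediction of the future `X ∘ θ ^ (k + 1)` from `F0` into the prediction
  -- of `X` from the remote past. The fields `filt F0 θ (-j)` decrease, which gives a reverse
  -- martingale.
  have e : ∀ k : ℕ, eLpNorm (μ[X ∘ iter θ ((k + 1 : ℕ) : ℤ) | F0]) (ENNReal.ofReal r) μ =
      eLpNorm (μ[X | filt F0 θ (-((k + 1 : ℕ) : ℤ))]) (ENNReal.ofReal r) μ := by
    intro k
    have h := condExp_comp_iter hθ (filt_le hθ hm (-((k + 1 : ℕ) : ℤ))) X ((k + 1 : ℕ) : ℤ)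
    rw [filt_filt, neg_add_cancel, filt_zero] at h
    rw [eLpNorm_congr_ae h, eLpNorm_comp_iter hθ]
  rw [tsum_congr fun k => by rw [e k]] at hs
  have h := tsum_eLpNorm_condExp_sub_ne_top (F := fun j : ℕ => filt F0 θ (-(j : ℤ))) hr hr2
    (fun i j hij => filt_mono hF (by simpa using hij)) (fun j => filt_le hθ hm _) hX hs
  have e2 : ∀ j : ℕ, μ[X | filt F0 θ (-(j : ℤ))] - μ[X | filt F0 θ (-((j + 1 : ℕ) : ℤ))] =
      proj μ (filt F0 θ) (-j) X := fun j => by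
    have : (-((j + 1 : ℕ) : ℤ)) = -j - 1 := by push_cast; ring
    rw [proj, this]
  simp only [e2] at h
  refine ⟨by rw [hannanNorm_eq_tsum hθ hm hF hi hX0]; exact h.1, ?_⟩
  have h0 : μ[X | filt F0 θ (-((0 : ℕ) : ℤ))] =ᵐ[μ] X := by
    rw [Nat.cast_zero, neg_zero, filt_zero]
    exact condExp_of_aestronglyMeasurable' hm hX0 hi
  filter_upwards [h.2, h0] with ω h1 h2
  rwa [h2] at h1

/-- Summation of a series of random variables that is summable in `L^p`. -/
lemma exists_hasSum_of_tsum_eLpNorm [IsProbabilityMeasure μ] (hm : F0 ≤ mΩ) {p : ℝ≥0∞} (hp : 1 ≤ p)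
    {e : ℤ → Ω → ℝ} (he : ∀ n, StronglyMeasurable[F0] (e n))
    (hfin : ∑' n, eLpNorm (e n) p μ ≠ ∞) :
    ∃ d : Ω → ℝ, StronglyMeasurable[F0] d ∧ MemLp d p μ ∧
      (∀ᵐ ω ∂μ, HasSum (fun n => e n ω) (d ω)) ∧
      Tendsto (fun s : Finset ℤ => eLpNorm (d - ∑ n ∈ s, e n) p μ) atTop (𝓝 0) := by
  have hem : ∀ n, AEStronglyMeasurable (e n) μ := fun n => ((he n).mono hm).aestronglyMeasurable
  set d : Ω → ℝ := fun ω => ∑' n, e n ω with hd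
  have hdm : StronglyMeasurable[F0] d := stronglyMeasurable_tsum he
  have hsum : ∀ᵐ ω ∂μ, HasSum (fun n => e n ω) (d ω) := by
    filter_upwards [ae_summable_of_tsum_eLpNorm hp hem hfin] with ω h
    exact h.of_abs.hasSum
  refine ⟨d, hdm, ⟨(hdm.mono hm).aestronglyMeasurable,
    (eLpNorm_le_tsum_of_hasSum hp hem hsum).trans_lt (lt_top_iff_ne_top.2 hfin)⟩, hsum, ?_⟩
  refine tendsto_of_tendsto_of_tendsto_of_le_of_le tendsto_const_nhds
    (ENNReal.tendsto_tsum_compl_atTop_zero hfin) (fun s => zero_le) fun s => ?_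
  refine eLpNorm_le_tsum_of_hasSum (u := fun n : {n // n ∉ s} => e n) hp (fun n => hem n) ?_
  filter_upwards [hsum] with ω h
  rw [Pi.sub_apply, Finset.sum_apply]
  refine (Finset.hasSum_compl_iff (f := fun n => e n ω) s).2 ?_
  rwa [sub_add_cancel]

/-- Subtracting finitely many conditionally centred terms does not change the conditional
expectation of `d`, so by contraction its norm is at most that of each remainder. -/
lemma condExp_ae_eq_zero_of_tendsto [IsProbabilityMeasure μ] {p : ℝ≥0∞} (hp : 1 ≤ p)
    {e : ℤ → Ω → ℝ} (he : ∀ n, Integrable (e n) μ) (h0 : ∀ n, μ[e n | F0] =ᵐ[μ] 0) {d : Ω → ℝ}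
    (hd : Integrable d μ)
    (ht : Tendsto (fun s : Finset ℤ => eLpNorm (d - ∑ n ∈ s, e n) p μ) atTop (𝓝 0)) :
    μ[d | F0] =ᵐ[μ] 0 := by
  have hle : ∀ s : Finset ℤ, eLpNorm (μ[d | F0]) p μ ≤ eLpNorm (d - ∑ n ∈ s, e n) p μ := by
    intro s
    have h1 : μ[d - ∑ n ∈ s, e n | F0] =ᵐ[μ] μ[d | F0] := by
      have hall : ∀ᵐ ω ∂μ, ∀ n, μ[e n | F0] ω = 0 := ae_all_iff.2 h0
      filter_upwards [condExp_sub hd (integrable_finsetSum' s fun n _ => he n) F0,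
        condExp_finsetSum (s := s) (fun n _ => he n) F0, hall] with ω h1 h2 h3
      rw [h1, Pi.sub_apply, h2, Finset.sum_apply, Finset.sum_eq_zero fun n _ => h3 n, sub_zero]
    rw [← eLpNorm_congr_ae h1]
    exact eLpNorm_condExp_le_eLpNorm _ hp
  have hz := ge_of_tendsto' ht hle
  exact (eLpNorm_eq_zero_iff integrable_condExp.1 (zero_lt_one.trans_le hp).ne').1
    (le_antisymm hz zero_le)

/-- By stationarity `P 1 (X ∘ θ ^ n)` is `P (1 - n) X` composed with `θ ^ n`, so the norms in the
series for `d` are those of the Hannan norm, reindexed. -/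
lemma exists_lil_martingale [IsProbabilityMeasure μ] (hθ : MeasurePreserving θ μ μ)
    (hm : F0 ≤ mΩ) (hF : F0 ≤ F0.comap θ) (hX : MemLp X 2 μ)
    (hX0 : AEStronglyMeasurable[F0] X μ) (hfin : hannanNorm μ (filt F0 θ) 2 X ≠ ∞)
    (hsum : ∀ᵐ ω ∂μ, HasSum (fun k : ℕ => proj μ (filt F0 θ) (-k) X ω) (X ω)) :
    ∃ d : Ω → ℝ, StronglyMeasurable[filt F0 θ 1] d ∧ MemLp d 2 μ ∧
      Tendsto (fun s : Finset ℤ =>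
        eLpNorm (d - ∑ n ∈ s, proj μ (filt F0 θ) 1 (X ∘ iter θ n)) 2 μ) atTop (𝓝 0) ∧
      μ[d | filt F0 θ 0] =ᵐ[μ] 0 ∧
      ∀ᵐ ω ∂μ, (fun n : ℕ => partialSum (fun i => X ∘ iter θ i) n ω -
        partialSum (fun k => d ∘ iter θ k) n ω) =o[atTop] lilScale := by
  have hi : Integrable X μ := hX.integrable (by norm_num)
  set e : ℤ → Ω → ℝ := fun n => proj μ (filt F0 θ) 1 (X ∘ iter θ n) with he
  have heq : ∀ n : ℤ, e n =ᵐ[μ] proj μ (filt F0 θ) (1 - n) X ∘ iter θ n := fun n => by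
    have := proj_comp_iter hθ hm X (1 - n) n
    rwa [sub_add_cancel] at this
  have hefin : ∑' n, eLpNorm (e n) 2 μ ≠ ∞ := by
    have h1 : ∀ n, eLpNorm (e n) 2 μ = eLpNorm (proj μ (filt F0 θ) (1 - n) X) 2 μ := fun n => by
      rw [eLpNorm_congr_ae (heq n), eLpNorm_comp_iter hθ]
    rw [tsum_congr h1]
    have := (Equiv.subLeft (1 : ℤ)).tsum_eq fun n => eLpNorm (proj μ (filt F0 θ) n X) 2 μ
    simp only [Equiv.subLeft_apply] at this
    rwa [this]
  obtain ⟨d, hd1, hd2, hd3, hd4⟩ := exists_hasSum_of_tsum_eLpNorm (filt_le hθ hm 1)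
    (p := 2) (by norm_num) (fun n => stronglyMeasurable_proj hF (X ∘ iter θ n) 1) hefin
  have heL : ∀ n, MemLp (e n) 2 μ := fun n =>
    MemLp.proj (by norm_num) (MemLp.comp_iter hθ hX n) 1
  refine ⟨d, hd1, hd2, hd4, ?_, ?_⟩
  · refine condExp_ae_eq_zero_of_tendsto (p := 2) (by norm_num)
      (fun n => (heL n).integrable (by norm_num)) (fun n => ?_) (hd2.integrable (by norm_num)) hd4
    have := condExp_proj_ae_eq_zero hθ hm hF (X ∘ iter θ n) 1
    rwa [sub_self] at this
  · refine ae_isLittleO_of_hasSum (m := fun k : ℕ => filt F0 θ (-(k : ℤ) - 1))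
      (D := fun k : ℕ => proj μ (filt F0 θ) (-(k : ℤ)) X)
      (fun k => isStationaryMDS_proj hθ hm hF X _) (fun k => MemLp.proj (by norm_num) hX _)
      (by rwa [← hannanNorm_eq_tsum hθ hm hF hi hX0]) hsum ?_
    -- For `n ≤ 0` the variable `X ∘ θ ^ n` is already known at time 0. The surviving indices `n = k
    -- + 1` give exactly the shifted components `D k ∘ θ ^ (k + 1)`.
    have hneg : ∀ᵐ ω ∂μ, ∀ n : ℤ, n ≤ 0 → e n ω = 0 := by
      refine ae_all_iff.2 fun n => ?_
      by_cases hn : n ≤ 0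
      · filter_upwards [heq n, ae_comp_iter hθ
          (proj_ae_eq_zero hθ hm hF hi hX0 (n := 1 - n) (by omega)) n] with ω h1 h2 _
        rw [h1]; exact h2
      · exact ae_of_all _ fun ω h => absurd h hn
    have hinj : Function.Injective fun k : ℕ => (k : ℤ) + 1 := fun i j h => by simpa using h
    filter_upwards [hd3, hneg, ae_all_iff.2 heq] with ω h1 h2 h3
    have h4 := (hinj.hasSum_iff (f := fun n => e n ω) (a := d ω) fun n hn => h2 n (by
      by_contra h
      exact hn ⟨(n - 1).natAbs, by simp only; omega⟩)).2 h1
    refine h4.congr_fun fun k => ?_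
    simp only [Function.comp]
    rw [h3, Function.comp]
    have : 1 - ((k : ℤ) + 1) = -k := by ring
    rw [this]

end Decomposition

/-! ### The mixing condition implies Hannan's condition. -/

section Main

variable {Ω : Type u} {F0 : MeasurableSpace Ω} [mΩ : MeasurableSpace Ω] {μ : Measure Ω}
  {θ : Ω ≃ᵐ Ω} {Y : Ω → ℝ} {f : ℝ → ℝ}

/-- A member of the closure is measurable only up to null sets of the law of `Y`, so the centred
variable is `F0`-measurable only up to null sets. -/
lemma aestronglyMeasurable_center_comp (hm : F0 ≤ mΩ) (hY : Measurable[F0] Y)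
    (hf : AEStronglyMeasurable f (μ.map Y)) : AEStronglyMeasurable[F0] (center μ (f ∘ Y)) μ := by
  refine ⟨fun ω => hf.mk f (Y ω) - ∫ ω', f (Y ω') ∂μ, ?_, ?_⟩
  · exact (hf.stronglyMeasurable_mk.comp_measurable hY).sub stronglyMeasurable_const
  · filter_upwards [ae_of_ae_map (hY.mono hm le_rfl).aemeasurable hf.ae_eq_mk] with ω h
    simp only [center, Function.comp, h]

lemma aestronglyMeasurable_of_memMonClosure_or_boundedVariationOn {p : ℝ≥0∞} {ν : Measure ℝ}
    (h1 : p < ∞ → ∃ M : ℝ, 0 < M ∧ f ∈ MonClosure p M ν)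
    (h2 : p = ∞ → BoundedVariationOn f Set.univ) : AEStronglyMeasurable f ν := by
  rcases eq_or_ne p ∞ with hp | hp
  · obtain ⟨u, v, K, -, hu, hv, -, -, rfl⟩ := exists_monotone_sub_of_boundedVariationOn (h2 hp)
    exact (hu.measurable.sub hv.measurable).aestronglyMeasurable
  · obtain ⟨M, -, hf⟩ := h1 (lt_top_iff_ne_top.2 hp)
    exact hf.1.1

/-- Under the mixing condition, the process satisfies a Hannan-type condition in `L^r`
for every `r ≤ min(p, 2)`, `r > 1`. -/
lemma memLp_and_hannan [IsProbabilityMeasure μ] (hθ : MeasurePreserving θ μ μ)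
    (hm : F0 ≤ mΩ) (hF : F0 ≤ F0.comap θ) (hY : Measurable[F0] Y) {p : ℝ≥0∞} (hp : 1 < p)
    (h1 : p < ∞ → ∃ M : ℝ, 0 < M ∧ f ∈ MonClosure p M (μ.map Y))
    (h2 : p = ∞ → BoundedVariationOn f Set.univ)
    (hs : ∑' k : ℕ, phiSeq F0 μ θ Y (k + 1) ^ (1 - p⁻¹).toReal /
      ((k + 1 : ℕ) : ℝ≥0∞) ^ (1 / 2 : ℝ) < ∞) {r : ℝ} (hr : 1 < r) (hr2 : r ≤ 2)
    (hrp : ENNReal.ofReal r ≤ p) :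
    MemLp (center μ (f ∘ Y)) (ENNReal.ofReal r) μ ∧
      hannanNorm μ (filt F0 θ) (ENNReal.ofReal r) (center μ (f ∘ Y)) ≠ ∞ ∧
      ∀ᵐ ω ∂μ, HasSum (fun k : ℕ => proj μ (filt F0 θ) (-k) (center μ (f ∘ Y)) ω)
        (center μ (f ∘ Y) ω) := by
  have hYm : Measurable Y := hY.mono hm le_rfl
  -- The constant depends on `f` and the law of `Y` only. All the `Y ∘ θ ^ k` share this law, so one
  -- constant serves every `k`.
  obtain ⟨C, hC, H⟩ := exists_eLpNorm_condExp_center_le (f := f) (ν := μ.map Y) hp h1 h2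
  have hfY : MemLp (f ∘ Y) p μ := (H hm hYm rfl).1
  have hX : MemLp (center μ (f ∘ Y)) (ENNReal.ofReal r) μ :=
    (hfY.mono_exponent hrp).sub (memLp_const _)
  refine ⟨hX, hannan_of_condExp hθ hm hF hr hr2 hX (aestronglyMeasurable_center_comp hm hY
    (aestronglyMeasurable_of_memMonClosure_or_boundedVariationOn h1 h2)) ?_⟩
  have he : 0 < (1 - p⁻¹).toReal :=
    ENNReal.toReal_pos (tsub_pos_of_lt (ENNReal.inv_lt_one.2 hp)).ne' (by finiteness)
  have hbound : ∀ k : ℕ,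
      eLpNorm (μ[center μ (f ∘ Y) ∘ iter θ ((k + 1 : ℕ) : ℤ) | F0]) (ENNReal.ofReal r) μ ≤
        C * phiSeq F0 μ θ Y (k + 1) ^ (1 - p⁻¹).toReal := by
    intro k
    have hphi : phi F0 μ (Y ∘ iter θ ((k + 1 : ℕ) : ℤ)) ≤ phiSeq F0 μ θ Y (k + 1) :=
      le_iSup₂ (f := fun i (_ : k + 1 ≤ i) => phi F0 μ (Y ∘ iter θ (i : ℤ))) (k + 1) le_rfl
    -- Finiteness is read off the hypothesis: an infinite coefficient, raised to a positive power,
    -- would make its term infinite.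
    have hfinite : phiSeq F0 μ θ Y (k + 1) ≠ ∞ := by
      intro h
      have := ENNReal.ne_top_of_tsum_ne_top hs.ne k
      rw [h, ENNReal.top_rpow_of_pos he] at this
      exact this (ENNReal.top_div_of_ne_top (by finiteness))
    have hmp := measurePreserving_iter hθ ((k + 1 : ℕ) : ℤ)
    have hk := (H (Y := Y ∘ iter θ ((k + 1 : ℕ) : ℤ)) (m := F0) (μ := μ) hm
      (hYm.comp hmp.measurable) (by rw [← Measure.map_map hYm hmp.measurable, hmp.map_eq])).2
      (ne_top_of_le_ne_top hfinite hphi)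
    rw [← Function.comp_assoc, center_comp_iter hθ] at hk
    exact (eLpNorm_le_eLpNorm_of_exponent_le hrp integrable_condExp.1).trans
      (hk.trans (mul_le_mul_right (ENNReal.rpow_le_rpow hphi he.le) _))
  refine ne_top_of_le_ne_top (ENNReal.mul_ne_top hC hs.ne) ?_
  rw [← ENNReal.tsum_mul_left]
  refine ENNReal.tsum_le_tsum fun k => ?_
  rw [← mul_div_assoc]
  exact ENNReal.div_le_div_right (hbound k) _

end Main

end PhiMixing

theorem mainTheorem6 :
    ∃ C C' : ℝ → ℝ,
      (∀ p : ℝ, 1 < p → p < 2 → 0 < C p) ∧ (∀ q : ℝ, 1 ≤ q → q < 2 → 0 < C' q) ∧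
      ∀ (Ω : Type*) (F0 : MeasurableSpace Ω) [mΩ : MeasurableSpace Ω] (μ : Measure Ω) [IsProbabilityMeasure μ]
        (θ : Ω ≃ᵐ Ω) (_ : MeasurePreserving θ μ μ)
        (_ : F0 ≤ mΩ) (_ : F0 ≤ F0.comap θ)
        (Y : Ω → ℝ) (_ : Measurable[F0] Y)
        (f : ℝ → ℝ) (p : ℝ≥0∞) (_ : 1 < p)
        (_ : p < ∞ → ∃ M : ℝ, 0 < M ∧ f ∈ PhiMixing.MonClosure p M (μ.map Y))
        (_ : p = ∞ → BoundedVariationOn f Set.univ)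
        (_ : ∑' k : ℕ, PhiMixing.phiSeq F0 μ θ Y (k + 1) ^ (1 - p⁻¹).toReal
          / ((k + 1 : ℕ) : ℝ≥0∞) ^ (1 / 2 : ℝ) < ∞),
        (p < 2 → PhiMixing.MZConclusion μ (PhiMixing.filt F0 θ) (PhiMixing.proc μ θ Y f)
          p.toReal (C p.toReal)) ∧
        (2 ≤ p → PhiMixing.LILConclusion μ θ (PhiMixing.filt F0 θ) (PhiMixing.proc μ θ Y f) C') := by
  have hC : ∀ p : ℝ, 1 < p ∧ p < 2 → _ := fun p hp =>
    PhiMixing.exists_maxFun_of_hasSum hp.1 hp.2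
  -- Subadditivity of the weak norm needs an exponent above 1, while `q = 1` is allowed. The
  -- inequality is taken at `(q + 2) / 2`, which lies strictly between 1 and 2 and is at least `q`;
  -- on a probability space weak norms increase with the exponent.
  have hC' : ∀ q : ℝ, 1 ≤ q ∧ q < 2 → _ := fun q hq =>
    PhiMixing.exists_maxFunLIL_of_hasSum (q := (q + 2) / 2) (by linarith [hq.1]) (by linarith [hq.2])
  classical
  choose C hC0 HC using hC
  choose C' hC'0 HC' using hC'
  -- Outside the ranges of the indices the constants are immaterial and are set to 1.
  refine ⟨fun p => if h : 1 < p ∧ p < 2 then C p h else 1,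
    fun q => if h : 1 ≤ q ∧ q < 2 then C' q h else 1, fun p h1 h2 => ?_, fun q h1 h2 => ?_, ?_⟩
  · simp only [dif_pos (⟨h1, h2⟩ : 1 < p ∧ p < 2)]
    exact hC0 p _
  · simp only [dif_pos (⟨h1, h2⟩ : 1 ≤ q ∧ q < 2)]
    exact hC'0 q _
  intro Ω F0 mΩ μ _ θ hθ hm hF Y hY f p hp h1 h2 hs
  have hH := fun {r : ℝ} => PhiMixing.memLp_and_hannan (r := r) hθ hm hF hY hp h1 h2 hs
  have hX0 := PhiMixing.aestronglyMeasurable_center_comp hm hY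
    (PhiMixing.aestronglyMeasurable_of_memMonClosure_or_boundedVariationOn h1 h2)
  rw [PhiMixing.proc_eq hθ]
  set X := PhiMixing.center μ (f ∘ Y) with hX
  have e0 : X ∘ PhiMixing.iter θ 0 = X := by rw [PhiMixing.iter_zero]; rfl
  refine ⟨fun hp2 => ?_, fun hp2 => ?_⟩
  · have hpt : p ≠ ∞ := ne_top_of_lt hp2
    have hp1 : 1 < p.toReal := by
      rwa [← ENNReal.toReal_one, ENNReal.toReal_lt_toReal (by simp) hpt]
    have hp2' : p.toReal < 2 := by
      rwa [← ENNReal.toReal_ofNat 2, ENNReal.toReal_lt_toReal hpt (by simp)]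
    obtain ⟨hXp, hfin, hsum⟩ := hH hp1 hp2'.le (ENNReal.ofReal_toReal hpt).le
    have hn := PhiMixing.hannanNorm_eq_tsum hθ hm hF
      (hXp.integrable (PhiMixing.one_le_ofReal hp1)) hX0 (ENNReal.ofReal p.toReal)
    have h := HC p.toReal ⟨hp1, hp2'⟩
      (fun k : ℕ => PhiMixing.isStationaryMDS_proj hθ hm hF X (-(k : ℤ)))
      (fun k => PhiMixing.MemLp.proj (PhiMixing.one_le_ofReal hp1) hXp _) (hn ▸ hfin) hsum
    rw [← hn] at h
    simp only [PhiMixing.MZConclusion, e0, dif_pos (⟨hp1, hp2'⟩ : 1 < p.toReal ∧ p.toReal < 2)]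
    exact ⟨hXp, hfin.lt_top, h.1, h.2⟩
  · have hr : ENNReal.ofReal 2 = 2 := ENNReal.ofReal_ofNat 2
    -- For every `p ≥ 2`, including `∞`, the argument runs in `L²`; a larger `p` only weakens the
    -- mixing condition.
    obtain ⟨hX2, hfin, hsum⟩ := hH (r := 2) (by norm_num) le_rfl (hr ▸ hp2)
    rw [hr] at hX2 hfin
    have hn := PhiMixing.hannanNorm_eq_tsum hθ hm hF (hX2.integrable (by norm_num)) hX0 2
    simp only [PhiMixing.LILConclusion, e0]
    refine ⟨hX2, hfin.lt_top, fun q hq1 hq2 => ?_,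
      PhiMixing.exists_lil_martingale hθ hm hF hX2 hX0 hfin hsum⟩
    rw [dif_pos (⟨hq1, hq2⟩ : 1 ≤ q ∧ q < 2), hn]
    refine (PhiMixing.weakNorm_le_of_le (by linarith) (show q ≤ (q + 2) / 2 by linarith) _).trans ?_
    exact (HC' q ⟨hq1, hq2⟩
      (fun k : ℕ => PhiMixing.isStationaryMDS_proj hθ hm hF X (-(k : ℤ)))
      (fun k => PhiMixing.MemLp.proj (by norm_num) hX2 _) hsum).1
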